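/- Let $g\ge 2$, let $e_1,\dots,e_{2g+2}$ be distinct complex numbers and let $X$ be the hyperelliptic curve of genus $g$ obtained by compactifying $C_0=\{y^2=f(x)\}$, $f(x)=\prod_k(x-e_k)$: $X$ is $C_0$ glued to $C_0'=\{w^2=\prod_k(1-e_kz)\}$ along $(z,w)=(1/x,\,y/x^{g+1})$. Let $\infty_\pm\in C_0'$ be the two points with $z=0$, let $\iota$ be the hyperelliptic involution $(x,y)\mapsto(x,-y)$, $(z,w)\mapsto(z,-w)$, let $P_k$ be the Weierstrass point with $(x,y)=(e_k,0)$, and let $W=\sum_kP_k$. Equip $X$ with the canonical metric $ds^2=\sum_{i=1}^g\omega_i\otimes\bar\omega_i$, $\omega_i=x^{i-1}dx/y$, that is $ds^2=\frac{\sigma_g(|x|^2)}{|y|^2}\,dx\otimes d\bar x$ with $\sigma_g(t)=1+t+\dots+t^{g-1}$; let $d\nu$ be its area measure, $\Delta$ its Laplace--Beltrami operator and $K$ its Gaussian curvature. Put $N(t)=\big(\sigma_g(|t|^2)(1+|t|^2)^2\big)^{1/(2g+2)}$. For $P\in X\setminus\{\infty_\pm\}$ let $F_P(Q)=|x(Q)-x(P)|/N(x(Q))$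 for $Q\in C_0$ and $F_P(Q)=|1-z(Q)x(P)|/N(z(Q))$ for $Q\in C_0'$; let $F_{\infty_\pm}(Q)=1/N(x(Q))$ for $Q\in C_0$ and $F_{\infty_\pm}(Q)=|z(Q)|/N(z(Q))$ for $Q\in C_0'$. For a divisor $E=\sum n_PP$ put $F_E=\prod F_P^{n_P}$, $u_E=\log F_E$, $\alpha(E)=\sum n_P(P+\iota(P))$ and $\delta_E(\varphi)=\sum n_P\varphi(P)$. **Theorem.** Let $D=\sum_i m_iQ_i$ be an effective divisor on $X$ whose support contains no Weierstrass point, and let $\rho(D)=\deg(W-D)/(g+1)$. Then $v=u_{W-D}$ is smooth on $X\setminus S$, where $S=\operatorname{supp}\alpha(W-D)=\{P_1,\dots,P_{2g+2}\}\cup\{Q_i\}\cup\{\iota(Q_i)\}$, and it satisfies $$\Delta v+4\rho(D)F_De^{v}=\rho(D)K+2\pi\,\delta_{\alpha(W-D)}$$ as distributions on $X$. That is, for every $\varphi\in C^\infty(X,\mathbb C)$ the functions $v\,\Delta\varphi$, $F_De^v\varphi$ and $K\varphi$ are $\nu$-integrable, the limit $$\langle\Delta v,\varphi\rangle=\lim_{\epsilon\to0+}\int_{X\setminus\bigcup_{P\in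 S}D_\epsilon(P)}v\,\Delta\varphi\,d\nu$$ exists, where $D_\epsilon(P)$ is the closed disc of radius $\epsilon$ about $P$ in a local holomorphic coordinate ($x$ at an ordinary point of $C_0$, $\sqrt{x-e_k}$ at $P_k$, $z$ at $\infty_\pm$), and $$\langle\Delta v,\varphi\rangle+4\rho(D)\int_XF_De^v\varphi\,d\nu=\rho(D)\int_XK\varphi\,d\nu+2\pi\,\delta_{\alpha(W-D)}(\varphi).$$ -/

import Mathlib

open scoped Manifold ContDiff Topology
open MeasureTheory Filter

namespace Hyperelliptic

/-! ### Square roots on the slit plane -/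

theorem sqrt_sq (a : ℂ) : Complex.sqrt a ^ 2 = a := by
  unfold Complex.sqrt
  exact Complex.cpow_ofNat_inv_pow a 2

theorem sqrt_re_pos {a : ℂ} (ha : a ∈ Complex.slitPlane) : 0 < (Complex.sqrt a).re := by
  unfold Complex.sqrt
  rw [Complex.cpow_inv_two_re]
  apply Real.sqrt_pos.2
  rcases ha with h | h
  · have := norm_nonneg a
    linarith
  · have := Complex.abs_re_lt_norm.2 h
    have := neg_abs_le a.re
    linarith

theorem sqrt_of_sq {a : ℂ} (ha : 0 < a.re) : Complex.sqrt (a ^ 2) = a := by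
  unfold Complex.sqrt
  exact Complex.sq_cpow_two_inv ha

theorem sq_mem_slitPlane {a : ℂ} (ha : 0 < a.re) : a ^ 2 ∈ Complex.slitPlane := by
  rw [Complex.mem_slitPlane_iff]
  by_cases h : a.im = 0
  · left
    simp [pow_two, h]
    positivity
  · right
    simp only [pow_two, Complex.mul_im]
    intro h'
    apply h
    have : 2 * a.re * a.im = 0 := by linarith
    rcases mul_eq_zero.1 this with h'' | h''
    · linarith
    · exact h''

theorem continuousOn_sqrt : ContinuousOn Complex.sqrt Complex.slitPlane :=
  Complex.differentiableOn_sqrt.continuousOn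

/-! ### The affine plane curve `y² = h(x)` and its coordinates -/

/-- The affine plane curve `{(x, y) ∈ ℂ² : y² = h(x)}` with the subspace topology. -/
abbrev PlaneCurve (h : ℂ → ℂ) : Type := {p : ℂ × ℂ // p.2 ^ 2 = h p.1}

theorem planeCurve_nonempty (h : ℂ → ℂ) : Nonempty (PlaneCurve h) :=
  ⟨⟨(0, Complex.sqrt (h 0)), sqrt_sq _⟩⟩

theorem baseChart_aux {y a : ℂ} (hy : y ≠ 0) : (y * Complex.sqrt (a / y ^ 2)) ^ 2 = a := by
  rw [mul_pow, sqrt_sq, mul_div_cancel₀ _ (pow_ne_zero 2 hy)]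

theorem branchChart_aux {t c d : ℂ} (hc : c ≠ 0) :
    (t * (Complex.sqrt c * Complex.sqrt (d / c))) ^ 2 = t ^ 2 * d := by
  rw [mul_pow, mul_pow, sqrt_sq, sqrt_sq, mul_div_cancel₀ _ hc]

/-- Near a point `p₀ = (x₀, y₀)` with `y₀ ≠ 0` of `y² = h(x)`, the function `x` is a coordinate:
its inverse is `t ↦ (t, √h(t))` with the branch of the square root that is close to `y₀`. -/
noncomputable def baseChart (h : ℂ → ℂ) (hc : Continuous h) (p₀ : PlaneCurve h)
    (hp : p₀.1.2 ≠ 0) : OpenPartialHomeomorph (PlaneCurve h) ℂ where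
  toFun p := p.1.1
  invFun t := ⟨(t, p₀.1.2 * Complex.sqrt (h t / p₀.1.2 ^ 2)), baseChart_aux hp⟩
  source := {p | 0 < (p.1.2 / p₀.1.2).re}
  target := {t | h t / p₀.1.2 ^ 2 ∈ Complex.slitPlane}
  map_source' := by
    intro p hp'
    have := sq_mem_slitPlane hp'
    rwa [div_pow, p.2] at this
  map_target' := by
    intro t ht
    simpa [hp] using sqrt_re_pos ht
  left_inv' := by
    intro p hp'
    have := sqrt_of_sq hp'
    rw [div_pow, p.2] at this
    apply Subtype.ext
    apply Prod.ext
    · rfl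
    · simp only [this]
      field_simp
  right_inv' := by
    intro t _
    rfl
  open_source := isOpen_lt continuous_const
    (Complex.continuous_re.comp ((continuous_snd.comp continuous_subtype_val).div_const _))
  open_target := Complex.isOpen_slitPlane.preimage (hc.div_const _)
  continuousOn_toFun := (continuous_fst.comp continuous_subtype_val).continuousOn
  continuousOn_invFun := by
    refine Topology.IsInducing.subtypeVal.continuousOn_iff.2 ?_
    exact continuousOn_id.prodMk (continuousOn_const.mul
      (continuousOn_sqrt.comp (hc.div_const _).continuousOn (fun t ht => ht)))

/-- Near the point `(a, 0)` of `y² = (x - a) k(x)`, where `k(a) ≠ 0`, the function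
`ζ = √(x - a) = y / √k(x)` is a coordinate, with inverse `ζ ↦ (a + ζ², ζ √k(a + ζ²))`.
The branch of `√k` near `a` is `√k(a) · √(k / k(a))`. -/
noncomputable def branchChart (h k : ℂ → ℂ) (a : ℂ) (hk : ∀ x, h x = (x - a) * k x)
    (hc : Continuous k) (ha : k a ≠ 0) : OpenPartialHomeomorph (PlaneCurve h) ℂ where
  toFun p := p.1.2 / (Complex.sqrt (k a) * Complex.sqrt (k p.1.1 / k a))
  invFun t := ⟨(a + t ^ 2, t * (Complex.sqrt (k a) * Complex.sqrt (k (a + t ^ 2) / k a))),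
    (branchChart_aux ha).trans (by rw [hk, add_sub_cancel_left])⟩
  source := {p | k p.1.1 / k a ∈ Complex.slitPlane}
  target := {t | k (a + t ^ 2) / k a ∈ Complex.slitPlane}
  map_source' := by
    intro p hp
    have h0 : k p.1.1 / k a ≠ 0 := Complex.slitPlane_ne_zero hp
    have h1 : k p.1.1 ≠ 0 := fun h => h0 (by simp [h])
    have e : a + (p.1.2 / (Complex.sqrt (k a) * Complex.sqrt (k p.1.1 / k a))) ^ 2 = p.1.1 := by
      rw [div_pow, mul_pow, sqrt_sq, sqrt_sq, p.2, hk]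
      field_simp
      ring
    simp only [Set.mem_ofPred_eq, e]
    exact hp
  map_target' := by
    intro t ht
    exact ht
  left_inv' := by
    intro p hp
    have h0 : k p.1.1 / k a ≠ 0 := Complex.slitPlane_ne_zero hp
    have h1 : k p.1.1 ≠ 0 := fun h => h0 (by simp [h])
    have e : a + (p.1.2 / (Complex.sqrt (k a) * Complex.sqrt (k p.1.1 / k a))) ^ 2 = p.1.1 := by
      rw [div_pow, mul_pow, sqrt_sq, sqrt_sq, p.2, hk]
      field_simp
      ring
    have s1 : Complex.sqrt (k a) ≠ 0 := fun h => ha (by rw [← sqrt_sq (k a), h]; simp)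
    have s2 : Complex.sqrt (k p.1.1 / k a) ≠ 0 :=
      fun h => h0 (by rw [← sqrt_sq (k p.1.1 / k a), h]; simp)
    apply Subtype.ext
    apply Prod.ext
    · exact e
    · simp only [e]
      field_simp
  right_inv' := by
    intro t ht
    have h0 : k (a + t ^ 2) / k a ≠ 0 := Complex.slitPlane_ne_zero ht
    have s1 : Complex.sqrt (k a) ≠ 0 := fun h => ha (by rw [← sqrt_sq (k a), h]; simp)
    have s2 : Complex.sqrt (k (a + t ^ 2) / k a) ≠ 0 :=
      fun h => h0 (by rw [← sqrt_sq (k (a + t ^ 2) / k a), h]; simp)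
    simp only
    field_simp
  open_source := Complex.isOpen_slitPlane.preimage
    ((hc.comp (continuous_fst.comp continuous_subtype_val)).div_const _)
  open_target := by
    have h1 : Continuous fun t : ℂ => k (a + t ^ 2) / k a := by fun_prop
    exact Complex.isOpen_slitPlane.preimage h1
  continuousOn_toFun := by
    have h1 : Continuous fun p : PlaneCurve h => k p.1.1 / k a :=
      (hc.comp (continuous_fst.comp continuous_subtype_val)).div_const _
    refine (continuous_snd.comp continuous_subtype_val).continuousOn.div
      (continuousOn_const.mul (continuousOn_sqrt.comp h1.continuousOn (fun t ht => ht))) ?_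
    intro p hp
    have h0 : k p.1.1 / k a ≠ 0 := Complex.slitPlane_ne_zero hp
    exact mul_ne_zero (fun h => ha (by rw [← sqrt_sq (k a), h]; simp))
      (fun h => h0 (by rw [← sqrt_sq (k p.1.1 / k a), h]; simp))
  continuousOn_invFun := by
    refine Topology.IsInducing.subtypeVal.continuousOn_iff.2 ?_
    have h1 : Continuous fun t : ℂ => k (a + t ^ 2) / k a := by fun_prop
    have h2 : Continuous fun t : ℂ => a + t ^ 2 := by fun_prop
    exact h2.continuousOn.prodMk
      (continuousOn_id.mul (continuousOn_const.mul
        (continuousOn_sqrt.comp h1.continuousOn (fun t ht => ht))))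

/-! ### The compact hyperelliptic curve -/

/-- `f(x) = ∏ₖ (x - eₖ)`, of degree `2g + 2`, with distinct roots `eₖ`. -/
noncomputable def polyF {g : ℕ} (e : Fin (2 * g + 2) ↪ ℂ) (x : ℂ) : ℂ := ∏ k, (x - e k)

/-- `z ^ (2g + 2) f(1 / z) = ∏ₖ (1 - eₖ z)`. -/
noncomputable def polyG {g : ℕ} (e : Fin (2 * g + 2) ↪ ℂ) (z : ℂ) : ℂ := ∏ k, (1 - e k * z)

/-- `f(x) / (x - eₖ)`. -/
noncomputable def polyFk {g : ℕ} (e : Fin (2 * g + 2) ↪ ℂ) (k : Fin (2 * g + 2)) (x : ℂ) : ℂ :=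
  ∏ j ∈ Finset.univ.erase k, (x - e j)

theorem continuous_polyF {g : ℕ} (e : Fin (2 * g + 2) ↪ ℂ) : Continuous (polyF e) := by
  unfold polyF; fun_prop

theorem continuous_polyG {g : ℕ} (e : Fin (2 * g + 2) ↪ ℂ) : Continuous (polyG e) := by
  unfold polyG; fun_prop

theorem continuous_polyFk {g : ℕ} (e : Fin (2 * g + 2) ↪ ℂ) (k : Fin (2 * g + 2)) :
    Continuous (polyFk e k) := by
  unfold polyFk; fun_prop

theorem polyF_eq {g : ℕ} (e : Fin (2 * g + 2) ↪ ℂ) (k : Fin (2 * g + 2)) (x : ℂ) :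
    polyF e x = (x - e k) * polyFk e k x :=
  (Finset.mul_prod_erase _ _ (Finset.mem_univ k)).symm

theorem polyFk_ne_zero {g : ℕ} (e : Fin (2 * g + 2) ↪ ℂ) (k : Fin (2 * g + 2)) :
    polyFk e k (e k) ≠ 0 := by
  unfold polyFk
  rw [Finset.prod_ne_zero_iff]
  intro j hj h
  exact (Finset.mem_erase.1 hj).1 (e.injective (sub_eq_zero.1 h)).symm

theorem polyG_eq {g : ℕ} (e : Fin (2 * g + 2) ↪ ℂ) {x z : ℂ} (h : x * z = 1) :
    polyG e z = z ^ (2 * g + 2) * polyF e x := by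
  unfold polyG polyF
  have : z ^ (2 * g + 2) = ∏ _k : Fin (2 * g + 2), z := by simp
  rw [this, ← Finset.prod_mul_distrib]
  refine Finset.prod_congr rfl fun k _ => ?_
  linear_combination -h

/-- The relation that glues `C₀ = {y² = f(x)}` to `C₀' = {w² = g(z)}` along the isomorphism
`(x, y) ↦ (z, w) = (1 / x, y / x ^ (g + 1))` from `{x ≠ 0}` to `{z ≠ 0}`. -/
def GlueRel {g : ℕ} (e : Fin (2 * g + 2) ↪ ℂ) :
    PlaneCurve (polyF e) ⊕ PlaneCurve (polyG e) → PlaneCurve (polyF e) ⊕ PlaneCurve (polyG e) →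
      Prop
  | .inl p, .inl p' => p = p'
  | .inr q, .inr q' => q = q'
  | .inl p, .inr q => p.1.1 * q.1.1 = 1 ∧ q.1.2 = p.1.2 / p.1.1 ^ (g + 1)
  | .inr q, .inl p => p.1.1 * q.1.1 = 1 ∧ q.1.2 = p.1.2 / p.1.1 ^ (g + 1)

theorem glue_left {a a' b c c' d : ℂ} {n : ℕ} (h : a * b = 1) (h' : a' * b = 1)
    (k : d = c / a ^ n) (k' : d = c' / a' ^ n) : a = a' ∧ c = c' := by
  have hb : b ≠ 0 := right_ne_zero_of_mul_eq_one h
  have ha : a ≠ 0 := left_ne_zero_of_mul_eq_one h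
  have e : a = a' := mul_right_cancel₀ hb (h.trans h'.symm)
  subst e
  refine ⟨rfl, ?_⟩
  rw [k] at k'
  field_simp at k'
  exact k'

theorem glueRel_equivalence {g : ℕ} (e : Fin (2 * g + 2) ↪ ℂ) : Equivalence (GlueRel e) where
  refl := by
    rintro (p | q) <;> rfl
  symm := by
    rintro (p | q) (p' | q') h
    · exact Eq.symm h
    · exact h
    · exact h
    · exact Eq.symm h
  trans := by
    rintro (p | q) (p' | q') (p'' | q'') h h'
    · exact Eq.trans h h'
    · cases h; exact h'
    · obtain ⟨h1, h2⟩ := glue_left h.1 h'.1 h.2 h'.2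
      exact Subtype.ext (Prod.ext h1 h2)
    · cases h'; exact h
    · cases h'; exact h
    · have hx : p'.1.1 ≠ 0 := left_ne_zero_of_mul_eq_one h.1
      exact Subtype.ext (Prod.ext (mul_left_cancel₀ hx (h.1.trans h'.1.symm))
        (h.2.trans h'.2.symm))
    · cases h; exact h'
    · exact Eq.trans h h'

/-- The gluing as a setoid on the disjoint union. -/
def glueSetoid {g : ℕ} (e : Fin (2 * g + 2) ↪ ℂ) :
    Setoid (PlaneCurve (polyF e) ⊕ PlaneCurve (polyG e)) :=
  ⟨GlueRel e, glueRel_equivalence e⟩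

/-- The complex hyperelliptic curve `X` of genus `g`: the compactification of
`y² = ∏ₖ (x - eₖ)`, obtained by gluing `C₀` and `C₀'`, with the quotient topology. -/
def Curve {g : ℕ} (e : Fin (2 * g + 2) ↪ ℂ) : Type := Quotient (glueSetoid e)

instance {g : ℕ} (e : Fin (2 * g + 2) ↪ ℂ) : TopologicalSpace (Curve e) :=
  inferInstanceAs (TopologicalSpace (Quotient (glueSetoid e)))

instance {g : ℕ} (e : Fin (2 * g + 2) ↪ ℂ) : MeasurableSpace (Curve e) := borel _

instance {g : ℕ} (e : Fin (2 * g + 2) ↪ ℂ) : BorelSpace (Curve e) := ⟨rfl⟩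

section Gluing

variable {g : ℕ} (e : Fin (2 * g + 2) ↪ ℂ)

/-- The inclusion `C₀ → X`. -/
def ofAffine (p : PlaneCurve (polyF e)) : Curve e := Quotient.mk (glueSetoid e) (.inl p)

/-- The inclusion `C₀' → X`. -/
def ofInfinite (q : PlaneCurve (polyG e)) : Curve e := Quotient.mk (glueSetoid e) (.inr q)

theorem ofAffine_injective : Function.Injective (ofAffine e) :=
  fun _ _ h => Quotient.exact h

theorem ofInfinite_injective : Function.Injective (ofInfinite e) :=
  fun _ _ h => Quotient.exact h

theorem ofAffine_eq_ofInfinite {p : PlaneCurve (polyF e)} {q : PlaneCurve (polyG e)} :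
    ofAffine e p = ofInfinite e q ↔ p.1.1 * q.1.1 = 1 ∧ q.1.2 = p.1.2 / p.1.1 ^ (g + 1) :=
  ⟨fun h => Quotient.exact h, fun h => Quotient.sound (s := glueSetoid e) h⟩

theorem continuous_ofAffine : Continuous (ofAffine e) :=
  continuous_quotient_mk'.comp continuous_inl

theorem continuous_ofInfinite : Continuous (ofInfinite e) :=
  continuous_quotient_mk'.comp continuous_inr

theorem isOpen_iff_preimage {U : Set (Curve e)} :
    IsOpen U ↔ IsOpen (ofAffine e ⁻¹' U) ∧ IsOpen (ofInfinite e ⁻¹' U) := by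
  refine ⟨fun h => ⟨h.preimage (continuous_ofAffine e), h.preimage (continuous_ofInfinite e)⟩,
    fun h => ?_⟩
  have : IsOpen ((Quotient.mk (glueSetoid e)) ⁻¹' U) := isOpen_sum_iff.2 h
  exact this

/-- The gluing map `(x, y) ↦ (1 / x, y / x ^ (g + 1))`. -/
noncomputable def toInfinite (p : PlaneCurve (polyF e)) (hp : p.1.1 ≠ 0) : PlaneCurve (polyG e) :=
  ⟨(p.1.1⁻¹, p.1.2 / p.1.1 ^ (g + 1)), by
    rw [polyG_eq e (mul_inv_cancel₀ hp), ← p.2, inv_pow, div_pow, ← pow_mul, add_mul, one_mul,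
      mul_comm g 2, div_eq_mul_inv, mul_comm]⟩

/-- The inverse gluing map `(z, w) ↦ (1 / z, w / z ^ (g + 1))`. -/
noncomputable def toAffine (q : PlaneCurve (polyG e)) (hq : q.1.1 ≠ 0) : PlaneCurve (polyF e) :=
  ⟨(q.1.1⁻¹, q.1.2 / q.1.1 ^ (g + 1)), by
    rw [div_pow, q.2, polyG_eq e (inv_mul_cancel₀ hq), ← pow_mul, add_mul, one_mul,
      mul_comm g 2, mul_div_cancel_left₀ _ (pow_ne_zero _ hq)]⟩

theorem ofInfinite_toInfinite (p : PlaneCurve (polyF e)) (hp : p.1.1 ≠ 0) :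
    ofInfinite e (toInfinite e p hp) = ofAffine e p :=
  ((ofAffine_eq_ofInfinite e).2 ⟨mul_inv_cancel₀ hp, rfl⟩).symm

theorem ofAffine_toAffine (q : PlaneCurve (polyG e)) (hq : q.1.1 ≠ 0) :
    ofAffine e (toAffine e q hq) = ofInfinite e q := by
  refine (ofAffine_eq_ofInfinite e).2 ⟨inv_mul_cancel₀ hq, ?_⟩
  simp only [toAffine]
  rw [inv_pow, div_inv_eq_mul, div_mul_cancel₀ _ (pow_ne_zero _ hq)]

theorem isOpen_of_chart {h h' : ℂ → ℂ} {V : Set (PlaneCurve h)} (hV : IsOpen V)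
    (S : Set (PlaneCurve h')) (φ : ∀ q : PlaneCurve h', q.1.1 ≠ 0 → PlaneCurve h)
    (hφ : Continuous fun q : {q : PlaneCurve h' // q.1.1 ≠ 0} => φ q.1 q.2)
    (hS : ∀ q, q ∈ S ↔ ∃ hq : q.1.1 ≠ 0, φ q hq ∈ V) : IsOpen S := by
  have hopen : IsOpen {q : PlaneCurve h' | q.1.1 ≠ 0} :=
    isOpen_ne_fun (continuous_fst.comp continuous_subtype_val) continuous_const
  have h2 := hopen.isOpenMap_subtype_val _ (hV.preimage hφ)
  convert h2 using 1
  ext q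
  rw [hS]
  constructor
  · rintro ⟨hq, hv⟩
    exact ⟨⟨q, hq⟩, hv, rfl⟩
  · rintro ⟨⟨q', hq⟩, hv, rfl⟩
    exact ⟨hq, hv⟩

theorem continuous_toInfinite :
    Continuous fun p : {p : PlaneCurve (polyF e) // p.1.1 ≠ 0} => toInfinite e p.1 p.2 := by
  have h1 : Continuous fun p : {p : PlaneCurve (polyF e) // p.1.1 ≠ 0} => p.1.1.1 := by fun_prop
  have h2 : Continuous fun p : {p : PlaneCurve (polyF e) // p.1.1 ≠ 0} => p.1.1.2 := by fun_prop
  exact ((h1.inv₀ fun p => p.2).prodMk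
    (h2.div (h1.pow _) fun p => pow_ne_zero _ p.2)).subtype_mk _

theorem continuous_toAffine :
    Continuous fun q : {q : PlaneCurve (polyG e) // q.1.1 ≠ 0} => toAffine e q.1 q.2 := by
  have h1 : Continuous fun p : {p : PlaneCurve (polyG e) // p.1.1 ≠ 0} => p.1.1.1 := by fun_prop
  have h2 : Continuous fun p : {p : PlaneCurve (polyG e) // p.1.1 ≠ 0} => p.1.1.2 := by fun_prop
  exact ((h1.inv₀ fun p => p.2).prodMk
    (h2.div (h1.pow _) fun p => pow_ne_zero _ p.2)).subtype_mk _

theorem isOpenEmbedding_ofAffine : Topology.IsOpenEmbedding (ofAffine e) := by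
  refine .of_continuous_injective_isOpenMap (continuous_ofAffine e) (ofAffine_injective e) ?_
  intro V hV
  refine (isOpen_iff_preimage e).2 ⟨?_, ?_⟩
  · rwa [Set.preimage_image_eq _ (ofAffine_injective e)]
  · refine isOpen_of_chart hV _ (toAffine e) (continuous_toAffine e) fun q => ?_
    constructor
    · rintro ⟨p, hp, hpq⟩
      have h := (ofAffine_eq_ofInfinite e).1 hpq
      have hq : q.1.1 ≠ 0 := right_ne_zero_of_mul_eq_one h.1
      refine ⟨hq, ?_⟩
      rw [← ofAffine_toAffine e q hq] at hpq
      rwa [← ofAffine_injective e hpq]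
    · rintro ⟨hq, hv⟩
      exact ⟨_, hv, ofAffine_toAffine e q hq⟩

theorem isOpenEmbedding_ofInfinite : Topology.IsOpenEmbedding (ofInfinite e) := by
  refine .of_continuous_injective_isOpenMap (continuous_ofInfinite e) (ofInfinite_injective e) ?_
  intro V hV
  refine (isOpen_iff_preimage e).2 ⟨?_, ?_⟩
  · refine isOpen_of_chart hV _ (toInfinite e) (continuous_toInfinite e) fun p => ?_
    constructor
    · rintro ⟨q, hq, hpq⟩
      have h := (ofAffine_eq_ofInfinite e).1 hpq.symm
      have hp : p.1.1 ≠ 0 := left_ne_zero_of_mul_eq_one h.1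
      refine ⟨hp, ?_⟩
      rw [← ofInfinite_toInfinite e p hp] at hpq
      rwa [← ofInfinite_injective e hpq]
    · rintro ⟨hq, hv⟩
      exact ⟨_, hv, ofInfinite_toInfinite e p hq⟩
  · rwa [Set.preimage_image_eq _ (ofInfinite_injective e)]

theorem exists_eq (P : Curve e) :
    (∃ p, ofAffine e p = P) ∨ ∃ q, q.1.1 = 0 ∧ ofInfinite e q = P := by
  induction P using Quotient.inductionOn with
  | h s =>
    rcases s with p | q
    · exact .inl ⟨p, rfl⟩
    · by_cases hq : q.1.1 = 0
      · exact .inr ⟨q, hq, rfl⟩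
      · exact .inl ⟨_, ofAffine_toAffine e q hq⟩

/-- The meromorphic function `x` on `X` (with the value `0` assigned at its poles). -/
noncomputable def xCoord : Curve e → ℂ :=
  Quotient.lift (s := glueSetoid e) (Sum.elim (fun p => p.1.1) fun q => q.1.1⁻¹) <| by
    rintro (p | q) (p' | q') h
    · cases (show p = p' from h)
      rfl
    · exact eq_inv_of_mul_eq_one_left (show p.1.1 * q'.1.1 = 1 from h.1)
    · exact (eq_inv_of_mul_eq_one_left (show p'.1.1 * q.1.1 = 1 from h.1)).symm
    · cases (show q = q' from h)
      rfl

theorem glue_snd {x y z w : ℂ} {n : ℕ} (h : x * z = 1 ∧ w = y / x ^ n) : y = w / z ^ n := by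
  have hx : x ≠ 0 := left_ne_zero_of_mul_eq_one h.1
  rw [h.2, eq_inv_of_mul_eq_one_right h.1, inv_pow, div_inv_eq_mul,
    div_mul_cancel₀ _ (pow_ne_zero _ hx)]

/-- The meromorphic function `y` on `X` (with the value `0` assigned at its poles). -/
noncomputable def yCoord : Curve e → ℂ :=
  Quotient.lift (s := glueSetoid e)
    (Sum.elim (fun p => p.1.2) fun q => q.1.2 / q.1.1 ^ (g + 1)) <| by
    rintro (p | q) (p' | q') h
    · cases (show p = p' from h)
      rfl
    · exact glue_snd h
    · exact (glue_snd h).symm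
    · cases (show q = q' from h)
      rfl

/-- The meromorphic function `z = 1 / x` on `X` (with the value `0` assigned at its poles). -/
noncomputable def zCoord : Curve e → ℂ :=
  Quotient.lift (s := glueSetoid e) (Sum.elim (fun p => p.1.1⁻¹) fun q => q.1.1) <| by
    rintro (p | q) (p' | q') h
    · cases (show p = p' from h)
      rfl
    · exact (eq_inv_of_mul_eq_one_right (show p.1.1 * q'.1.1 = 1 from h.1)).symm
    · exact eq_inv_of_mul_eq_one_right (show p'.1.1 * q.1.1 = 1 from h.1)
    · cases (show q = q' from h)
      rfl

/-- The meromorphic function `w = y / x ^ (g + 1)` on `X` (with the value `0` assigned at its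
poles). -/
noncomputable def wCoord : Curve e → ℂ :=
  Quotient.lift (s := glueSetoid e)
    (Sum.elim (fun p => p.1.2 / p.1.1 ^ (g + 1)) fun q => q.1.2) <| by
    rintro (p | q) (p' | q') h
    · cases (show p = p' from h)
      rfl
    · exact (show q'.1.2 = p.1.2 / p.1.1 ^ (g + 1) from h.2).symm
    · exact (show q.1.2 = p'.1.2 / p'.1.1 ^ (g + 1) from h.2)
    · cases (show q = q' from h)
      rfl

/-- The Weierstrass point `Pₖ`, with `(x, y) = (eₖ, 0)`. -/
def weierstrassPoint (k : Fin (2 * g + 2)) : Curve e :=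
  ofAffine e ⟨(e k, 0), by simp [polyF_eq e k]⟩

theorem glue_neg {p : PlaneCurve (polyF e)} {q : PlaneCurve (polyG e)}
    (h : p.1.1 * q.1.1 = 1 ∧ q.1.2 = p.1.2 / p.1.1 ^ (g + 1)) :
    ofAffine e ⟨(p.1.1, -p.1.2), by simpa using p.2⟩ =
      ofInfinite e ⟨(q.1.1, -q.1.2), by simpa using q.2⟩ := by
  refine (ofAffine_eq_ofInfinite e).2 ⟨h.1, ?_⟩
  change -q.1.2 = -p.1.2 / p.1.1 ^ (g + 1)
  rw [h.2, neg_div]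

/-- The hyperelliptic involution `ι`, given by `(x, y) ↦ (x, -y)` and `(z, w) ↦ (z, -w)`. -/
def involution : Curve e → Curve e :=
  Quotient.lift (s := glueSetoid e)
    (Sum.elim (fun p => ofAffine e ⟨(p.1.1, -p.1.2), by simpa using p.2⟩)
      fun q => ofInfinite e ⟨(q.1.1, -q.1.2), by simpa using q.2⟩) <| by
    rintro (p | q) (p' | q') h
    · cases (show p = p' from h)
      rfl
    · exact glue_neg e h
    · exact (glue_neg e h).symm
    · cases (show q = q' from h)
      rfl

/-! ### The complex structure -/

/-- The coordinate `x` near `(x₀, y₀) ∈ C₀` with `y₀ ≠ 0`. -/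
noncomputable def affineChart (p : PlaneCurve (polyF e)) (hp : p.1.2 ≠ 0) :
    OpenPartialHomeomorph (Curve e) ℂ :=
  haveI := planeCurve_nonempty (polyF e)
  ((isOpenEmbedding_ofAffine e).toOpenPartialHomeomorph (ofAffine e)).symm.trans
    (baseChart (polyF e) (continuous_polyF e) p hp)

/-- The coordinate `ζ = √(x - eₖ)` near the Weierstrass point `Pₖ`. -/
noncomputable def weierstrassChart (k : Fin (2 * g + 2)) :
    OpenPartialHomeomorph (Curve e) ℂ :=
  haveI := planeCurve_nonempty (polyF e)
  ((isOpenEmbedding_ofAffine e).toOpenPartialHomeomorph (ofAffine e)).symm.trans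
    (branchChart (polyF e) (polyFk e k) (e k) (polyF_eq e k) (continuous_polyFk e k)
      (polyFk_ne_zero e k))

/-- The coordinate `z` near `(z₀, w₀) ∈ C₀'` with `w₀ ≠ 0`. -/
noncomputable def infiniteChart (q : PlaneCurve (polyG e)) (hq : q.1.2 ≠ 0) :
    OpenPartialHomeomorph (Curve e) ℂ :=
  haveI := planeCurve_nonempty (polyG e)
  ((isOpenEmbedding_ofInfinite e).toOpenPartialHomeomorph (ofInfinite e)).symm.trans
    (baseChart (polyG e) (continuous_polyG e) q hq)

theorem snd_ne_zero_of_fst_eq_zero {q : PlaneCurve (polyG e)} (hq : q.1.1 = 0) : q.1.2 ≠ 0 := by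
  intro h
  have := q.2
  rw [hq, h] at this
  simp [polyG] at this

theorem point_cases (P : Curve e) :
    (∃ p, p.1.2 ≠ 0 ∧ ofAffine e p = P) ∨ (∃ k, weierstrassPoint e k = P) ∨
      ∃ q, q.1.1 = 0 ∧ ofInfinite e q = P := by
  rcases exists_eq e P with ⟨p, rfl⟩ | h
  · by_cases hp : p.1.2 = 0
    · right; left
      have h0 : polyF e p.1.1 = 0 := by rw [← p.2, hp]; simp
      obtain ⟨k, -, hk⟩ := Finset.prod_eq_zero_iff.1 h0
      refine ⟨k, congrArg _ (Subtype.ext (Prod.ext ?_ hp.symm))⟩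
      exact (sub_eq_zero.1 hk).symm
    · exact .inl ⟨p, hp, rfl⟩
  · exact .inr (.inr h)

theorem mem_affineChart_source (p : PlaneCurve (polyF e)) (hp : p.1.2 ≠ 0) :
    ofAffine e p ∈ (affineChart e p hp).source := by
  have := planeCurve_nonempty (polyF e)
  simp [affineChart, baseChart, Topology.IsOpenEmbedding.toOpenPartialHomeomorph_left_inv, hp]

theorem mem_weierstrassChart_source (k : Fin (2 * g + 2)) :
    weierstrassPoint e k ∈ (weierstrassChart e k).source := by
  have := planeCurve_nonempty (polyF e)
  simp [weierstrassChart, weierstrassPoint, branchChart, polyFk_ne_zero,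
    Topology.IsOpenEmbedding.toOpenPartialHomeomorph_left_inv]

theorem mem_infiniteChart_source (q : PlaneCurve (polyG e)) (hq : q.1.2 ≠ 0) :
    ofInfinite e q ∈ (infiniteChart e q hq).source := by
  have := planeCurve_nonempty (polyG e)
  simp [infiniteChart, baseChart, Topology.IsOpenEmbedding.toOpenPartialHomeomorph_left_inv, hq]

/-- The holomorphic coordinates `x`, `ζ`, `z`. -/
def curveAtlas : Set (OpenPartialHomeomorph (Curve e) ℂ) :=
  {ψ | (∃ p hp, ψ = affineChart e p hp) ∨ (∃ k, ψ = weierstrassChart e k) ∨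
    ∃ q hq, ψ = infiniteChart e q hq}

theorem exists_chart (P : Curve e) : ∃ ψ : OpenPartialHomeomorph (Curve e) ℂ,
    (∃ p hp, ofAffine e p = P ∧ ψ = affineChart e p hp) ∨
      (∃ k, weierstrassPoint e k = P ∧ ψ = weierstrassChart e k) ∨
        ∃ q hq, q.1.1 = 0 ∧ ofInfinite e q = P ∧ ψ = infiniteChart e q hq := by
  rcases point_cases e P with ⟨p, hp, h⟩ | ⟨k, h⟩ | ⟨q, hq, h⟩
  · exact ⟨_, .inl ⟨p, hp, h, rfl⟩⟩
  · exact ⟨_, .inr (.inl ⟨k, h, rfl⟩)⟩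
  · exact ⟨_, .inr (.inr ⟨q, snd_ne_zero_of_fst_eq_zero e hq, hq, h, rfl⟩)⟩

/-- The preferred coordinate at `P`: `x` if `P ∈ C₀` is not a Weierstrass point, `ζ` if `P` is a
Weierstrass point, and `z` if `P` is one of the two points `∞±` at infinity. -/
noncomputable def chart (P : Curve e) : OpenPartialHomeomorph (Curve e) ℂ :=
  (exists_chart e P).choose

theorem mem_chart_source (P : Curve e) : P ∈ (chart e P).source := by
  unfold chart
  rcases (exists_chart e P).choose_spec with ⟨p, hp, h, h'⟩ | ⟨k, h, h'⟩ | ⟨q, hq, -, h, h'⟩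
  · rw [h', ← h]; exact mem_affineChart_source e p hp
  · rw [h', ← h]; exact mem_weierstrassChart_source e k
  · rw [h', ← h]; exact mem_infiniteChart_source e q hq

theorem chart_mem_atlas (P : Curve e) : chart e P ∈ curveAtlas e := by
  rcases (exists_chart e P).choose_spec with ⟨p, hp, -, h'⟩ | ⟨k, -, h'⟩ | ⟨q, hq, -, -, h'⟩
  · exact .inl ⟨p, hp, h'⟩
  · exact .inr (.inl ⟨k, h'⟩)
  · exact .inr (.inr ⟨q, hq, h'⟩)

noncomputable instance : ChartedSpace ℂ (Curve e) where
  atlas := curveAtlas e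
  chartAt := chart e
  mem_chart_source := mem_chart_source e
  chart_mem_atlas := chart_mem_atlas e

/-! The transition maps are holomorphic. -/

theorem affineChart_apply (p : PlaneCurve (polyF e)) (hp : p.1.2 ≠ 0) {P : Curve e}
    (hP : P ∈ (affineChart e p hp).source) :
    P ∈ Set.range (ofAffine e) ∧ affineChart e p hp P = xCoord e P := by
  have := planeCurve_nonempty (polyF e)
  obtain ⟨p', rfl⟩ : P ∈ Set.range (ofAffine e) := by
    have := hP.1
    simpa using this
  refine ⟨⟨p', rfl⟩, ?_⟩
  simp [affineChart, baseChart, Topology.IsOpenEmbedding.toOpenPartialHomeomorph_left_inv]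
  rfl

theorem weierstrassChart_apply (k : Fin (2 * g + 2)) {P : Curve e}
    (hP : P ∈ (weierstrassChart e k).source) :
    P ∈ Set.range (ofAffine e) ∧ polyFk e k (xCoord e P) / polyFk e k (e k) ∈ Complex.slitPlane ∧
      weierstrassChart e k P = yCoord e P / (Complex.sqrt (polyFk e k (e k)) *
        Complex.sqrt (polyFk e k (xCoord e P) / polyFk e k (e k))) := by
  have := planeCurve_nonempty (polyF e)
  obtain ⟨p', rfl⟩ : P ∈ Set.range (ofAffine e) := by
    have := hP.1
    simpa using this
  refine ⟨⟨p', rfl⟩, ?_, ?_⟩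
  · have := hP.2
    simp [branchChart, Topology.IsOpenEmbedding.toOpenPartialHomeomorph_left_inv] at this
    exact this
  · simp [weierstrassChart, branchChart,
      Topology.IsOpenEmbedding.toOpenPartialHomeomorph_left_inv]
    rfl

theorem infiniteChart_apply (q : PlaneCurve (polyG e)) (hq : q.1.2 ≠ 0) {P : Curve e}
    (hP : P ∈ (infiniteChart e q hq).source) :
    P ∈ Set.range (ofInfinite e) ∧ infiniteChart e q hq P = zCoord e P := by
  have := planeCurve_nonempty (polyG e)
  obtain ⟨p', rfl⟩ : P ∈ Set.range (ofInfinite e) := by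
    have := hP.1
    simpa using this
  refine ⟨⟨p', rfl⟩, ?_⟩
  simp [infiniteChart, baseChart, Topology.IsOpenEmbedding.toOpenPartialHomeomorph_left_inv]
  rfl

theorem differentiableAt_polyF (t : ℂ) : DifferentiableAt ℂ (polyF e) t := by
  unfold polyF; fun_prop

theorem differentiableAt_polyG (t : ℂ) : DifferentiableAt ℂ (polyG e) t := by
  unfold polyG; fun_prop

theorem differentiableAt_polyFk (k : Fin (2 * g + 2)) (t : ℂ) :
    DifferentiableAt ℂ (polyFk e k) t := by
  unfold polyFk; fun_prop

theorem ofAffine_mem_infinite {p : PlaneCurve (polyF e)} :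
    ofAffine e p ∈ Set.range (ofInfinite e) ↔ p.1.1 ≠ 0 := by
  constructor
  · rintro ⟨q, h⟩
    exact left_ne_zero_of_mul_eq_one ((ofAffine_eq_ofInfinite e).1 h.symm).1
  · intro h
    exact ⟨_, ofInfinite_toInfinite e p h⟩

theorem ofInfinite_mem_affine {q : PlaneCurve (polyG e)} :
    ofInfinite e q ∈ Set.range (ofAffine e) ↔ q.1.1 ≠ 0 := by
  constructor
  · rintro ⟨q, h⟩
    exact right_ne_zero_of_mul_eq_one ((ofAffine_eq_ofInfinite e).1 h).1
  · intro h
    exact ⟨_, ofAffine_toAffine e q h⟩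

/-- The coordinates `x, y` and `z` are holomorphic in every chart, away from their poles. -/
theorem differentiableAt_coord {ψ : OpenPartialHomeomorph (Curve e) ℂ} (hψ : ψ ∈ curveAtlas e)
    {t : ℂ} (ht : t ∈ ψ.target) :
    (ψ.symm t ∈ Set.range (ofAffine e) →
      DifferentiableAt ℂ (fun s => xCoord e (ψ.symm s)) t ∧
        DifferentiableAt ℂ (fun s => yCoord e (ψ.symm s)) t) ∧
    (ψ.symm t ∈ Set.range (ofInfinite e) →
      DifferentiableAt ℂ (fun s => zCoord e (ψ.symm s)) t) := by
  rcases hψ with ⟨p, hp, rfl⟩ | ⟨k, rfl⟩ | ⟨q, hq, rfl⟩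
  · have := planeCurve_nonempty (polyF e)
    have ht' : polyF e t / p.1.2 ^ 2 ∈ Complex.slitPlane := by
      have := ht.1
      exact this
    refine ⟨fun _ => ⟨differentiableAt_id, ?_⟩, fun h => ?_⟩
    · change DifferentiableAt ℂ
        (fun s => p.1.2 * Complex.sqrt (polyF e s / p.1.2 ^ 2)) t
      exact (DifferentiableAt.comp t (Complex.differentiableAt_sqrt ht')
        ((differentiableAt_polyF e t).div_const _)).const_mul _
    · have h0 : t ≠ 0 := (ofAffine_mem_infinite e).1 h
      change DifferentiableAt ℂ (fun s : ℂ => s⁻¹) t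
      exact differentiableAt_inv h0
  · have := planeCurve_nonempty (polyF e)
    have ht' : polyFk e k (e k + t ^ 2) / polyFk e k (e k) ∈ Complex.slitPlane := by
      have := ht.1
      exact this
    have d1 : DifferentiableAt ℂ (fun s : ℂ => e k + s ^ 2) t := by fun_prop
    refine ⟨fun _ => ⟨d1, ?_⟩, fun h => ?_⟩
    · change DifferentiableAt ℂ (fun s => s * (Complex.sqrt (polyFk e k (e k)) *
        Complex.sqrt (polyFk e k (e k + s ^ 2) / polyFk e k (e k)))) t
      have d2 : DifferentiableAt ℂ
          (fun s => polyFk e k (e k + s ^ 2) / polyFk e k (e k)) t :=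
        (DifferentiableAt.comp t (differentiableAt_polyFk e k _) d1).div_const _
      exact differentiableAt_id.mul
        ((DifferentiableAt.comp t (Complex.differentiableAt_sqrt ht') d2).const_mul _)
    · have h0 : e k + t ^ 2 ≠ 0 := (ofAffine_mem_infinite e).1 h
      change DifferentiableAt ℂ (fun s : ℂ => (e k + s ^ 2)⁻¹) t
      exact d1.inv h0
  · have := planeCurve_nonempty (polyG e)
    have ht' : polyG e t / q.1.2 ^ 2 ∈ Complex.slitPlane := by
      have := ht.1
      exact this
    refine ⟨fun h => ?_, fun _ => differentiableAt_id⟩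
    have h0 : t ≠ 0 := (ofInfinite_mem_affine e).1 h
    constructor
    · change DifferentiableAt ℂ (fun s : ℂ => s⁻¹) t
      exact differentiableAt_inv h0
    · change DifferentiableAt ℂ
        (fun s => q.1.2 * Complex.sqrt (polyG e s / q.1.2 ^ 2) / s ^ (g + 1)) t
      exact ((DifferentiableAt.comp t (Complex.differentiableAt_sqrt ht')
        ((differentiableAt_polyG e t).div_const _)).const_mul _).div
        (differentiableAt_pow _) (pow_ne_zero _ h0)

/-- `X` is a Riemann surface. -/
instance : IsManifold 𝓘(ℂ) ω (Curve e) := by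
  refine isManifold_of_contDiffOn _ _ _ fun ψ ψ' hψ hψ' => ?_
  simp only [modelWithCornersSelf_coe, modelWithCornersSelf_coe_symm, Function.id_comp,
    Function.comp_id, Set.preimage_id, Set.range_id, Set.inter_univ]
  refine DifferentiableOn.contDiffOn ?_ (ψ.symm.trans ψ').open_source
  intro t ht
  have ht1 : t ∈ ψ.target := ht.1
  have ht2 : ψ.symm t ∈ ψ'.source := ht.2
  have hd := differentiableAt_coord e hψ ht1
  have key : ∀ F : ℂ → ℂ, DifferentiableAt ℂ F t →
      (∀ s ∈ (ψ.symm.trans ψ').source, ψ' (ψ.symm s) = F s) →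
      DifferentiableWithinAt ℂ (ψ.symm.trans ψ') (ψ.symm.trans ψ').source t :=
    fun F hF h => hF.differentiableWithinAt.congr h (h t ht)
  rcases hψ' with ⟨p, hp, rfl⟩ | ⟨k, rfl⟩ | ⟨q, hq, rfl⟩
  · exact key _ (hd.1 (affineChart_apply e p hp ht2).1).1
      fun s hs => (affineChart_apply e p hp hs.2).2
  · obtain ⟨h1, h2, -⟩ := weierstrassChart_apply e k ht2
    obtain ⟨d1, d2⟩ := hd.1 h1
    have s1 : Complex.sqrt (polyFk e k (e k)) ≠ 0 := fun h =>
      polyFk_ne_zero e k (by rw [← sqrt_sq (polyFk e k (e k)), h]; simp)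
    have s2 := Complex.slitPlane_ne_zero h2
    rw [← sqrt_sq (polyFk e k (xCoord e (ψ.symm t)) / polyFk e k (e k))] at s2
    refine key _ (d2.div ((DifferentiableAt.comp t (Complex.differentiableAt_sqrt h2)
      ((DifferentiableAt.comp t (differentiableAt_polyFk e k _) d1).div_const _)).const_mul _)
      (mul_ne_zero s1 fun h => s2 ?_)) fun s hs => (weierstrassChart_apply e k hs.2).2.2
    simp only [Function.comp_def] at h
    rw [h]; simp
  · exact key _ (hd.2 (infiniteChart_apply e q hq ht2).1)
      fun s hs => (infiniteChart_apply e q hq hs.2).2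

/-! ### The canonical metric, its area measure, Laplacian and Gaussian curvature -/

open Classical in
/-- The coefficient at `t` of the holomorphic one-form `ω = x ^ i dx / y`, `0 ≤ i ≤ g - 1`, in the
local coordinate `ψ`. At zeros of `y` one uses `dx / y = 2 dy / f'(x)`, and at `∞±` one uses
`x ^ i dx / y = - z ^ (g - 1 - i) dz / w`. -/
noncomputable def formCoeff (i : Fin g) (ψ : OpenPartialHomeomorph (Curve e) ℂ) (t : ℂ) : ℂ :=
  if ψ.symm t ∈ Set.range (ofAffine e) then
    if yCoord e (ψ.symm t) ≠ 0 then
      xCoord e (ψ.symm t) ^ (i : ℕ) * deriv (fun s => xCoord e (ψ.symm s)) t / yCoord e (ψ.symm t)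
    else
      xCoord e (ψ.symm t) ^ (i : ℕ) * (2 * deriv (fun s => yCoord e (ψ.symm s)) t) /
        deriv (polyF e) (xCoord e (ψ.symm t))
  else
    -zCoord e (ψ.symm t) ^ (g - 1 - (i : ℕ)) * deriv (fun s => zCoord e (ψ.symm s)) t /
      wCoord e (ψ.symm t)

/-- The conformal factor `ρ` of the canonical metric `ds² = ∑ᵢ ωᵢ ⊗ ω̄ᵢ`, where
`ωᵢ = x ^ i dx / y` for `0 ≤ i ≤ g - 1`, in the coordinate `ψ`: there `ds² = ρ(t) dt ⊗ dt̄`. -/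
noncomputable def conformalFactor (ψ : OpenPartialHomeomorph (Curve e) ℂ) (t : ℂ) : ℝ :=
  ∑ i : Fin g, ‖formCoeff e i ψ t‖ ^ 2

/-- The Laplace-Beltrami operator of `ds² = ρ |dt|²`, that is `ρ⁻¹ (∂²/∂a² + ∂²/∂b²)` for a local
coordinate `t = a + i b`. -/
noncomputable def laplaceBeltrami (φ : Curve e → ℂ) (P : Curve e) : ℂ :=
  ((conformalFactor e (chart e P) (chart e P P))⁻¹ : ℝ) *
    Laplacian.laplacian (fun t : ℂ => φ ((chart e P).symm t)) (chart e P P)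

/-- The Gaussian curvature `K = -(1 / (2 ρ)) (∂²/∂a² + ∂²/∂b²) log ρ` of `ds² = ρ |dt|²`. -/
noncomputable def gaussCurvature (P : Curve e) : ℝ :=
  -(1 / 2) * (conformalFactor e (chart e P) (chart e P P))⁻¹ *
    Laplacian.laplacian (fun t : ℂ => Real.log (conformalFactor e (chart e P) t)) (chart e P P)

/-- `σ_g(s) = 1 + s + ⋯ + s ^ (g - 1)`. -/
noncomputable def sigma (g : ℕ) (s : ℝ) : ℝ := ∑ i ∈ Finset.range g, s ^ i

/-- The area measure `ν` of the canonical metric. The finitely many Weierstrass points and points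
at infinity have area zero, and off them `X` is an unramified double cover of the `x`-plane on whose
two sheets `y = ±√f(x)` the metric is `σ_g(|x|²) / |f(x)| dx ⊗ dx̄`. -/
noncomputable def area : Measure (Curve e) :=
  Measure.map (fun x : ℂ => ofAffine e ⟨(x, Complex.sqrt (polyF e x)), sqrt_sq _⟩)
      ((volume : Measure ℂ).withDensity
        fun x => ENNReal.ofReal (sigma g (‖x‖ ^ 2) / ‖polyF e x‖)) +
    Measure.map (fun x : ℂ => ofAffine e ⟨(x, -Complex.sqrt (polyF e x)),
        (neg_sq _).trans (sqrt_sq _)⟩)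
      ((volume : Measure ℂ).withDensity
        fun x => ENNReal.ofReal (sigma g (‖x‖ ^ 2) / ‖polyF e x‖))

/-! ### Divisors and the functions `F_D` -/

/-- `(σ_g(|t|²) (1 + |t|²)²) ^ (1 / (2 g + 2))`. -/
noncomputable def denom (g : ℕ) (t : ℂ) : ℝ :=
  (sigma g (‖t‖ ^ 2) * (1 + ‖t‖ ^ 2) ^ 2) ^ (1 / (2 * (g : ℝ) + 2))

open Classical in
/-- The function `F_P`. The formulas in `x` and in `z` agree wherever both make sense. -/
noncomputable def funF (P Q : Curve e) : ℝ :=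
  if P ∈ Set.range (ofAffine e) then
    if Q ∈ Set.range (ofAffine e) then
      ‖xCoord e Q - xCoord e P‖ / denom g (xCoord e Q)
    else ‖1 - zCoord e Q * xCoord e P‖ / denom g (zCoord e Q)
  else
    if Q ∈ Set.range (ofAffine e) then 1 / denom g (xCoord e Q)
    else ‖zCoord e Q‖ / denom g (zCoord e Q)

/-- Divisors on `X`: finitely supported integer valued functions on `X`. -/
abbrev Divisor : Type := Curve e →₀ ℤ

/-- `deg D = ∑ n_P`. -/
noncomputable def degree (D : Divisor e) : ℤ := D.sum fun _ n => n

/-- The Weierstrass divisor `W = ∑ Pₖ`. -/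
noncomputable def weierstrassDivisor : Divisor e := ∑ k, Finsupp.single (weierstrassPoint e k) 1

/-- `α(D) = ∑ n_P (P + ι(P))`. -/
noncomputable def alpha (D : Divisor e) : Divisor e := D + D.mapDomain (involution e)

/-- `δ_D(φ) = ∑ n_P φ(P)`. -/
noncomputable def diracDelta (D : Divisor e) (φ : Curve e → ℂ) : ℂ := D.sum fun P n => n * φ P

/-- `F_D = ∏ F_P ^ n_P`. -/
noncomputable def funFD (D : Divisor e) (Q : Curve e) : ℝ := D.prod fun P n => funF e P Q ^ n

/-- `u_D = log F_D`, a function on the complement of `supp α(D)`; its values on `supp α(D)` have no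
significance. -/
noncomputable def logF (D : Divisor e) (Q : Curve e) : ℝ := Real.log (funFD e D Q)

/-- The closed coordinate disc `D_ε(P) = {|t| ≤ ε}` for the preferred coordinate, centred at `P`. -/
def coordDisc (P : Curve e) (ε : ℝ) : Set (Curve e) :=
  {Q ∈ (chart e P).source | ‖chart e P Q - chart e P P‖ ≤ ε}

end Gluing

end Hyperelliptic

/-!
The equation is a sum of planar identities. The function `x` presents `X` as a double cover of the
Riemann sphere, and `F_P`, the conformal factor and the curvature depend on `x` only. Integrating
over the two sheets (`integrable_area_and_integral_eq`) replaces a test function `φ` by its trace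
`Φ(x) = φ(x, √f(x)) + φ(x, -√f(x))`, and since the area density is the conformal factor, `Δφ dν`
turns into the Euclidean Laplacian `ΔΦ dx` (`density_mul_laplaceBeltrami`).

The trace is continuous, but it need not be differentiable at the branch points. Smoothness of `φ`
on the compact curve bounds the gradient of `Φ` by `√density` and `ΔΦ` by `density`
(`exists_bound_localBranch`, `traceBounds_trace`). These bounds are what the divergence theorem with
cut-offs near the branch points and infinity needs (`integral_divergence_eq_zero`), so Green's
identity `∫ u ΔΦ = ∫ Φ Δu` holds for every function `u` that is `C²` on the sphere
(`TraceBounds.integral_smul_laplacian`). Applied to the regularisations `log (|x - a|² + r²)` and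
`log (r² |x|² + 1)` of logarithmic potentials, with `r → 0`, it gives, against traces,

* `Δ log (|x - a|² / (1 + |x|²)) = 4 π δ_a - 4 / (1 + |x|²)²`,
* `Δ log (1 / (1 + |x|²)) = 4 π δ_∞ - 4 / (1 + |x|²)²`.

By definition of `N`, the function `2 log F_P` is one of these two potentials minus
`(g + 1)⁻¹ log (σ_g(|x|²) / (1 + |x|²) ^ (g - 1))`, which is smooth on the sphere. Writing
`J = 4 / (1 + |x|²)²` and `T = Δ log σ_g(|x|²)`, one gets for every divisor `E`

`Δ log F_E = 2 π δ_{α(E)} - deg E · (J + T / 2) / (g + 1)`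

(`integral_divisorPotential_smul_laplacian`). With `E = W - D` and `ρ = deg E / (g + 1)` the two
remaining terms are the ones in the equation: `K dν = -T / 2 dx`, because `log |f|` is harmonic
(`gaussCurvature_ofAffine`), and `4 F_D e^v dν = 4 F_W dν = J dx`, because
`F_W = |f| / (σ_g(|x|²) (1 + |x|²)²)` (`density_mul_exp_divisorPotential`).

The singularities of `v` are logarithmic, so `v Δφ` is integrable and the limit over the complements
of the discs is the integral over `X`. Smoothness of `v` off `S` is read off from the formulas for
`F_P` (`funF_pos_and_contMDiffAt`): effectivity of `D` and the absence of Weierstrass points in it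
exclude cancellation in `α(W - D)` (`mem_support_alpha`), so that `S` contains all zeros of the
factors of `F_{W - D}`.
-/

namespace Hyperelliptic

open Asymptotics

/-! ### The planar Laplacian -/

section Laplacian

variable {F : Type*} [NormedAddCommGroup F] [NormedSpace ℝ F]

theorem laplacian_eq_fderiv_fderiv (f : ℂ → F) (x : ℂ) :
    Laplacian.laplacian f x = fderiv ℝ (fderiv ℝ f) x 1 1 +
      fderiv ℝ (fderiv ℝ f) x Complex.I Complex.I := by
  rw [InnerProductSpace.laplacian_eq_iteratedFDeriv_complexPlane]
  simp [iteratedFDeriv_two_apply]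

theorem laplacian_eq_fderiv_apply {f : ℂ → F} {x : ℂ} (hf : ContDiffAt ℝ 2 f x) :
    Laplacian.laplacian f x = fderiv ℝ (fun y => fderiv ℝ f y 1) x 1 +
      fderiv ℝ (fun y => fderiv ℝ f y Complex.I) x Complex.I := by
  have hd : DifferentiableAt ℝ (fderiv ℝ f) x :=
    (hf.fderiv_right (m := 1) (by norm_num)).differentiableAt (by norm_num)
  rw [laplacian_eq_fderiv_fderiv, fderiv_clm_apply hd (differentiableAt_const _),
    fderiv_clm_apply hd (differentiableAt_const _)]
  simp

theorem continuousAt_laplacian {f : ℂ → F} {x : ℂ} (hf : ContDiffAt ℝ 2 f x) :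
    ContinuousAt (Laplacian.laplacian f) x := by
  have hd : ContinuousAt (fderiv ℝ (fderiv ℝ f)) x :=
    ((hf.fderiv_right (m := 1) (by norm_num)).fderiv_right (m := 0) (by norm_num)).continuousAt
  have h : Laplacian.laplacian f = fun x => fderiv ℝ (fderiv ℝ f) x 1 1 +
      fderiv ℝ (fderiv ℝ f) x Complex.I Complex.I := funext (laplacian_eq_fderiv_fderiv f)
  rw [h]
  exact ((hd.clm_apply continuousAt_const).clm_apply continuousAt_const).add
    ((hd.clm_apply continuousAt_const).clm_apply continuousAt_const)

theorem fderiv_comp_analytic {Φ : ℂ → F} {X : ℂ → ℂ} {t : ℂ} (hX : DifferentiableAt ℂ X t)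
    (hΦ : DifferentiableAt ℝ Φ (X t)) (v : ℂ) :
    fderiv ℝ (fun s => Φ (X s)) t v = fderiv ℝ Φ (X t) (deriv X t * v) := by
  have h1 : HasFDerivAt (fun s => Φ (X s)) _ t :=
    hΦ.hasFDerivAt.comp t hX.hasDerivAt.complexToReal_fderiv
  rw [h1.fderiv]
  simp

theorem norm_fderiv_comp_analytic {Φ : ℂ → F} {X : ℂ → ℂ} {t : ℂ} (hX : DifferentiableAt ℂ X t)
    (h0 : deriv X t ≠ 0) (hΦ : DifferentiableAt ℝ Φ (X t)) :
    ‖fderiv ℝ Φ (X t)‖ * ‖deriv X t‖ ≤ ‖fderiv ℝ (fun s => Φ (X s)) t‖ := by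
  rw [← le_div_iff₀ (norm_pos_iff.2 h0)]
  refine ContinuousLinearMap.opNorm_le_bound _ (by positivity) fun w => ?_
  have := fderiv_comp_analytic hX hΦ ((deriv X t)⁻¹ * w)
  rw [mul_inv_cancel_left₀ h0] at this
  rw [← this]
  refine (ContinuousLinearMap.le_opNorm _ _).trans (le_of_eq ?_)
  rw [norm_mul, norm_inv]
  ring

/-- The Laplacian is conformally covariant: under a holomorphic change of variables it is multiplied
by the squared norm of the derivative. -/
theorem laplacian_comp_analytic {Φ : ℂ → F} {X : ℂ → ℂ} {t : ℂ} (hX : AnalyticAt ℂ X t)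
    (hΦ : ContDiffAt ℝ 2 Φ (X t)) :
    Laplacian.laplacian (fun s => Φ (X s)) t = ‖deriv X t‖ ^ 2 • Laplacian.laplacian Φ (X t) := by
  have hXr : ContDiffAt ℝ 2 X t := (hX.contDiffAt (n := 2)).restrict_scalars ℝ
  have hc : ContDiffAt ℝ 2 (fun s => Φ (X s)) t := hΦ.comp t hXr
  have ev : ∀ᶠ s in 𝓝 t, AnalyticAt ℂ X s ∧ DifferentiableAt ℝ Φ (X s) := by
    refine hX.eventually_analyticAt.and (hX.continuousAt.eventually ?_)
    filter_upwards [hΦ.eventually (by simp)] with y hy using hy.differentiableAt (by norm_num)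
  have hd : DifferentiableAt ℝ (fderiv ℝ Φ) (X t) :=
    (hΦ.fderiv_right (m := 1) (by norm_num)).differentiableAt (by norm_num)
  have hd' : HasFDerivAt (fun s => fderiv ℝ Φ (X s)) _ t :=
    hd.hasFDerivAt.comp t hX.differentiableAt.hasDerivAt.complexToReal_fderiv
  have key : ∀ v : ℂ, fderiv ℝ (fun s => fderiv ℝ (fun s => Φ (X s)) s v) t v =
      fderiv ℝ (fderiv ℝ Φ) (X t) (deriv X t * v) (deriv X t * v) +
        fderiv ℝ Φ (X t) (deriv (deriv X) t * v * v) := by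
    intro v
    have e : (fun s => fderiv ℝ (fun s => Φ (X s)) s v) =ᶠ[𝓝 t]
        fun s => fderiv ℝ Φ (X s) (deriv X s * v) := by
      filter_upwards [ev] with s hs
      exact fderiv_comp_analytic hs.1.differentiableAt hs.2 v
    have h2 : HasFDerivAt (fun s => deriv X s * v) _ t :=
      ((hX.deriv.differentiableAt.hasDerivAt).mul_const v).complexToReal_fderiv
    rw [e.fderiv_eq, (hd'.clm_apply h2).fderiv]
    simp
    rw [add_comm]
  rw [laplacian_eq_fderiv_apply hc, key, key, laplacian_eq_fderiv_fderiv]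
  have sym : fderiv ℝ (fderiv ℝ Φ) (X t) 1 Complex.I = fderiv ℝ (fderiv ℝ Φ) (X t) Complex.I 1 := by
    have := (hΦ.isSymmSndFDerivAt (by simp [minSmoothness_of_isRCLikeNormedField]))
    exact this 1 Complex.I
  set B := fderiv ℝ (fderiv ℝ Φ) (X t)
  set c := deriv X t
  have hc1 : c * 1 = c.re • (1 : ℂ) + c.im • Complex.I := by
    apply Complex.ext <;> simp
  have hc2 : c * Complex.I = c.re • Complex.I + (-c.im) • (1 : ℂ) := by
    apply Complex.ext <;> simp
  have hz : deriv (deriv X) t * Complex.I * Complex.I = -(deriv (deriv X) t * 1 * 1) := by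
    rw [mul_assoc, Complex.I_mul_I]; ring
  rw [hz, hc1, hc2, map_neg]
  simp only [map_add, map_smul, add_apply, smul_apply, sym]
  rw [← Complex.normSq_eq_norm_sq, Complex.normSq_apply]
  module

end Laplacian

/-- As `q → 0` the right-hand side becomes `4 π` times a point mass at `a`. -/
theorem laplacian_log_norm_sub_sq_add {p q : ℝ} (hp : 0 < p) (hq : 0 < q) (a x : ℂ) :
    Laplacian.laplacian (fun x : ℂ => Real.log (p * ‖x - a‖ ^ 2 + q)) x =
      4 * p * q / (p * ‖x - a‖ ^ 2 + q) ^ 2 := by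
  have hpos : ∀ y : ℂ, 0 < p * ‖y - a‖ ^ 2 + q := fun y => by positivity
  have h1 : ∀ y : ℂ, HasFDerivAt (fun y : ℂ => p * ‖y - a‖ ^ 2 + q)
      (p • (2 • (innerSL ℝ (y - a)))) y := fun y => by
    have := ((hasFDerivAt_id (𝕜 := ℝ) y).sub_const a).norm_sq
    simpa using (this.const_mul p).add_const q
  have h2 : ∀ y : ℂ, HasFDerivAt (fun x : ℂ => Real.log (p * ‖x - a‖ ^ 2 + q))
      ((p * ‖y - a‖ ^ 2 + q)⁻¹ • (p • (2 • (innerSL ℝ (y - a))))) y := fun y =>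
    (h1 y).log (hpos y).ne'
  have hsm : ContDiffAt ℝ 2 (fun x : ℂ => Real.log (p * ‖x - a‖ ^ 2 + q)) x := by
    refine ContDiffAt.log ?_ (hpos x).ne'
    exact (contDiffAt_const.mul ((contDiffAt_id.sub contDiffAt_const).norm_sq ℝ)).add
      contDiffAt_const
  rw [laplacian_eq_fderiv_apply hsm]
  have h3 : ∀ v : ℂ, fderiv ℝ (fun y => fderiv ℝ (fun x : ℂ => Real.log (p * ‖x - a‖ ^ 2 + q)) y v)
      x v = (p * ‖x - a‖ ^ 2 + q)⁻¹ * (2 * p * ‖v‖ ^ 2) -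
        ((p * ‖x - a‖ ^ 2 + q) ^ 2)⁻¹ * (2 * p * inner ℝ (x - a) v) ^ 2 := by
    intro v
    have e : (fun y => fderiv ℝ (fun x : ℂ => Real.log (p * ‖x - a‖ ^ 2 + q)) y v) =
        fun y => (p * ‖y - a‖ ^ 2 + q)⁻¹ * (2 * p * inner ℝ (y - a) v) := by
      funext y
      rw [(h2 y).fderiv]
      simp [-mul_eq_mul_left_iff]
      ring
    have h4 : HasFDerivAt (fun y : ℂ => 2 * p * inner ℝ (y - a) v) _ x :=
      (((hasFDerivAt_id (𝕜 := ℝ) x).sub_const a).inner ℝ (hasFDerivAt_const v x)).const_mul (2 * p)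
    have h5 : HasFDerivAt (fun y : ℂ => (p * ‖y - a‖ ^ 2 + q)⁻¹) _ x :=
      (hasDerivAt_inv (hpos x).ne').comp_hasFDerivAt x (h1 x)
    rw [e, (h5.fun_mul h4).fderiv]
    simp
    ring
  rw [h3, h3]
  have h6 : (inner ℝ (x - a) (1 : ℂ)) ^ 2 + (inner ℝ (x - a) Complex.I) ^ 2 = ‖x - a‖ ^ 2 := by
    rw [← Complex.normSq_eq_norm_sq, Complex.normSq_apply, Complex.inner, Complex.inner]
    simp
    ring
  have := (hpos x).ne'
  simp only [norm_one, Complex.norm_I]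
  field_simp
  linear_combination (-4 * p) * h6

/-! ### Integrability and the divergence theorem on the punctured plane -/

theorem integrableAtFilter_norm_sub_rpow (c : ℂ) :
    IntegrableAtFilter (fun x : ℂ => ‖x - c‖ ^ (-(3 / 2) : ℝ)) (𝓝 c) := by
  have h0 : IntegrableOn (fun x : ℂ => ‖x‖ ^ (-(3 / 2) : ℝ)) (Metric.ball 0 1) := by
    refine (integrableOn_fun_norm_addHaar volume (f := fun y : ℝ => y ^ (-(3 / 2) : ℝ))).2 ?_
    have := (intervalIntegral.integrableOn_Ioo_rpow_iff (s := -(1 / 2)) zero_lt_one).2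
      (by norm_num)
    refine this.congr_fun (fun y hy => ?_) measurableSet_Ioo
    have hy : 0 < y := hy.1
    simp only [Complex.finrank_real_complex, smul_eq_mul]
    norm_num
    conv_rhs => rw [← Real.rpow_one y, ← Real.rpow_mul hy.le, ← Real.rpow_add hy]
    norm_num
  refine ⟨Metric.ball c 1, Metric.ball_mem_nhds _ zero_lt_one, ?_⟩
  have h1 := ((measurePreserving_sub_right (volume : Measure ℂ) c).integrableOn_comp_preimage
    (MeasurableEquiv.subRight c).measurableEmbedding).2 h0
  have h2 : (fun x => x - c) ⁻¹' Metric.ball 0 1 = Metric.ball c 1 := by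
    ext x
    simp [dist_eq_norm]
  rwa [h2] at h1

theorem integrable_of_isBigO {E : Type*} [NormedAddCommGroup E] {h : ℂ → E}
    (hm : AEStronglyMeasurable h)
    (h1 : ∀ c, h =O[𝓝[≠] c] fun x => ‖x - c‖ ^ (-(3 / 2) : ℝ))
    (h2 : h =O[cocompact ℂ] fun x => (1 + ‖x‖) ^ (-3 : ℝ)) : Integrable h := by
  refine LocallyIntegrable.integrable_of_isBigO_cocompact (g := fun x : ℂ => (1 + ‖x‖) ^ (-3 : ℝ))
    (fun c => ?_) h2 ((integrable_one_add_norm (by simp; norm_num)).integrableAtFilter _)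
  obtain ⟨C, hC⟩ := (h1 c).bound
  obtain ⟨u, hu, huc, hub⟩ := eventually_nhds_iff.1 (eventually_nhdsWithin_iff.1 hC)
  obtain ⟨w, hw, hw'⟩ := integrableAtFilter_norm_sub_rpow c
  refine ⟨u ∩ interior w, inter_mem (huc.mem_nhds hub) (interior_mem_nhds.2 hw), ?_⟩
  have hg := (hw'.mono_set (Set.inter_subset_right.trans interior_subset :
    u ∩ interior w ⊆ w)).norm.const_mul C
  refine hg.mono' hm.restrict ?_
  filter_upwards [ae_restrict_mem (huc.inter isOpen_interior).measurableSet,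
    ae_restrict_of_ae (Measure.ae_ne volume c)] with x hx hxc
  exact hu x hx.1 hxc

/-- The scale-invariant form of a bound on the derivative of the cut-off `θ`: it applies to
all rescalings `θ (n s)` uniformly. -/
theorem exists_bound_mul_deriv_smoothTransition :
    ∃ C : ℝ, ∀ s : ℝ, |s * deriv (fun t => Real.smoothTransition (t - 1)) s| ≤ C := by
  have hsm : ContDiff ℝ 1 fun t : ℝ => Real.smoothTransition (t - 1) :=
    Real.smoothTransition.contDiff.comp (contDiff_id.sub contDiff_const)
  have hcont : Continuous fun s : ℝ => s * deriv (fun t => Real.smoothTransition (t - 1)) s :=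
    continuous_id.mul (hsm.continuous_deriv le_rfl)
  have hsupp : HasCompactSupport
      fun s : ℝ => s * deriv (fun t => Real.smoothTransition (t - 1)) s := by
    refine HasCompactSupport.intro (isCompact_Icc (a := (1 : ℝ)) (b := 2)) fun s hs => ?_
    rw [Set.mem_Icc, not_and_or, not_le, not_le] at hs
    rcases hs with hs | hs
    · have : (fun t : ℝ => Real.smoothTransition (t - 1)) =ᶠ[𝓝 s] fun _ => 0 := by
        filter_upwards [gt_mem_nhds hs] with t ht
        exact Real.smoothTransition.zero_of_nonpos (by linarith)
      simp [this.deriv_eq]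
    · have : (fun t : ℝ => Real.smoothTransition (t - 1)) =ᶠ[𝓝 s] fun _ => 1 := by
        filter_upwards [lt_mem_nhds hs] with t ht
        exact Real.smoothTransition.one_of_one_le (by linarith)
      simp [this.deriv_eq]
  obtain ⟨C, hC⟩ := hsupp.exists_bound_of_continuous hcont
  exact ⟨C, hC⟩

/-- The divergence theorem on the complement of the zero set of a function `q ≥ 0` with compact
superlevel sets. The cut-offs `θ (n q)`, with `θ = 0` on `(-∞, 1]` and `θ = 1` on `[2, ∞)`, have
gradient bounded by a constant times `‖∇q‖ / q`, so no boundary term remains when `‖∇q‖ ‖F‖ / q` is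
integrable. -/
theorem integral_divergence_eq_zero {q : ℂ → ℝ} (hq : ContDiff ℝ 1 q)
    (hnull : ∀ᵐ x, 0 < q x) (hcpt : ∀ ε > 0, IsCompact {x | ε ≤ q x}) {F₁ F₂ : ℂ → ℂ}
    (h1 : ∀ x, 0 < q x → ContDiffAt ℝ 1 F₁ x) (h2 : ∀ x, 0 < q x → ContDiffAt ℝ 1 F₂ x)
    (hdiv : Integrable fun x => fderiv ℝ F₁ x 1 + fderiv ℝ F₂ x Complex.I)
    {M : ℂ → ℝ} (hM : Integrable M)
    (hb : ∀ x, 0 < q x → ‖fderiv ℝ q x‖ * (‖F₁ x‖ + ‖F₂ x‖) ≤ q x * M x) :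
    ∫ x, (fderiv ℝ F₁ x 1 + fderiv ℝ F₂ x Complex.I) = 0 := by
  obtain ⟨C, hC⟩ := exists_bound_mul_deriv_smoothTransition
  set θ : ℝ → ℝ := fun t => Real.smoothTransition (t - 1) with hθ
  have hθs : ContDiff ℝ 1 θ :=
    Real.smoothTransition.contDiff.comp (contDiff_id.sub contDiff_const)
  have hθ0 : ∀ t ≤ 1, θ t = 0 := fun t ht =>
    Real.smoothTransition.zero_of_nonpos (by linarith)
  have hθ1 : ∀ t, 2 ≤ t → θ t = 1 := fun t ht =>
    Real.smoothTransition.one_of_one_le (by linarith)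
  have hθd0 : ∀ t < 1, deriv θ t = 0 := fun t ht => by
    have : θ =ᶠ[𝓝 t] fun _ => 0 := by
      filter_upwards [gt_mem_nhds ht] with s hs using hθ0 s hs.le
    simp [this.deriv_eq]
  have hθd1 : ∀ t, 2 < t → deriv θ t = 0 := fun t ht => by
    have : θ =ᶠ[𝓝 t] fun _ => 1 := by
      filter_upwards [lt_mem_nhds ht] with s hs using hθ1 s hs.le
    simp [this.deriv_eq]
  have hχd : ∀ (n : ℕ) x, HasFDerivAt (fun x => θ (n * q x))
      (deriv θ (n * q x) • ((n : ℝ) • fderiv ℝ q x)) x := fun n x =>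
    ((hθs.differentiable one_ne_zero _).hasDerivAt).comp_hasFDerivAt x
      (((hq.differentiable one_ne_zero x).hasFDerivAt).const_mul (n : ℝ))
  have hχs : ∀ n : ℕ, ContDiff ℝ 1 fun x => θ (n * q x) := fun n =>
    hθs.comp (contDiff_const.mul hq)
  -- Continuous functions on `{q > 0}` cut off by `θ (n q)` are integrable.
  have hint : ∀ n : ℕ, 0 < n → ∀ G : ℂ → ℂ, ContinuousOn G {x | 0 < q x} →
      (∀ x, (n : ℝ) * q x < 1 → G x = 0) → Integrable G := by
    intro n hn G hG hG0
    have hn' : (0 : ℝ) < n := by exact_mod_cast hn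
    have hK := hcpt ((n : ℝ)⁻¹) (by positivity)
    refine IntegrableOn.integrable_of_forall_notMem_eq_zero (s := {x | (n : ℝ)⁻¹ ≤ q x}) ?_ ?_
    · refine (hG.mono fun x hx => ?_).integrableOn_compact hK
      exact lt_of_lt_of_le (by positivity) (show (n : ℝ)⁻¹ ≤ q x from hx)
    · intro x hx
      refine hG0 x ?_
      simp only [Set.mem_ofPred_eq, not_le] at hx
      calc (n : ℝ) * q x < n * (n : ℝ)⁻¹ := by gcongr
        _ = 1 := mul_inv_cancel₀ hn'.ne'
  -- Integration by parts, with the compactly supported factor `θ (n q)`.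
  have hibp : ∀ n : ℕ, 0 < n → ∀ (F : ℂ → ℂ), (∀ x, 0 < q x → ContDiffAt ℝ 1 F x) → ∀ v : ℂ,
      Integrable (fun x => θ (n * q x) • fderiv ℝ F x v) ∧
      Integrable (fun x => fderiv ℝ (fun x => θ (n * q x)) x v • F x) ∧
      ∫ x, θ (n * q x) • fderiv ℝ F x v = -∫ x, fderiv ℝ (fun x => θ (n * q x)) x v • F x := by
    intro n hn F hF v
    have hn' : (0 : ℝ) < n := by exact_mod_cast hn
    have hcF : ContinuousOn F {x | 0 < q x} := fun x hx => (hF x hx).continuousAt.continuousWithinAt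
    have hcF' : ContinuousOn (fun x => fderiv ℝ F x v) {x | 0 < q x} := fun x hx =>
      ((((hF x hx).fderiv_right (m := 0) (by norm_num)).continuousAt).clm_apply
        continuousAt_const).continuousWithinAt
    have hcχ : Continuous fun x => θ (n * q x) := (hχs n).continuous
    have hcχ' : Continuous fun x => fderiv ℝ (fun x => θ (n * q x)) x v :=
      ((hχs n).continuous_fderiv one_ne_zero).clm_apply continuous_const
    have i1 := hint n hn _ (hcχ.continuousOn.smul hcF') fun x hx => by
      simp [hθ0 _ hx.le]
    have i2 := hint n hn _ (hcχ'.continuousOn.smul hcF) fun x hx => by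
      simp [(hχd n x).fderiv, hθd0 _ hx]
    have i3 := hint n hn _ (hcχ.continuousOn.smul hcF) fun x hx => by
      simp [hθ0 _ hx.le]
    refine ⟨i1, i2, integral_smul_fderiv_eq_neg_fderiv_smul_of_integrable i2 i1 i3
      (fun x _ => (hχd n x).differentiableAt) fun x hx => ?_⟩
    refine (hF x ?_).differentiableAt one_ne_zero
    have hsub : tsupport (fun x => θ (n * q x)) ⊆ {x | (n : ℝ)⁻¹ ≤ q x} := by
      refine closure_minimal (fun y hy => ?_) (hcpt _ (by positivity)).isClosed
      by_contra hlt
      simp only [Set.mem_ofPred_eq, not_le] at hlt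
      refine hy (hθ0 _ ?_)
      calc (n : ℝ) * q y ≤ n * (n : ℝ)⁻¹ := by gcongr
        _ = 1 := mul_inv_cancel₀ hn'.ne'
    exact lt_of_lt_of_le (by positivity) (hsub hx)
  -- `d` is the divergence and `R n` the error term, which lives where `1 ≤ n q ≤ 2`.
  set d : ℂ → ℂ := fun x => fderiv ℝ F₁ x 1 + fderiv ℝ F₂ x Complex.I with hd
  set R : ℕ → ℂ → ℂ := fun n x => fderiv ℝ (fun x => θ (n * q x)) x 1 • F₁ x +
    fderiv ℝ (fun x => θ (n * q x)) x Complex.I • F₂ x with hR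
  have hev : ∀ x, 0 < q x → ∀ᶠ n : ℕ in atTop, 2 < (n : ℝ) * q x := fun x hx =>
    (tendsto_natCast_atTop_atTop.atTop_mul_const hx).eventually_gt_atTop 2
  have hRint : ∀ n : ℕ, 0 < n → Integrable (R n) := fun n hn =>
    (hibp n hn F₁ h1 1).2.1.add (hibp n hn F₂ h2 Complex.I).2.1
  have hsum : ∀ n : ℕ, 0 < n → ∫ x, θ (n * q x) • d x = -∫ x, R n x := by
    intro n hn
    obtain ⟨a1, a2, a3⟩ := hibp n hn F₁ h1 1
    obtain ⟨b1, b2, b3⟩ := hibp n hn F₂ h2 Complex.I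
    simp only [hd, hR, smul_add]
    rw [integral_add a1 b1, integral_add a2 b2, a3, b3]
    ring
  have lim1 : Tendsto (fun n : ℕ => ∫ x, θ (n * q x) • d x) atTop (𝓝 (∫ x, d x)) := by
    refine tendsto_integral_of_dominated_convergence (fun x => ‖d x‖) (fun n => ?_) hdiv.norm
      (fun n => ?_) ?_
    · exact (hχs n).continuous.aestronglyMeasurable.smul hdiv.1
    · refine Eventually.of_forall fun x => ?_
      rw [norm_smul, Real.norm_eq_abs, abs_of_nonneg (Real.smoothTransition.nonneg _)]
      exact mul_le_of_le_one_left (norm_nonneg _) (Real.smoothTransition.le_one _)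
    · filter_upwards [hnull] with x hx
      refine tendsto_const_nhds.congr' ?_
      filter_upwards [hev x hx] with n hn
      rw [hθ1 _ hn.le, one_smul]
  have lim2 : Tendsto (fun n : ℕ => ∫ x, R n x) atTop (𝓝 0) := by
    rw [← integral_zero ℂ ℂ]
    refine tendsto_integral_filter_of_dominated_convergence (fun x => C * M x) ?_ ?_
      (hM.const_mul C) ?_
    · filter_upwards [eventually_gt_atTop 0] with n hn using (hRint n hn).1
    · filter_upwards [eventually_gt_atTop 0] with n hn
      filter_upwards [hnull] with x hx
      have e : ∀ v : ℂ, ‖v‖ = 1 → ∀ w : ℂ, ‖fderiv ℝ (fun x => θ (n * q x)) x v • w‖ ≤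
          |deriv θ (n * q x)| * n * (‖fderiv ℝ q x‖ * ‖w‖) := by
        intro v hv w
        rw [norm_smul, (hχd n x).fderiv]
        simp only [smul_apply, norm_smul, Real.norm_eq_abs, Nat.abs_cast]
        have := (fderiv ℝ q x).le_opNorm v
        rw [hv, mul_one, Real.norm_eq_abs] at this
        calc |deriv θ (n * q x)| * (n * |fderiv ℝ q x v|) * ‖w‖
            = |deriv θ (n * q x)| * n * (|fderiv ℝ q x v| * ‖w‖) := by ring
          _ ≤ _ := by gcongr
      calc ‖R n x‖ ≤ |deriv θ (n * q x)| * n * (‖fderiv ℝ q x‖ * ‖F₁ x‖) +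
            |deriv θ (n * q x)| * n * (‖fderiv ℝ q x‖ * ‖F₂ x‖) :=
            (norm_add_le _ _).trans (add_le_add (e 1 (by simp) _) (e Complex.I (by simp) _))
        _ = |deriv θ (n * q x)| * n * (‖fderiv ℝ q x‖ * (‖F₁ x‖ + ‖F₂ x‖)) := by ring
        _ ≤ |deriv θ (n * q x)| * n * (q x * M x) :=
            mul_le_mul_of_nonneg_left (hb x hx) (by positivity)
        _ = |n * q x * deriv θ (n * q x)| * M x := by
            rw [abs_mul, abs_of_nonneg (by positivity : 0 ≤ (n : ℝ) * q x)]; ring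
        _ ≤ C * M x := by
            refine mul_le_mul_of_nonneg_right (hC _) ?_
            refine nonneg_of_mul_nonneg_right (le_trans ?_ (hb x hx)) hx
            positivity
    · filter_upwards [hnull] with x hx
      refine tendsto_const_nhds.congr' ?_
      filter_upwards [hev x hx] with n hn
      simp [hR, (hχd n x).fderiv, hθd1 _ hn]
  have lim3 : Tendsto (fun n : ℕ => ∫ x, θ (n * q x) • d x) atTop (𝓝 (-0)) := by
    refine lim2.neg.congr' ?_
    filter_upwards [eventually_gt_atTop 0] with n hn using (hsum n hn).symm
  simpa using tendsto_nhds_unique lim1 lim3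

/-! ### Smooth functions on the Riemann sphere -/

/-- A real function on `ℂ` that extends to a `C²` function on the Riemann sphere; near infinity this
is read off in the coordinate `z = x⁻¹`. -/
def SmoothOnSphere (u : ℂ → ℝ) : Prop :=
  ContDiff ℝ 2 u ∧ ∃ k : ℂ → ℝ, ContDiffAt ℝ 2 k 0 ∧ ∀ᶠ z in 𝓝[≠] 0, u z⁻¹ = k z

theorem exists_forall_le_of_eventually_cocompact {f : ℂ → ℝ} (hf : Continuous f) {C : ℝ}
    (hC : ∀ᶠ x in cocompact ℂ, f x ≤ C) : ∃ C, ∀ x, f x ≤ C := by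
  obtain ⟨K, hK, hKC⟩ := mem_cocompact.1 hC
  obtain ⟨C', hC'⟩ := hK.bddAbove_image hf.continuousOn
  refine ⟨max C C', fun x => ?_⟩
  by_cases hx : x ∈ K
  · exact (hC' ⟨x, hx, rfl⟩).trans (le_max_right _ _)
  · exact (hKC hx : f x ≤ C).trans (le_max_left _ _)

theorem eventually_norm_le_of_continuousAt {E F : Type*} [TopologicalSpace E]
    [NormedAddCommGroup F] {f : E → F} {x : E} (hf : ContinuousAt f x) :
    ∀ᶠ y in 𝓝 x, ‖f y‖ ≤ ‖f x‖ + 1 := by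
  filter_upwards [hf.norm.eventually (gt_mem_nhds (lt_add_one ‖f x‖))] with y hy using hy.le

/-- Such a function is bounded together with its gradient and Laplacian, when the latter are
measured in the spherical metric. -/
theorem SmoothOnSphere.exists_bound {u : ℂ → ℝ} (hu : SmoothOnSphere u) :
    ∃ C, ∀ x, ‖u x‖ ≤ C ∧ ‖fderiv ℝ u x‖ * (1 + ‖x‖ ^ 2) ≤ C ∧
      ‖Laplacian.laplacian u x‖ * (1 + ‖x‖ ^ 2) ^ 2 ≤ C := by
  obtain ⟨hu, k, hk, huk⟩ := hu
  have ev0 : ∀ᶠ z in 𝓝[≠] (0 : ℂ), ∀ᶠ y in 𝓝 z, u y⁻¹ = k y := by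
    obtain ⟨s, hs, hso, hs0⟩ := eventually_nhds_iff.1 (eventually_nhdsWithin_iff.1 huk)
    filter_upwards [nhdsWithin_le_nhds (hso.mem_nhds hs0), self_mem_nhdsWithin] with z hz hz0
    filter_upwards [hso.mem_nhds hz, isOpen_ne.mem_nhds hz0] with y hy hy0 using hs y hy hy0
  have e1 := eventually_norm_le_of_continuousAt hk.continuousAt
  have e2 := eventually_norm_le_of_continuousAt
    (hk.fderiv_right (m := 1) (by norm_num)).continuousAt
  have e3 := eventually_norm_le_of_continuousAt (continuousAt_laplacian hk)
  have hc2 : Continuous fun x => Laplacian.laplacian u x :=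
    continuous_iff_continuousAt.2 fun x => continuousAt_laplacian hu.contDiffAt
  have hc1 : Continuous (fderiv ℝ u) := hu.continuous_fderiv (by norm_num)
  -- Near infinity the bounds are those of `k` near `0`, as `|d(z⁻¹)/dz| = |z⁻¹|²`.
  have main : ∀ᶠ z in 𝓝[≠] (0 : ℂ), ‖u z⁻¹‖ ≤ ‖k 0‖ + 1 ∧
      ‖fderiv ℝ u z⁻¹‖ * (1 + ‖z⁻¹‖ ^ 2) ≤ 2 * (‖fderiv ℝ k 0‖ + 1) ∧
      ‖Laplacian.laplacian u z⁻¹‖ * (1 + ‖z⁻¹‖ ^ 2) ^ 2 ≤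
        4 * (‖Laplacian.laplacian k 0‖ + 1) := by
    filter_upwards [ev0, nhdsWithin_le_nhds e1, nhdsWithin_le_nhds e2, nhdsWithin_le_nhds e3,
      self_mem_nhdsWithin, nhdsWithin_le_nhds (Metric.ball_mem_nhds (0 : ℂ) one_pos)]
      with z h0 h1 h2 h3 hz hz1
    have hz : z ≠ 0 := hz
    have hzn : 0 < ‖z‖ := norm_pos_iff.2 hz
    have hinv : AnalyticAt ℂ (fun z : ℂ => z⁻¹) z := analyticAt_inv hz
    have hd : ‖deriv (fun z : ℂ => z⁻¹) z‖ = ‖z⁻¹‖ ^ 2 := by simp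
    have hd0 : deriv (fun z : ℂ => z⁻¹) z ≠ 0 := by
      rw [← norm_pos_iff, hd, norm_inv]; positivity
    have h0' : (fun y => u y⁻¹) =ᶠ[𝓝 z] k := h0
    have hn : 1 + ‖z⁻¹‖ ^ 2 ≤ 2 * ‖z⁻¹‖ ^ 2 := by
      have : ‖z‖ < 1 := by simpa using hz1
      have h1 : 1 ≤ ‖z⁻¹‖ := by
        rw [norm_inv]; exact (one_le_inv₀ hzn).2 this.le
      nlinarith
    refine ⟨by rwa [h0'.eq_of_nhds], ?_, ?_⟩
    · have := norm_fderiv_comp_analytic hinv.differentiableAt hd0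
        ((hu.differentiable (by norm_num)) z⁻¹)
      rw [h0'.fderiv_eq, hd] at this
      calc _ ≤ ‖fderiv ℝ u z⁻¹‖ * (2 * ‖z⁻¹‖ ^ 2) := by gcongr
        _ = 2 * (‖fderiv ℝ u z⁻¹‖ * ‖z⁻¹‖ ^ 2) := by ring
        _ ≤ _ := by linarith
    · have := laplacian_comp_analytic (Φ := u) hinv hu.contDiffAt
      rw [(InnerProductSpace.laplacian_congr_nhds h0').eq_of_nhds, hd] at this
      rw [this, norm_smul] at h3
      simp only [norm_pow, norm_norm] at h3
      calc _ ≤ ‖Laplacian.laplacian u z⁻¹‖ * (2 * ‖z⁻¹‖ ^ 2) ^ 2 := by gcongr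
        _ = 4 * ((‖z⁻¹‖ ^ 2) ^ 2 * ‖Laplacian.laplacian u z⁻¹‖) := by ring
        _ ≤ _ := by linarith
  have hinf : ∀ᶠ x in cocompact ℂ, ‖u x‖ ≤ ‖k 0‖ + 1 ∧
      ‖fderiv ℝ u x‖ * (1 + ‖x‖ ^ 2) ≤ 2 * (‖fderiv ℝ k 0‖ + 1) ∧
      ‖Laplacian.laplacian u x‖ * (1 + ‖x‖ ^ 2) ^ 2 ≤
        4 * (‖Laplacian.laplacian k 0‖ + 1) := by
    rw [← Metric.cobounded_eq_cocompact]
    filter_upwards [tendsto_inv₀_cobounded'.eventually main] with x hx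
    simpa only [inv_inv] using hx
  obtain ⟨C1, h1⟩ := exists_forall_le_of_eventually_cocompact hu.continuous.norm
    (hinf.mono fun x h => h.1)
  obtain ⟨C2, h2⟩ := exists_forall_le_of_eventually_cocompact
    (by fun_prop : Continuous fun x => ‖fderiv ℝ u x‖ * (1 + ‖x‖ ^ 2)) (hinf.mono fun x h => h.2.1)
  obtain ⟨C3, h3⟩ := exists_forall_le_of_eventually_cocompact
    (by fun_prop : Continuous fun x => ‖Laplacian.laplacian u x‖ * (1 + ‖x‖ ^ 2) ^ 2)
    (hinf.mono fun x h => h.2.2)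
  refine ⟨max C1 (max C2 C3), fun x => ⟨(h1 x).trans (le_max_left _ _), (h2 x).trans ?_,
    (h3 x).trans ?_⟩⟩ <;> simp

theorem integrable_one_add_norm_sq_inv_sq :
    Integrable fun x : ℂ => ((1 + ‖x‖ ^ 2) ^ 2)⁻¹ := by
  have := integrable_rpow_neg_one_add_norm_sq (E := ℂ) (μ := volume) (r := 4)
    (by simp; norm_num)
  refine this.congr (Eventually.of_forall fun x => ?_)
  have h : (-4 / 2 : ℝ) = -(2 : ℕ) := by norm_num
  simp only [h]
  rw [Real.rpow_neg (by positivity), Real.rpow_natCast]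

theorem SmoothOnSphere.continuous_laplacian {u : ℂ → ℝ} (hu : SmoothOnSphere u) :
    Continuous (Laplacian.laplacian u) :=
  continuous_iff_continuousAt.2 fun _ => continuousAt_laplacian hu.1.contDiffAt

theorem SmoothOnSphere.integrable_laplacian {u : ℂ → ℝ} (hu : SmoothOnSphere u) :
    Integrable (Laplacian.laplacian u) := by
  obtain ⟨C, hC⟩ := hu.exists_bound
  refine (integrable_one_add_norm_sq_inv_sq.const_mul C).mono'
    hu.continuous_laplacian.aestronglyMeasurable (Eventually.of_forall fun x => ?_)
  rw [← div_eq_mul_inv, le_div_iff₀ (by positivity)]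
  exact (hC x).2.2

theorem contDiff_log_norm_sub_sq_add {p q : ℝ} (hp : 0 ≤ p) (hq : 0 < q) (a : ℂ) {n : ℕ∞ω} :
    ContDiff ℝ n fun x : ℂ => Real.log (p * ‖x - a‖ ^ 2 + q) := by
  refine ContDiff.log ?_ fun x => by positivity
  exact (contDiff_const.mul ((contDiff_id.sub contDiff_const).norm_sq ℝ)).add contDiff_const

theorem laplacian_log_one_add_norm_sq (x : ℂ) :
    Laplacian.laplacian (fun x : ℂ => Real.log (1 + ‖x‖ ^ 2)) x = 4 * ((1 + ‖x‖ ^ 2) ^ 2)⁻¹ := by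
  have := laplacian_log_norm_sub_sq_add one_pos one_pos 0 x
  simp only [one_mul, sub_zero, mul_one] at this
  rw [← div_eq_mul_inv]
  simpa only [add_comm] using this

theorem contDiff_log_one_add_norm_sq {n : ℕ∞ω} :
    ContDiff ℝ n fun x : ℂ => Real.log (1 + ‖x‖ ^ 2) := by
  have := contDiff_log_norm_sub_sq_add (n := n) zero_le_one one_pos 0
  simpa only [one_mul, sub_zero, add_comm] using this

theorem log_one_add_norm_inv_sq {z : ℂ} (hz : z ≠ 0) :
    Real.log (1 + ‖z⁻¹‖ ^ 2) = Real.log (1 + ‖z‖ ^ 2) - Real.log (‖z‖ ^ 2) := by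
  have : 0 < ‖z‖ := norm_pos_iff.2 hz
  rw [← Real.log_div (by positivity) (by positivity), norm_inv]
  congr 1
  field_simp
  ring

/-- The regularisation of `log (‖x - a‖² / (1 + ‖x‖²))`. -/
theorem smoothOnSphere_log_sub (a : ℂ) {r : ℝ} (hr : 0 < r) :
    SmoothOnSphere fun x => Real.log (‖x - a‖ ^ 2 + r ^ 2) - Real.log (1 + ‖x‖ ^ 2) := by
  refine ⟨ContDiff.sub ?_ contDiff_log_one_add_norm_sq,
    fun z => Real.log (‖1 - a * z‖ ^ 2 + r ^ 2 * ‖z‖ ^ 2) - Real.log (1 + ‖z‖ ^ 2), ?_, ?_⟩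
  · simpa only [one_mul] using
      contDiff_log_norm_sub_sq_add (n := 2) zero_le_one (by positivity : 0 < r ^ 2) a
  · refine ContDiffAt.sub (ContDiffAt.log ?_ ?_) contDiff_log_one_add_norm_sq.contDiffAt
    · exact ((contDiffAt_const.sub (contDiffAt_const.mul contDiffAt_id)).norm_sq ℝ).add
        (contDiffAt_const.mul (contDiffAt_id.norm_sq ℝ))
    · simp
  · filter_upwards [self_mem_nhdsWithin] with z hz
    have hz : z ≠ 0 := hz
    have hzn : 0 < ‖z‖ := norm_pos_iff.2 hz
    have : ‖z⁻¹ - a‖ ^ 2 + r ^ 2 = (‖1 - a * z‖ ^ 2 + r ^ 2 * ‖z‖ ^ 2) / ‖z‖ ^ 2 := by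
      have h : z⁻¹ - a = (1 - a * z) / z := by field_simp
      rw [h, norm_div]
      field_simp
    rw [log_one_add_norm_inv_sq hz, this, Real.log_div (by positivity) (by positivity)]
    ring

theorem smoothOnSphere_log_infinity {r : ℝ} (hr : 0 < r) :
    SmoothOnSphere fun x => Real.log (r ^ 2 * ‖x‖ ^ 2 + 1) - Real.log (1 + ‖x‖ ^ 2) := by
  refine ⟨ContDiff.sub ?_ contDiff_log_one_add_norm_sq,
    fun z => Real.log (‖z‖ ^ 2 + r ^ 2) - Real.log (1 + ‖z‖ ^ 2),
    (ContDiff.sub ?_ contDiff_log_one_add_norm_sq).contDiffAt, ?_⟩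
  · simpa only [sub_zero] using
      contDiff_log_norm_sub_sq_add (n := 2) (by positivity : 0 ≤ r ^ 2) one_pos 0
  · simpa only [one_mul, sub_zero] using
      contDiff_log_norm_sub_sq_add (n := 2) zero_le_one (by positivity : 0 < r ^ 2) 0
  · filter_upwards [self_mem_nhdsWithin] with z hz
    have hz : z ≠ 0 := hz
    have hzn : 0 < ‖z‖ := norm_pos_iff.2 hz
    have : r ^ 2 * ‖z⁻¹‖ ^ 2 + 1 = (‖z‖ ^ 2 + r ^ 2) / ‖z‖ ^ 2 := by
      rw [norm_inv]
      field_simp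
      ring
    rw [log_one_add_norm_inv_sq hz, this, Real.log_div (by positivity) (by positivity)]
    ring

theorem sigma_pos {g : ℕ} (hg : 0 < g) {s : ℝ} (hs : 0 ≤ s) : 0 < sigma g s := by
  unfold sigma
  refine Finset.sum_pos' (fun i _ => by positivity) ⟨0, by simpa using hg, by simp⟩

theorem contDiff_sigma (g : ℕ) {n : ℕ∞ω} : ContDiff ℝ n (sigma g) := by
  unfold sigma
  exact ContDiff.sum fun i _ => contDiff_id.pow i

/-- `σ_g` is palindromic. -/
theorem sigma_inv {g : ℕ} {s : ℝ} (hs : s ≠ 0) :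
    sigma g s⁻¹ = sigma g s / s ^ (g - 1) := by
  unfold sigma
  rw [← Finset.sum_range_reflect, Finset.sum_div]
  refine Finset.sum_congr rfl fun i hi => ?_
  have hi : i ≤ g - 1 := by have := Finset.mem_range.1 hi; omega
  rw [inv_pow, eq_div_iff (pow_ne_zero _ hs), inv_mul_eq_iff_eq_mul₀ (pow_ne_zero _ hs), ← pow_add]
  congr 1
  omega

theorem contDiff_log_sigma {g : ℕ} (hg : 0 < g) {n : ℕ∞ω} :
    ContDiff ℝ n fun x : ℂ => Real.log (sigma g (‖x‖ ^ 2)) :=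
  ((contDiff_sigma g).comp (contDiff_id.norm_sq ℝ)).log fun x =>
    (sigma_pos hg (sq_nonneg ‖x‖)).ne'

/-- `log (σ_g(|x|²) / (1 + |x|²) ^ (g - 1))`. -/
noncomputable def logSigma (g : ℕ) (x : ℂ) : ℝ :=
  Real.log (sigma g (‖x‖ ^ 2)) - (g - 1 : ℕ) * Real.log (1 + ‖x‖ ^ 2)

theorem smoothOnSphere_logSigma {g : ℕ} (hg : 0 < g) : SmoothOnSphere (logSigma g) := by
  have hs : ContDiff ℝ 2 (logSigma g) :=
    (contDiff_log_sigma hg).sub (contDiff_const.mul contDiff_log_one_add_norm_sq)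
  refine ⟨hs, logSigma g, hs.contDiffAt, ?_⟩
  filter_upwards [self_mem_nhdsWithin] with z hz
  have hz : z ≠ 0 := hz
  have hzn : 0 < ‖z‖ := norm_pos_iff.2 hz
  unfold logSigma
  rw [log_one_add_norm_inv_sq hz, norm_inv, inv_pow, sigma_inv (by positivity),
    Real.log_div (sigma_pos hg (sq_nonneg _)).ne' (by positivity)]
  have : Real.log ((‖z‖ ^ 2) ^ (g - 1)) = (g - 1 : ℕ) * Real.log (‖z‖ ^ 2) := Real.log_pow _ _
  rw [this]
  ring

theorem laplacian_logSigma {g : ℕ} (hg : 0 < g) (x : ℂ) :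
    Laplacian.laplacian (logSigma g) x =
      Laplacian.laplacian (fun x : ℂ => Real.log (sigma g (‖x‖ ^ 2))) x -
        4 * (g - 1 : ℕ) * ((1 + ‖x‖ ^ 2) ^ 2)⁻¹ := by
  have h1 : ContDiffAt ℝ 2 (fun x : ℂ => Real.log (sigma g (‖x‖ ^ 2))) x :=
    (contDiff_log_sigma hg).contDiffAt
  have h2 : ContDiffAt ℝ 2 (fun x : ℂ => Real.log (1 + ‖x‖ ^ 2)) x :=
    contDiff_log_one_add_norm_sq.contDiffAt
  have e : logSigma g = (fun x : ℂ => Real.log (sigma g (‖x‖ ^ 2))) -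
      ((g - 1 : ℕ) : ℝ) • fun x : ℂ => Real.log (1 + ‖x‖ ^ 2) := rfl
  have h3 : ContDiffAt ℝ 2 (((g - 1 : ℕ) : ℝ) • fun x : ℂ => Real.log (1 + ‖x‖ ^ 2)) x :=
    contDiffAt_const.smul h2
  rw [e, h1.laplacian_sub h3, InnerProductSpace.laplacian_smul _ h2,
    laplacian_log_one_add_norm_sq]
  simp only [smul_eq_mul]
  ring

/-! ### The approximate identity given by the regularised logarithm -/

theorem integral_two_mul_one_add_norm_sq_inv_sq :
    ∫ x : ℂ, 2 * ((1 + ‖x‖ ^ 2) ^ 2)⁻¹ = 2 * Real.pi := by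
  have h := integral_fun_norm_addHaar (volume : Measure ℂ)
    fun y : ℝ => 2 * ((1 + y ^ 2) ^ 2)⁻¹
  have hd : ∀ x ∈ Set.Ici (0 : ℝ), HasDerivAt (fun y : ℝ => -(1 + y ^ 2)⁻¹)
      (x ^ (2 - 1) • (2 * ((1 + x ^ 2) ^ 2)⁻¹)) x := fun x _ => by
    have hx : (1 + x ^ 2 : ℝ) ≠ 0 := by positivity
    refine (((hasDerivAt_pow 2 x).const_add 1).fun_inv hx).fun_neg.congr_deriv ?_
    simp only [smul_eq_mul]
    field_simp
    norm_num [mul_comm]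
  have hlim : Tendsto (fun y : ℝ => -(1 + y ^ 2)⁻¹) atTop (𝓝 (-0)) := by
    refine Tendsto.neg (tendsto_inv_atTop_zero.comp ?_)
    exact tendsto_atTop_add_const_left _ _ (tendsto_pow_atTop two_ne_zero)
  have hI := integral_Ioi_of_hasDerivAt_of_nonneg' hd
    (fun x hx => smul_nonneg (pow_nonneg (le_of_lt hx) _) (by positivity)) hlim
  rw [h, Complex.finrank_real_complex, hI]
  simp [Measure.real, Complex.volume_ball]

/-- The measures `2 / (1 + |s|²)² ds`, moved by dilations that send almost every point to a place
where the bounded function `Φ` is close to `L`, integrate `Φ` to a value close to `2 π L`. -/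
theorem tendsto_integral_kernel {Φ : ℂ → ℂ} (hΦ : Continuous Φ) {C : ℝ} (hC : ∀ x, ‖Φ x‖ ≤ C)
    {T : ℝ → ℂ → ℂ} (hT : ∀ r, Continuous (T r)) {L : ℂ}
    (hL : ∀ s ≠ 0, Tendsto (fun r => Φ (T r s)) (𝓝[>] 0) (𝓝 L)) :
    Tendsto (fun r => ∫ s : ℂ, (2 * ((1 + ‖s‖ ^ 2) ^ 2)⁻¹) • Φ (T r s)) (𝓝[>] 0)
      (𝓝 (2 * Real.pi * L)) := by
  have e : (2 * Real.pi * L : ℂ) = ∫ s : ℂ, (2 * ((1 + ‖s‖ ^ 2) ^ 2)⁻¹) • L := by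
    rw [integral_smul_const, integral_two_mul_one_add_norm_sq_inv_sq]
    simp
  have hk : Continuous fun s : ℂ => 2 * ((1 + ‖s‖ ^ 2) ^ 2)⁻¹ :=
    continuous_const.mul ((by fun_prop : Continuous fun s : ℂ => (1 + ‖s‖ ^ 2) ^ 2).inv₀
      fun s => by positivity)
  rw [e]
  refine tendsto_integral_filter_of_dominated_convergence
    (fun s => 2 * ((1 + ‖s‖ ^ 2) ^ 2)⁻¹ * C) (Eventually.of_forall fun r => ?_)
    (Eventually.of_forall fun r => Eventually.of_forall fun s => ?_)
    ((integrable_one_add_norm_sq_inv_sq.const_mul 2).mul_const C) ?_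
  · exact (hk.smul (hΦ.comp (hT r))).aestronglyMeasurable
  · rw [norm_smul, Real.norm_of_nonneg (by positivity)]
    gcongr
    exact hC _
  · filter_upwards [Measure.ae_ne volume (0 : ℂ)] with s hs
    exact tendsto_const_nhds.smul (hL s hs)

/-- The substitution `x = a + r s` turns the kernel into the fixed measure `2 / (1 + |s|²)² ds`. -/
theorem tendsto_integral_kernel_finite {Φ : ℂ → ℂ} (hΦ : Continuous Φ) {C : ℝ}
    (hC : ∀ x, ‖Φ x‖ ≤ C) (a : ℂ) :
    Tendsto (fun r : ℝ => ∫ x, (2 * r ^ 2 / (‖x - a‖ ^ 2 + r ^ 2) ^ 2) • Φ x) (𝓝[>] 0)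
      (𝓝 (2 * Real.pi * Φ a)) := by
  have h := tendsto_integral_kernel hΦ hC (T := fun r s => a + r • s) (fun r => by fun_prop)
    (L := Φ a) fun s _ => by
      have : Continuous fun r : ℝ => Φ (a + r • s) := by fun_prop
      have := this.tendsto 0
      simp only [zero_smul, add_zero] at this
      exact this.mono_left nhdsWithin_le_nhds
  refine h.congr' ?_
  filter_upwards [self_mem_nhdsWithin] with r hr
  have hr : 0 < r := hr
  have h1 := Measure.integral_comp_smul (volume : Measure ℂ)
    (fun y => (2 * r ^ 2 / (‖y‖ ^ 2 + r ^ 2) ^ 2) • Φ (a + y)) r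
  have h2 := integral_add_left_eq_self (μ := (volume : Measure ℂ))
    (fun x => (2 * r ^ 2 / (‖x - a‖ ^ 2 + r ^ 2) ^ 2) • Φ x) a
  simp only [add_sub_cancel_left] at h2
  rw [h2, Complex.finrank_real_complex, abs_of_pos (by positivity), eq_comm,
    inv_smul_eq_iff₀ (by positivity)] at h1
  rw [h1, ← integral_smul]
  refine integral_congr_ae (Eventually.of_forall fun s => ?_)
  simp only [norm_smul, smul_smul, Real.norm_of_nonneg hr.le]
  congr 1
  field_simp
  ring

/-- The substitution `x = s / r` turns the kernel into the fixed measure `2 / (1 + |s|²)² ds`. -/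
theorem tendsto_integral_kernel_infinity {Φ : ℂ → ℂ} (hΦ : Continuous Φ) {C : ℝ}
    (hC : ∀ x, ‖Φ x‖ ≤ C) {L : ℂ} (hL : Tendsto Φ (cocompact ℂ) (𝓝 L)) :
    Tendsto (fun r : ℝ => ∫ x, (2 * r ^ 2 / (r ^ 2 * ‖x‖ ^ 2 + 1) ^ 2) • Φ x) (𝓝[>] 0)
      (𝓝 (2 * Real.pi * L)) := by
  have h := tendsto_integral_kernel hΦ hC (T := fun r s => r⁻¹ • s) (fun r => by fun_prop)
    (L := L) fun s hs => by
      refine hL.comp ?_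
      rw [← Metric.cobounded_eq_cocompact, ← tendsto_norm_atTop_iff_cobounded]
      simp only [norm_smul]
      refine Tendsto.atTop_mul_const (norm_pos_iff.2 hs) ?_
      exact tendsto_norm_atTop_atTop.comp tendsto_inv_nhdsGT_zero
  refine h.congr' ?_
  filter_upwards [self_mem_nhdsWithin] with r hr
  have hr : 0 < r := hr
  have h1 := Measure.integral_comp_smul (volume : Measure ℂ)
    (fun y => (2 * r ^ 2 / (r ^ 2 * ‖y‖ ^ 2 + 1) ^ 2) • Φ y) r⁻¹
  rw [Complex.finrank_real_complex, abs_of_pos (by positivity), eq_comm,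
    inv_smul_eq_iff₀ (by positivity)] at h1
  rw [h1, ← integral_smul]
  refine integral_congr_ae (Eventually.of_forall fun s => ?_)
  simp only [norm_smul, smul_smul, Real.norm_of_nonneg (inv_nonneg.2 hr.le)]
  congr 1
  field_simp
  ring

/-! ### Orders of growth at the points of the plane and at infinity -/

/-- `h(x) = O(|x - c| ^ (-s))` at every point `c`, and `h(x) = O((1 + |x|) ^ (-t))` at infinity. -/
def SingularBound (h : ℂ → ℝ) (s t : ℝ) : Prop :=
  (∀ c, h =O[𝓝[≠] c] fun x => ‖x - c‖ ^ (-s)) ∧ h =O[cocompact ℂ] fun x => (1 + ‖x‖) ^ (-t)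

theorem eventually_norm_sub_pos (c : ℂ) : ∀ᶠ x in 𝓝[≠] c, 0 < ‖x - c‖ := by
  filter_upwards [self_mem_nhdsWithin] with x hx
  exact norm_pos_iff.2 (sub_ne_zero.2 hx)

theorem eventually_norm_sub_le_one (c : ℂ) : ∀ᶠ x in 𝓝[≠] c, ‖x - c‖ ≤ 1 := by
  filter_upwards [nhdsWithin_le_nhds (Metric.closedBall_mem_nhds c one_pos)] with x hx
  simpa [dist_eq_norm] using hx

theorem SingularBound.mul {h h' : ℂ → ℝ} {s t s' t' : ℝ} (H : SingularBound h s t)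
    (H' : SingularBound h' s' t') : SingularBound (fun x => h x * h' x) (s + s') (t + t') := by
  refine ⟨fun c => ((H.1 c).mul (H'.1 c)).congr' EventuallyEq.rfl ?_,
    (H.2.mul H'.2).congr_right fun x => ?_⟩
  · filter_upwards [eventually_norm_sub_pos c] with x hx
    rw [← Real.rpow_add hx, neg_add]
  · rw [← Real.rpow_add (by positivity), neg_add]

theorem SingularBound.add {h h' : ℂ → ℝ} {s t : ℝ} (H : SingularBound h s t)
    (H' : SingularBound h' s t) : SingularBound (fun x => h x + h' x) s t :=
  ⟨fun c => (H.1 c).add (H'.1 c), H.2.add H'.2⟩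

theorem SingularBound.const_mul {h : ℂ → ℝ} {s t : ℝ} (H : SingularBound h s t) (C : ℝ) :
    SingularBound (fun x => C * h x) s t :=
  ⟨fun c => (H.1 c).const_mul_left C, H.2.const_mul_left C⟩

theorem SingularBound.sum {ι : Type*} {I : Finset ι} {h : ι → ℂ → ℝ} {s t : ℝ}
    (H : ∀ i ∈ I, SingularBound (h i) s t) : SingularBound (fun x => ∑ i ∈ I, h i x) s t :=
  ⟨fun c => IsBigO.fun_sum fun i hi => (H i hi).1 c, IsBigO.fun_sum fun i hi => (H i hi).2⟩

theorem SingularBound.mono {h : ℂ → ℝ} {s t s' t' : ℝ} (H : SingularBound h s t) (hs : s ≤ s')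
    (ht : t' ≤ t) : SingularBound h s' t' := by
  refine ⟨fun c => (H.1 c).trans (IsBigO.of_bound 1 ?_), H.2.trans (IsBigO.of_bound 1 ?_)⟩
  · filter_upwards [eventually_norm_sub_pos c, eventually_norm_sub_le_one c] with x hx hx1
    rw [Real.norm_of_nonneg (by positivity), Real.norm_of_nonneg (by positivity), one_mul]
    exact Real.rpow_le_rpow_of_exponent_ge hx hx1 (by linarith)
  · refine Eventually.of_forall fun x => ?_
    rw [Real.norm_of_nonneg (by positivity), Real.norm_of_nonneg (by positivity), one_mul]
    exact Real.rpow_le_rpow_of_exponent_le (by linarith [norm_nonneg x]) (by linarith)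

theorem SingularBound.sqrt {h : ℂ → ℝ} {s t : ℝ} (H : SingularBound h s t) :
    SingularBound (fun x => √(h x)) (s / 2) (t / 2) := by
  have key : ∀ {l : Filter ℂ} {k : ℂ → ℝ}, (∀ x, 0 ≤ k x) → ∀ s : ℝ,
      h =O[l] (fun x => k x ^ (-s)) → (fun x => √(h x)) =O[l] fun x => k x ^ (-(s / 2)) := by
    intro l k hk s hO
    obtain ⟨C, hC⟩ := hO.bound
    refine IsBigO.of_bound (√C) ?_
    filter_upwards [hC] with x hx
    have hk' := hk x
    rw [Real.norm_of_nonneg (by positivity), Real.norm_of_nonneg (by positivity)]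
    rw [Real.norm_of_nonneg (by positivity : 0 ≤ k x ^ (-s))] at hx
    have e : k x ^ (-(s / 2)) = √(k x ^ (-s)) := by
      rw [Real.sqrt_eq_rpow, ← Real.rpow_mul hk']
      ring_nf
    rw [e, ← Real.sqrt_mul' _ (by positivity)]
    exact Real.sqrt_le_sqrt ((Real.le_norm_self _).trans hx)
  exact ⟨fun c => key (fun _ => norm_nonneg _) s (H.1 c), key (fun x => by positivity) t H.2⟩

theorem SingularBound.integrable {h : ℂ → ℝ} {s t : ℝ} (H : SingularBound h s t)
    (hs : s ≤ 3 / 2) (ht : 3 ≤ t) (hm : AEStronglyMeasurable h) : Integrable h :=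
  integrable_of_isBigO hm (H.mono hs ht).1 (H.mono hs ht).2

theorem isBigO_norm_sub_rpow_of_continuousAt {h : ℂ → ℝ} {c : ℂ} (hh : ContinuousAt h c) {s : ℝ}
    (hs : 0 ≤ s) : h =O[𝓝[≠] c] fun x => ‖x - c‖ ^ (-s) := by
  refine ((hh.isBigO_one ℝ).mono nhdsWithin_le_nhds).trans (IsBigO.of_bound 1 ?_)
  filter_upwards [eventually_norm_sub_pos c, eventually_norm_sub_le_one c] with x hx hx1
  rw [norm_one, one_mul, Real.norm_of_nonneg (by positivity)]
  exact Real.one_le_rpow_of_pos_of_le_one_of_nonpos hx hx1 (by linarith)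

theorem singularBound_of_continuous {h : ℂ → ℝ} (hh : Continuous h) {t C : ℝ}
    (hC : ∀ x, |h x| ≤ C * (1 + ‖x‖) ^ (-t)) : SingularBound h 0 t := by
  refine ⟨fun c => isBigO_norm_sub_rpow_of_continuousAt hh.continuousAt le_rfl,
    IsBigO.of_bound C (Eventually.of_forall fun x => ?_)⟩
  rw [Real.norm_of_nonneg (by positivity : 0 ≤ (1 + ‖x‖) ^ (-t))]
  exact hC x

theorem singularBound_one_add_norm_sq_inv : SingularBound (fun x => (1 + ‖x‖ ^ 2)⁻¹) 0 2 := by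
  have hc : Continuous fun x : ℂ => (1 + ‖x‖ ^ 2)⁻¹ :=
    (by fun_prop : Continuous fun x : ℂ => 1 + ‖x‖ ^ 2).inv₀ fun x => by positivity
  refine singularBound_of_continuous (C := 2) hc fun x => ?_
  rw [abs_of_pos (by positivity), Real.rpow_neg (by positivity), Real.rpow_two,
    ← div_eq_mul_inv, inv_eq_one_div, div_le_div_iff₀ (by positivity) (by positivity)]
  nlinarith [sq_nonneg (1 - ‖x‖)]

theorem singularBound_norm_div_one_add_norm_sq :
    SingularBound (fun x => ‖x‖ / (1 + ‖x‖ ^ 2)) 0 1 := by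
  have hc : Continuous fun x : ℂ => ‖x‖ / (1 + ‖x‖ ^ 2) :=
    (by fun_prop : Continuous fun x : ℂ => ‖x‖).div
      (by fun_prop : Continuous fun x : ℂ => 1 + ‖x‖ ^ 2) fun x => by positivity
  refine singularBound_of_continuous (C := 2) hc fun x => ?_
  rw [abs_of_nonneg (by positivity), Real.rpow_neg (by positivity), Real.rpow_one,
    ← div_eq_mul_inv, div_le_div_iff₀ (by positivity) (by positivity)]
  nlinarith [sq_nonneg (1 - ‖x‖), norm_nonneg x]

theorem log_one_add_norm_sq_le (x : ℂ) : Real.log (1 + ‖x‖ ^ 2) ≤ 2 * (1 + ‖x‖) := by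
  have h1 : Real.log (1 + ‖x‖ ^ 2) ≤ Real.log ((1 + ‖x‖) ^ 2) :=
    Real.log_le_log (by positivity) (by nlinarith [norm_nonneg x])
  have h2 := Real.log_le_self (by positivity : 0 ≤ 1 + ‖x‖)
  rw [Real.log_pow] at h1
  push_cast at h1
  linarith

theorem singularBound_log_one_add_norm_sq :
    SingularBound (fun x => Real.log (1 + ‖x‖ ^ 2)) 0 (-1) := by
  refine singularBound_of_continuous (C := 2)
    (contDiff_log_one_add_norm_sq (n := 0)).continuous fun x => ?_
  rw [abs_of_nonneg (Real.log_nonneg (by nlinarith [norm_nonneg x])), neg_neg, Real.rpow_one]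
  exact log_one_add_norm_sq_le x

theorem eventually_norm_sub_inv_le (a : ℂ) :
    ∀ᶠ x in cocompact ℂ, 0 < ‖x - a‖ ∧ ‖x - a‖⁻¹ ≤ 4 * (1 + ‖x‖)⁻¹ := by
  have h := (tendsto_norm_cocompact_atTop (E := ℂ)).eventually_ge_atTop (max 1 (2 * ‖a‖))
  filter_upwards [h] with x hx
  have h1 := (le_max_left _ _).trans hx
  have h2 := (le_max_right _ _).trans hx
  have h3 := norm_sub_norm_le x a
  have h4 : 0 < ‖x - a‖ := by linarith
  refine ⟨h4, ?_⟩
  rw [← div_eq_mul_inv, inv_eq_one_div, div_le_div_iff₀ h4 (by positivity)]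
  linarith

theorem singularBound_norm_sub_inv (a : ℂ) : SingularBound (fun x => ‖x - a‖⁻¹) 1 1 := by
  refine ⟨fun c => ?_, IsBigO.of_bound 4 ?_⟩
  · rcases eq_or_ne c a with rfl | hca
    · refine IsBigO.of_bound 1 (Eventually.of_forall fun x => ?_)
      rw [Real.rpow_neg_one, one_mul]
    · refine isBigO_norm_sub_rpow_of_continuousAt ?_ zero_le_one
      exact (by fun_prop : ContinuousAt (fun x => ‖x - a‖) c).inv₀
        (norm_ne_zero_iff.2 (sub_ne_zero.2 hca))
  · filter_upwards [eventually_norm_sub_inv_le a] with x hx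
    rw [Real.norm_of_nonneg (by positivity), Real.norm_of_nonneg (by positivity),
      Real.rpow_neg_one]
    exact hx.2

/-- The exponent `1 / 2` leaves room for the simple pole of the density of the canonical metric: the
product has order `3 / 2 < 2`, so it is integrable. -/
theorem singularBound_log_norm_sub (a : ℂ) :
    SingularBound (fun x => Real.log ‖x - a‖) (1 / 2) (-1) := by
  refine ⟨fun c => ?_, IsBigO.of_bound (1 + ‖a‖ + 4) ?_⟩
  · rcases eq_or_ne c a with rfl | hca
    · have h : Tendsto (fun x : ℂ => ‖x - c‖) (𝓝[≠] c) (𝓝[>] 0) :=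
        tendsto_norm_sub_self_nhdsNE c
      have h2 := (isLittleO_log_rpow_nhdsGT_zero (show -(1 / 2 : ℝ) < 0 by norm_num)).isBigO
      exact h2.comp_tendsto h
    · refine isBigO_norm_sub_rpow_of_continuousAt ?_ (by norm_num)
      exact (by fun_prop : ContinuousAt (fun x => ‖x - a‖) c).log
        (norm_ne_zero_iff.2 (sub_ne_zero.2 hca))
  · filter_upwards [eventually_norm_sub_inv_le a] with x hx
    rw [neg_neg, Real.rpow_one, Real.norm_of_nonneg (by positivity : 0 ≤ 1 + ‖x‖),
      Real.norm_eq_abs]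
    have h1 := Real.log_le_self (norm_nonneg (x - a))
    have h2 := Real.log_le_self (inv_nonneg.2 (norm_nonneg (x - a)))
    rw [Real.log_inv] at h2
    have h3 := norm_sub_le x a
    have h4 : (1 + ‖x‖)⁻¹ ≤ 1 := inv_le_one_of_one_le₀ (by linarith [norm_nonneg x])
    have h5 := norm_nonneg a
    have h6 := norm_nonneg x
    have h7 := hx.2
    rw [abs_le]
    constructor <;> nlinarith [mul_nonneg h5 h6]

/-! ### The density of the canonical metric in the coordinate `x` -/

section Density

variable {g : ℕ} (e : Fin (2 * g + 2) ↪ ℂ)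

/-- The density `σ_g(|x|²) / |f(x)|` of the canonical metric in the coordinate `x`. -/
noncomputable def density (x : ℂ) : ℝ := sigma g (‖x‖ ^ 2) / ‖polyF e x‖

theorem polyF_ne_zero_iff {x : ℂ} : polyF e x ≠ 0 ↔ ∀ k, x ≠ e k := by
  unfold polyF
  rw [Finset.prod_ne_zero_iff]
  simp [sub_ne_zero]

theorem ae_polyF_ne_zero : ∀ᵐ x : ℂ, polyF e x ≠ 0 := by
  simp only [polyF_ne_zero_iff, ae_all_iff]
  exact fun k => Measure.ae_ne volume (e k)

theorem isOpen_polyF_ne_zero : IsOpen {x | polyF e x ≠ 0} :=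
  isOpen_ne_fun (continuous_polyF e) continuous_const

theorem continuous_sigma_norm_sq (g : ℕ) : Continuous fun x : ℂ => sigma g (‖x‖ ^ 2) :=
  (contDiff_sigma g (n := 0)).continuous.comp (by fun_prop)

theorem measurable_density : Measurable (density e) :=
  (continuous_sigma_norm_sq g).measurable.div (continuous_polyF e).norm.measurable

theorem density_nonneg (x : ℂ) : 0 ≤ density e x := by
  unfold density sigma; positivity

theorem density_pos (hg : 0 < g) {x : ℂ} (hx : polyF e x ≠ 0) : 0 < density e x :=
  div_pos (sigma_pos hg (sq_nonneg _)) (norm_pos_iff.2 hx)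

/-- The roots of `f` are simple, and at infinity `σ_g(|x|²) / |f(x)|` decays like `|x|` to the power
`2 (g - 1) - (2 g + 2)`. -/
theorem singularBound_density : SingularBound (density e) 1 4 := by
  constructor
  · intro c
    by_cases hc : polyF e c = 0
    · have : ∃ k, c = e k := by
        by_contra! h
        exact (polyF_ne_zero_iff e).2 h hc
      obtain ⟨k, rfl⟩ := this
      have h1 : ContinuousAt (fun x => sigma g (‖x‖ ^ 2) / ‖polyFk e k x‖) (e k) :=
        (continuous_sigma_norm_sq g).continuousAt.div (continuous_polyFk e k).norm.continuousAt
          (norm_ne_zero_iff.2 (polyFk_ne_zero e k))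
      have h2 := isBigO_norm_sub_rpow_of_continuousAt h1 le_rfl
      have h3 := h2.mul ((singularBound_norm_sub_inv (e k)).1 (e k))
      refine h3.congr' (Eventually.of_forall fun x => ?_) ?_
      · simp only [density, polyF_eq e k x, norm_mul]
        ring
      · filter_upwards [eventually_norm_sub_pos (e k)] with x hx
        rw [← Real.rpow_add hx]
        norm_num
    · refine isBigO_norm_sub_rpow_of_continuousAt ?_ zero_le_one
      exact (continuous_sigma_norm_sq g).continuousAt.div (continuous_polyF e).norm.continuousAt
        (norm_ne_zero_iff.2 hc)
  · rcases Nat.eq_zero_or_pos g with rfl | hg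
    · have : density e = fun _ => 0 := by funext x; simp [density, sigma]
      rw [this]
      exact isBigO_zero _ _
    -- At infinity the two factors have orders `-(2 g + 2)` and `2 g - 2`.
    have h1 : (fun x => ∏ k, ‖x - e k‖⁻¹) =O[cocompact ℂ]
        fun x => ∏ _k : Fin (2 * g + 2), (1 + ‖x‖) ^ (-1 : ℝ) :=
      IsBigO.finsetProd fun k _ => (singularBound_norm_sub_inv (e k)).2
    have h2 : (fun x : ℂ => sigma g (‖x‖ ^ 2)) =O[cocompact ℂ]
        fun x => (1 + ‖x‖) ^ (2 * g - 2 : ℝ) := by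
      refine IsBigO.of_bound g (Eventually.of_forall fun x => ?_)
      have hx := norm_nonneg x
      rw [Real.norm_of_nonneg (sigma_pos hg (sq_nonneg _)).le,
        Real.norm_of_nonneg (by positivity)]
      have hexp : (2 * g - 2 : ℝ) = ((2 * (g - 1) : ℕ) : ℝ) := by
        push_cast [Nat.cast_sub hg]; ring
      rw [hexp, Real.rpow_natCast]
      unfold sigma
      calc ∑ i ∈ Finset.range g, (‖x‖ ^ 2) ^ i
          ≤ ∑ i ∈ Finset.range g, (1 + ‖x‖) ^ (2 * (g - 1)) := by
            refine Finset.sum_le_sum fun i hi => ?_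
            have hi : i ≤ g - 1 := by have := Finset.mem_range.1 hi; omega
            rw [← pow_mul]
            calc ‖x‖ ^ (2 * i) ≤ (1 + ‖x‖) ^ (2 * i) := by gcongr; linarith
              _ ≤ _ := pow_le_pow_right₀ (by linarith) (by omega)
        _ = _ := by simp
    refine (h2.mul h1).congr (fun x => ?_) fun x => ?_
    · simp only [density, polyF, norm_prod, Finset.prod_inv_distrib, div_eq_mul_inv]
    · rw [Finset.prod_const, ← Real.rpow_mul_natCast (by positivity),
        ← Real.rpow_add (by positivity)]
      congr 1
      simp
      ring

/-- The function `|f|² / (1 + |x|²) ^ (2 g + 3)`, whose zeros on the Riemann sphere are the branch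
points and infinity. The exponent exceeds the degree `2 g + 2` of `f`, which makes it vanish at
infinity. -/
noncomputable def cutoffBase (x : ℂ) : ℝ := ‖polyF e x‖ ^ 2 / (1 + ‖x‖ ^ 2) ^ (2 * g + 3)

/-- A majorant of the logarithmic gradient of `cutoffBase`. -/
noncomputable def cutoffSlope (x : ℂ) : ℝ :=
  ∑ k, 2 * ‖x - e k‖⁻¹ + (2 * g + 3) * (2 * (‖x‖ / (1 + ‖x‖ ^ 2)))

theorem contDiff_cutoffBase : ContDiff ℝ 1 (cutoffBase e) := by
  have h : ContDiff ℂ 1 (polyF e) := by unfold polyF; fun_prop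
  refine ((h.restrict_scalars ℝ).norm_sq ℝ).div
    ((contDiff_const.add (contDiff_id.norm_sq ℝ)).pow _) fun x => by positivity

theorem cutoffBase_pos_iff {x : ℂ} : 0 < cutoffBase e x ↔ polyF e x ≠ 0 := by
  unfold cutoffBase
  constructor
  · intro h h0
    simp [h0] at h
  · intro h
    have := norm_pos_iff.2 h
    positivity

theorem isCompact_le_cutoffBase {ε : ℝ} (hε : 0 < ε) : IsCompact {x | ε ≤ cutoffBase e x} := by
  have hb : ∃ A > 0, ∀ x, ‖polyF e x‖ ^ 2 ≤ A * (1 + ‖x‖ ^ 2) ^ (2 * g + 2) := by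
    refine ⟨∏ k, (2 * (1 + ‖e k‖ ^ 2)), Finset.prod_pos fun k _ => by positivity, fun x => ?_⟩
    have : (1 + ‖x‖ ^ 2) ^ (2 * g + 2) = ∏ _k : Fin (2 * g + 2), (1 + ‖x‖ ^ 2) := by simp
    rw [polyF, norm_prod, ← Finset.prod_pow, this, ← Finset.prod_mul_distrib]
    refine Finset.prod_le_prod (fun k _ => by positivity) fun k _ => ?_
    have h1 := norm_sub_le x (e k)
    have h2 := norm_nonneg (x - e k)
    nlinarith [sq_nonneg (‖x‖ - ‖e k‖), sq_nonneg (‖x‖ * ‖e k‖)]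
  obtain ⟨A, hA, hb⟩ := hb
  refine Metric.isCompact_of_isClosed_isBounded
    (isClosed_le continuous_const (contDiff_cutoffBase e).continuous) ?_
  refine (Metric.isBounded_closedBall (x := (0 : ℂ)) (r := 1 + A / ε)).subset fun x hx => ?_
  have hx : ε ≤ cutoffBase e x := hx
  unfold cutoffBase at hx
  rw [le_div_iff₀ (by positivity)] at hx
  have h1 : ε * (1 + ‖x‖ ^ 2) ≤ A := by
    have h2 : (0 : ℝ) < (1 + ‖x‖ ^ 2) ^ (2 * g + 2) := by positivity
    refine le_of_mul_le_mul_right ?_ h2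
    calc _ = ε * (1 + ‖x‖ ^ 2) ^ (2 * g + 3) := by ring
      _ ≤ _ := hx.trans (hb x)
  have h3 : 1 + ‖x‖ ^ 2 ≤ A / ε := by rw [le_div_iff₀ hε]; linarith
  rw [mem_closedBall_zero_iff]
  nlinarith [norm_nonneg x, sq_nonneg (‖x‖ - 1)]

/-- The logarithmic gradient of `cutoffBase` is a sum over the roots of `f` and a term from the
denominator. -/
theorem norm_fderiv_cutoffBase_le {x : ℂ} (hx : polyF e x ≠ 0) :
    ‖fderiv ℝ (cutoffBase e) x‖ ≤ cutoffBase e x * cutoffSlope e x := by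
  have hx' := (polyF_ne_zero_iff e).1 hx
  have d1 : ∀ a : ℂ, HasFDerivAt (fun y : ℂ => ‖y - a‖ ^ 2) (2 • innerSL ℝ (x - a)) x := fun a => by
    simpa using ((hasFDerivAt_id (𝕜 := ℝ) x).sub_const a).norm_sq
  have d2 : ∀ k, HasFDerivAt (fun y : ℂ => Real.log (‖y - e k‖ ^ 2))
      ((‖x - e k‖ ^ 2)⁻¹ • (2 • innerSL ℝ (x - e k))) x := fun k =>
    (d1 (e k)).log (pow_ne_zero _ (norm_ne_zero_iff.2 (sub_ne_zero.2 (hx' k))))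
  have d3 : HasFDerivAt (fun y : ℂ => Real.log (1 + ‖y‖ ^ 2))
      ((1 + ‖x‖ ^ 2)⁻¹ • (2 • innerSL ℝ x)) x := by
    have := (d1 0).const_add 1
    simp only [sub_zero] at this
    exact this.log (by positivity)
  have d4 := (HasFDerivAt.fun_sum (u := Finset.univ) fun k _ => d2 k).fun_sub
    (d3.const_mul ((2 * g + 3 : ℕ) : ℝ))
  have hev : cutoffBase e =ᶠ[𝓝 x] fun y => Real.exp (∑ k, Real.log (‖y - e k‖ ^ 2) -
      ((2 * g + 3 : ℕ) : ℝ) * Real.log (1 + ‖y‖ ^ 2)) := by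
    filter_upwards [(isOpen_polyF_ne_zero e).mem_nhds hx] with y hy
    have hy' := (polyF_ne_zero_iff e).1 hy
    rw [← Real.log_prod fun k _ => pow_ne_zero _ (norm_ne_zero_iff.2 (sub_ne_zero.2 (hy' k))),
      ← Real.log_pow, ← Real.log_div, Real.exp_log]
    · simp only [cutoffBase, polyF, norm_prod, Finset.prod_pow]
    · refine div_pos (Finset.prod_pos fun k _ => ?_) (by positivity)
      have := norm_pos_iff.2 (sub_ne_zero.2 (hy' k))
      positivity
    · refine Finset.prod_ne_zero_iff.2 fun k _ => ?_
      exact pow_ne_zero _ (norm_ne_zero_iff.2 (sub_ne_zero.2 (hy' k)))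
    · positivity
  have d5 := d4.exp
  have hval := hev.eq_of_nhds
  rw [hev.fderiv_eq, d5.fderiv, norm_smul, Real.norm_of_nonneg (Real.exp_pos _).le]
  rw [← hval]
  refine mul_le_mul_of_nonneg_left ?_ (by unfold cutoffBase; positivity)
  refine (norm_sub_le _ _).trans (add_le_add ((norm_sum_le _ _).trans
    (Finset.sum_le_sum fun k _ => ?_)) ?_)
  · have := norm_pos_iff.2 (sub_ne_zero.2 (hx' k))
    rw [norm_smul, norm_inv, norm_pow, norm_norm, ← Nat.cast_smul_eq_nsmul ℝ, norm_smul,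
      innerSL_apply_norm]
    simp only [Nat.cast_ofNat, Real.norm_ofNat]
    refine le_of_eq ?_
    field_simp
  · rw [norm_smul, norm_smul, norm_inv, ← Nat.cast_smul_eq_nsmul ℝ, norm_smul,
      innerSL_apply_norm, Real.norm_of_nonneg (by positivity : (0 : ℝ) ≤ 1 + ‖x‖ ^ 2)]
    simp only [RCLike.norm_natCast]
    refine le_of_eq ?_
    push_cast
    ring

theorem singularBound_cutoffSlope : SingularBound (cutoffSlope e) 1 1 :=
  (SingularBound.sum fun k _ => (singularBound_norm_sub_inv (e k)).const_mul 2).add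
    (((singularBound_norm_div_one_add_norm_sq.const_mul 2).const_mul _).mono zero_le_one le_rfl)

end Density

/-! ### Green's identity for functions on the plane with square root singularities -/

section Green

variable {g : ℕ} (e : Fin (2 * g + 2) ↪ ℂ)

/-- The regularity of the function `x ↦ φ(x, √f(x)) + φ(x, -√f(x))` for a smooth function `φ` on
`X`: it is continuous, it is `C²` off the branch points, and its gradient and Laplacian are bounded
there when they are measured in the canonical metric. -/
structure TraceBounds (Φ : ℂ → ℂ) (C : ℝ) : Prop where
  continuous : Continuous Φ
  norm_le : ∀ x, ‖Φ x‖ ≤ C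
  contDiffAt : ∀ x, polyF e x ≠ 0 → ContDiffAt ℝ 2 Φ x
  norm_fderiv_le : ∀ x, polyF e x ≠ 0 → ‖fderiv ℝ Φ x‖ ≤ C * √(density e x)
  norm_laplacian_le : ∀ x, polyF e x ≠ 0 → ‖Laplacian.laplacian Φ x‖ ≤ C * density e x

variable {e} {Φ : ℂ → ℂ} {C : ℝ}

theorem aestronglyMeasurable_of_continuousAt {F : Type*} [NormedAddCommGroup F] {h : ℂ → F}
    (hh : ∀ x, polyF e x ≠ 0 → ContinuousAt h x) : AEStronglyMeasurable h := by
  have : ContinuousOn h {x | polyF e x ≠ 0} := fun x hx => (hh x hx).continuousWithinAt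
  have h1 := this.aestronglyMeasurable_of_isSeparable (μ := volume)
    (isOpen_polyF_ne_zero e).measurableSet (TopologicalSpace.IsSeparable.of_separableSpace _)
  have h2 : (volume : Measure ℂ).restrict {x | polyF e x ≠ 0} = volume :=
    Measure.restrict_eq_self_of_ae_mem (ae_polyF_ne_zero e)
  rwa [h2] at h1

theorem TraceBounds.nonneg (H : TraceBounds e Φ C) : 0 ≤ C :=
  (norm_nonneg _).trans (H.norm_le 0)

theorem TraceBounds.integrable_smul (H : TraceBounds e Φ C) {u : ℂ → ℝ} (hu : Integrable u) :
    Integrable fun x => u x • Φ x := by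
  refine (hu.norm.mul_const C).mono' (hu.1.smul H.continuous.aestronglyMeasurable)
    (Eventually.of_forall fun x => ?_)
  rw [norm_smul]
  exact mul_le_mul_of_nonneg_left (H.norm_le x) (norm_nonneg _)

theorem TraceBounds.integrable_smul_laplacian (H : TraceBounds e Φ C) {u : ℂ → ℝ}
    (hu : AEStronglyMeasurable u) (hi : Integrable fun x => density e x * |u x|) :
    Integrable fun x => u x • Laplacian.laplacian Φ x := by
  refine (hi.const_mul C).mono' (hu.smul (aestronglyMeasurable_of_continuousAt fun x hx =>
    continuousAt_laplacian (H.contDiffAt x hx))) ?_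
  filter_upwards [ae_polyF_ne_zero e] with x hx
  rw [norm_smul, Real.norm_eq_abs]
  calc |u x| * ‖Laplacian.laplacian Φ x‖ ≤ |u x| * (C * density e x) :=
        mul_le_mul_of_nonneg_left (H.norm_laplacian_le x hx) (abs_nonneg _)
    _ = _ := by ring

theorem integrable_density : Integrable (density e) :=
  (singularBound_density e).integrable (by norm_num) (by norm_num)
    (measurable_density e).aestronglyMeasurable

theorem SmoothOnSphere.integrable_density_mul {u : ℂ → ℝ} (hu : SmoothOnSphere u) :
    Integrable fun x => density e x * |u x| := by
  obtain ⟨B, hB⟩ := hu.exists_bound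
  refine (integrable_density (e := e)).mul_bdd (c := B) hu.1.continuous.abs.aestronglyMeasurable ?_
  refine Eventually.of_forall fun x => ?_
  simpa using (hB x).1

/-- Green's identity. The vector field `u ∇Φ - Φ ∇u` has divergence `u ΔΦ - Φ Δu`, and it is small
enough at the branch points and at infinity for the divergence theorem. -/
theorem TraceBounds.integral_smul_laplacian (H : TraceBounds e Φ C) {u : ℂ → ℝ}
    (hu : SmoothOnSphere u) :
    ∫ x, u x • Laplacian.laplacian Φ x = ∫ x, Laplacian.laplacian u x • Φ x := by
  obtain ⟨B, hB⟩ := hu.exists_bound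
  have hC := H.nonneg
  have i1 := H.integrable_smul_laplacian hu.1.continuous.aestronglyMeasurable
    hu.integrable_density_mul
  have i2 : Integrable fun x => Laplacian.laplacian u x • Φ x :=
    H.integrable_smul hu.integrable_laplacian
  let F : ℂ → ℂ → ℂ := fun v x => u x • fderiv ℝ Φ x v - fderiv ℝ u x v • Φ x
  have hΦ1 : ∀ v x, polyF e x ≠ 0 → ContDiffAt ℝ 1 (fun x => fderiv ℝ Φ x v) x := fun v x hx =>
    ((H.contDiffAt x hx).fderiv_right (m := 1) (by norm_num)).clm_apply contDiffAt_const
  have hu1 : ∀ v x, ContDiffAt ℝ 1 (fun x => fderiv ℝ u x v) x := fun v x =>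
    (hu.1.contDiffAt.fderiv_right (m := 1) (by norm_num)).clm_apply contDiffAt_const
  have hF1 : ∀ v x, 0 < cutoffBase e x → ContDiffAt ℝ 1 (F v) x := fun v x hx => by
    have hx := (cutoffBase_pos_iff e).1 hx
    exact ((hu.1.contDiffAt.of_le (by norm_num)).smul (hΦ1 v x hx)).sub
      ((hu1 v x).smul ((H.contDiffAt x hx).of_le (by norm_num)))
  have hFd : ∀ v x, polyF e x ≠ 0 → fderiv ℝ (F v) x v =
      u x • fderiv ℝ (fun x => fderiv ℝ Φ x v) x v -
        fderiv ℝ (fun x => fderiv ℝ u x v) x v • Φ x := by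
    intro v x hx
    have a1 := (hu.1.differentiable (by norm_num) x).hasFDerivAt
    have a2 := ((H.contDiffAt x hx).differentiableAt (by norm_num)).hasFDerivAt
    have a3 := ((hΦ1 v x hx).differentiableAt one_ne_zero).hasFDerivAt
    have a4 := ((hu1 v x).differentiableAt one_ne_zero).hasFDerivAt
    have := (a1.fun_smul a3).fun_sub (a4.fun_smul a2)
    rw [this.fderiv]
    simp
    ring
  have hdiv : ∀ x, polyF e x ≠ 0 → fderiv ℝ (F 1) x 1 + fderiv ℝ (F Complex.I) x Complex.I =
      u x • Laplacian.laplacian Φ x - Laplacian.laplacian u x • Φ x := by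
    intro x hx
    rw [hFd 1 x hx, hFd Complex.I x hx, laplacian_eq_fderiv_apply (H.contDiffAt x hx),
      laplacian_eq_fderiv_apply hu.1.contDiffAt]
    module
  have hdiv' : (fun x => fderiv ℝ (F 1) x 1 + fderiv ℝ (F Complex.I) x Complex.I) =ᵐ[volume]
      fun x => u x • Laplacian.laplacian Φ x - Laplacian.laplacian u x • Φ x := by
    filter_upwards [ae_polyF_ne_zero e] with x hx using hdiv x hx
  -- At a branch point the majorant has order `1 + 1 / 2 < 2`; at infinity it decays to order `3`.
  have hM : Integrable fun x =>
      2 * (B * C) * (cutoffSlope e x * (√(density e x) + (1 + ‖x‖ ^ 2)⁻¹)) := by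
    have s1 : SingularBound (fun x => √(density e x)) (1 / 2) 2 :=
      (singularBound_density e).sqrt.mono le_rfl (by norm_num)
    have s2 := (singularBound_cutoffSlope e).mul
      (s1.add (singularBound_one_add_norm_sq_inv.mono (by norm_num) le_rfl))
    refine (s2.const_mul (2 * (B * C))).integrable (by norm_num) (by norm_num) ?_
    refine Measurable.aestronglyMeasurable ?_
    have := measurable_density e
    unfold cutoffSlope
    fun_prop
  have hz := integral_divergence_eq_zero (contDiff_cutoffBase e)
    (by filter_upwards [ae_polyF_ne_zero e] with x hx using (cutoffBase_pos_iff e).2 hx)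
    (fun ε hε => isCompact_le_cutoffBase e hε) (hF1 1) (hF1 Complex.I)
    ((i1.sub i2).congr hdiv'.symm) hM ?_
  · rw [integral_congr_ae hdiv', integral_sub i1 i2] at hz
    exact sub_eq_zero.1 hz
  · intro x hx
    have hx0 := (cutoffBase_pos_iff e).1 hx
    obtain ⟨b1, b2, -⟩ := hB x
    have hB0 : 0 ≤ B := (norm_nonneg _).trans b1
    have b2' : ‖fderiv ℝ u x‖ ≤ B * (1 + ‖x‖ ^ 2)⁻¹ := by
      rwa [← div_eq_mul_inv, le_div_iff₀ (by positivity)]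
    have hF : ∀ v : ℂ, ‖v‖ = 1 → ‖F v x‖ ≤ B * C * (√(density e x) + (1 + ‖x‖ ^ 2)⁻¹) := by
      intro v hv
      have c1 := (fderiv ℝ Φ x).le_opNorm v
      have c2 := (fderiv ℝ u x).le_opNorm v
      rw [hv, mul_one] at c1 c2
      calc ‖F v x‖ ≤ ‖u x‖ * ‖fderiv ℝ Φ x v‖ + ‖fderiv ℝ u x v‖ * ‖Φ x‖ := by
            refine (norm_sub_le _ _).trans (le_of_eq ?_)
            rw [norm_smul, norm_smul]
        _ ≤ B * (C * √(density e x)) + B * (1 + ‖x‖ ^ 2)⁻¹ * C := by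
            gcongr
            · exact c1.trans (H.norm_fderiv_le x hx0)
            · exact c2.trans b2'
            · exact H.norm_le x
        _ = _ := by ring
    have hs := norm_fderiv_cutoffBase_le e hx0
    calc ‖fderiv ℝ (cutoffBase e) x‖ * (‖F 1 x‖ + ‖F Complex.I x‖)
        ≤ cutoffBase e x * cutoffSlope e x * (B * C * (√(density e x) + (1 + ‖x‖ ^ 2)⁻¹) +
            B * C * (√(density e x) + (1 + ‖x‖ ^ 2)⁻¹)) := by
          refine mul_le_mul hs (add_le_add (hF 1 (by simp)) (hF Complex.I (by simp)))
            (by positivity) ((norm_nonneg _).trans hs)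
      _ = _ := by ring

theorem integrable_density_mul_of_singularBound {u : ℂ → ℝ} (hu : SingularBound u (1 / 2) (-1))
    (hm : Measurable u) : Integrable fun x => density e x * |u x| := by
  have := ((singularBound_density e).mul hu).integrable (by norm_num) (by norm_num)
    ((measurable_density e).mul hm).aestronglyMeasurable
  refine this.norm.congr (Eventually.of_forall fun x => ?_)
  simp only [norm_mul, Real.norm_eq_abs, abs_of_nonneg (density_nonneg e x)]

theorem measurable_log_one_add_norm_sq : Measurable fun x : ℂ => Real.log (1 + ‖x‖ ^ 2) :=
  (contDiff_log_one_add_norm_sq (n := 0)).continuous.measurable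

theorem TraceBounds.integrable_one_add_norm_sq_inv_sq_smul (H : TraceBounds e Φ C) :
    Integrable fun x => ((1 + ‖x‖ ^ 2) ^ 2)⁻¹ • Φ x :=
  H.integrable_smul integrable_one_add_norm_sq_inv_sq

/-- If functions `u r`, smooth on the sphere, converge to `w` with an integrable majorant, then
`∫ w ΔΦ` is the limit of `∫ Φ Δ(u r)`. -/
theorem TraceBounds.integral_smul_laplacian_of_tendsto (H : TraceBounds e Φ C) {u : ℝ → ℂ → ℝ}
    {w M : ℂ → ℝ} (hu : ∀ r > 0, SmoothOnSphere (u r))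
    (hM : Integrable fun x => density e x * M x)
    (hb : ∀ᶠ r in 𝓝[>] 0, ∀ᵐ x, |u r x| ≤ M x)
    (hlim : ∀ᵐ x, Tendsto (fun r => u r x) (𝓝[>] 0) (𝓝 (w x))) {L : ℂ}
    (hL : Tendsto (fun r => ∫ x, Laplacian.laplacian (u r) x • Φ x) (𝓝[>] 0) (𝓝 L)) :
    ∫ x, w x • Laplacian.laplacian Φ x = L := by
  refine tendsto_nhds_unique (?_ : Tendsto (fun r => ∫ x, u r x • Laplacian.laplacian Φ x)
    (𝓝[>] 0) _) (hL.congr' ?_)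
  · refine tendsto_integral_filter_of_dominated_convergence (fun x => C * (density e x * M x))
      ?_ ?_ (hM.const_mul C) ?_
    · filter_upwards [self_mem_nhdsWithin] with r hr
      exact (H.integrable_smul_laplacian (hu r hr).1.continuous.aestronglyMeasurable
        (hu r hr).integrable_density_mul).1
    · filter_upwards [hb] with r hr
      filter_upwards [hr, ae_polyF_ne_zero e] with x hx hx0
      rw [norm_smul, Real.norm_eq_abs]
      calc |u r x| * ‖Laplacian.laplacian Φ x‖ ≤ M x * (C * density e x) :=
            mul_le_mul hx (H.norm_laplacian_le x hx0) (norm_nonneg _) ((abs_nonneg _).trans hx)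
        _ = _ := by ring
    · filter_upwards [hlim] with x hx using hx.smul_const _
  · filter_upwards [self_mem_nhdsWithin] with r hr
    exact (H.integral_smul_laplacian (hu r hr)).symm

theorem laplacian_log_sub_log {p q : ℝ} (hp : 0 < p) (hq : 0 < q) (a x : ℂ) :
    Laplacian.laplacian
        (fun x : ℂ => Real.log (p * ‖x - a‖ ^ 2 + q) - Real.log (1 + ‖x‖ ^ 2)) x =
      4 * p * q / (p * ‖x - a‖ ^ 2 + q) ^ 2 - 4 * ((1 + ‖x‖ ^ 2) ^ 2)⁻¹ := by
  rw [← laplacian_log_norm_sub_sq_add hp hq, ← laplacian_log_one_add_norm_sq]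
  exact (contDiff_log_norm_sub_sq_add hp.le hq a).contDiffAt.laplacian_sub
    contDiff_log_one_add_norm_sq.contDiffAt

/-- The common computation for a finite point and for infinity: `Δ(u r)` is an approximate point
mass `4 π δ` minus a multiple of the area form of the sphere. -/
theorem TraceBounds.tendsto_integral_laplacian (H : TraceBounds e Φ C) {u k : ℝ → ℂ → ℝ}
    (hu : ∀ r > 0, SmoothOnSphere (u r))
    (hk : ∀ r > 0, ∀ x, Laplacian.laplacian (u r) x = 2 * k r x - 4 * ((1 + ‖x‖ ^ 2) ^ 2)⁻¹)
    {L : ℂ} (hL : Tendsto (fun r => ∫ x, k r x • Φ x) (𝓝[>] 0) (𝓝 (2 * Real.pi * L))) :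
    Tendsto (fun r => ∫ x, Laplacian.laplacian (u r) x • Φ x) (𝓝[>] 0)
      (𝓝 (4 * Real.pi * L - 4 * ∫ x, ((1 + ‖x‖ ^ 2) ^ 2)⁻¹ • Φ x)) := by
  have h1 := (hL.const_mul 2).sub_const (4 * ∫ x, ((1 + ‖x‖ ^ 2) ^ 2)⁻¹ • Φ x)
  have e1 : (2 * (2 * Real.pi * L) : ℂ) = 4 * Real.pi * L := by ring
  rw [e1] at h1
  refine h1.congr' ?_
  filter_upwards [self_mem_nhdsWithin] with r hr
  have i1 := H.integrable_one_add_norm_sq_inv_sq_smul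
  have i2 : Integrable fun x => Laplacian.laplacian (u r) x • Φ x :=
    H.integrable_smul (hu r hr).integrable_laplacian
  have i3 : Integrable fun x => k r x • Φ x := by
    refine ((i2.add (i1.const_mul 4)).const_mul (1 / 2)).congr (Eventually.of_forall fun x => ?_)
    simp only [Pi.add_apply, hk r hr, Complex.real_smul]
    push_cast
    ring
  rw [← integral_const_mul, ← integral_const_mul, ← integral_sub (i3.const_mul 2) (i1.const_mul 4)]
  refine integral_congr_ae (Eventually.of_forall fun x => ?_)
  simp only [hk r hr, Complex.real_smul]
  push_cast
  ring

/-- The potential of a finite point: `Δ log (|x - a|² / (1 + |x|²)) = 4 π δ_a - 4 / (1 + |x|²)²`. -/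
theorem TraceBounds.integral_log_norm_sub_smul_laplacian (H : TraceBounds e Φ C) (a : ℂ) :
    ∫ x, (2 * Real.log ‖x - a‖ - Real.log (1 + ‖x‖ ^ 2)) • Laplacian.laplacian Φ x =
      4 * Real.pi * Φ a - 4 * ∫ x, ((1 + ‖x‖ ^ 2) ^ 2)⁻¹ • Φ x := by
  -- The potential is the limit of its regularisations at scale `r`.
  have hs : ∀ r > (0 : ℝ), SmoothOnSphere
      fun x => Real.log (‖x - a‖ ^ 2 + r ^ 2) - Real.log (1 + ‖x‖ ^ 2) := fun r hr =>
    smoothOnSphere_log_sub a hr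
  refine H.integral_smul_laplacian_of_tendsto
    (M := fun x => |2 * Real.log ‖x - a‖| + |Real.log (1 + ‖x - a‖ ^ 2)| +
      |Real.log (1 + ‖x‖ ^ 2)|) hs ?_ ?_ ?_
    (H.tendsto_integral_laplacian hs
      (k := fun r x => 2 * r ^ 2 / (‖x - a‖ ^ 2 + r ^ 2) ^ 2) (fun r hr x => ?_)
      (tendsto_integral_kernel_finite H.continuous H.norm_le a))
  · have m1 : Measurable fun x => 2 * Real.log ‖x - a‖ := by fun_prop
    have m2 : Measurable fun x => Real.log (1 + ‖x - a‖ ^ 2) := by fun_prop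
    have b2 : SingularBound (fun x => Real.log (1 + ‖x - a‖ ^ 2)) 0 (-1) := by
      refine singularBound_of_continuous (C := 2 * (1 + ‖a‖)) ?_ fun x => ?_
      · exact (contDiff_log_one_add_norm_sq (n := 0)).continuous.comp
          (continuous_id.sub continuous_const)
      · rw [abs_of_nonneg (Real.log_nonneg (by nlinarith [norm_nonneg (x - a)])), neg_neg,
          Real.rpow_one]
        refine (log_one_add_norm_sq_le (x - a)).trans ?_
        nlinarith [norm_sub_le x a, norm_nonneg x, norm_nonneg a,
          mul_nonneg (norm_nonneg x) (norm_nonneg a)]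
    have i1 := integrable_density_mul_of_singularBound (e := e)
      ((singularBound_log_norm_sub a).const_mul 2) m1
    have i2 := integrable_density_mul_of_singularBound (e := e)
      (b2.mono (by norm_num) le_rfl) m2
    have i3 := integrable_density_mul_of_singularBound (e := e)
      (singularBound_log_one_add_norm_sq.mono (by norm_num) le_rfl) measurable_log_one_add_norm_sq
    refine ((i1.add i2).add i3).congr (Eventually.of_forall fun x => ?_)
    simp only [Pi.add_apply]
    ring
  · filter_upwards [Ioo_mem_nhdsGT one_pos] with r hr
    filter_upwards [Measure.ae_ne volume a] with x hx
    have hn : 0 < ‖x - a‖ := norm_pos_iff.2 (sub_ne_zero.2 hx)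
    have hr2 : r ^ 2 ≤ 1 := pow_le_one₀ hr.1.le hr.2.le
    have h1 : 2 * Real.log ‖x - a‖ ≤ Real.log (‖x - a‖ ^ 2 + r ^ 2) := by
      have := Real.log_le_log (by positivity) (by nlinarith : ‖x - a‖ ^ 2 ≤ ‖x - a‖ ^ 2 + r ^ 2)
      rwa [Real.log_pow, Nat.cast_ofNat] at this
    have h2 : Real.log (‖x - a‖ ^ 2 + r ^ 2) ≤ Real.log (1 + ‖x - a‖ ^ 2) :=
      Real.log_le_log (by positivity) (by linarith)
    refine (abs_sub _ _).trans (add_le_add_left ?_ _)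
    rw [abs_le]
    have c1 := neg_abs_le (2 * Real.log ‖x - a‖)
    have c2 := abs_nonneg (2 * Real.log ‖x - a‖)
    have c3 := le_abs_self (Real.log (1 + ‖x - a‖ ^ 2))
    have c4 := abs_nonneg (Real.log (1 + ‖x - a‖ ^ 2))
    constructor <;> linarith
  · filter_upwards [Measure.ae_ne volume a] with x hx
    have hn : 0 < ‖x - a‖ := norm_pos_iff.2 (sub_ne_zero.2 hx)
    refine Tendsto.sub_const ?_ _
    have hc : ContinuousAt (fun r : ℝ => Real.log (‖x - a‖ ^ 2 + r ^ 2)) 0 :=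
      (by fun_prop : ContinuousAt (fun r : ℝ => ‖x - a‖ ^ 2 + r ^ 2) 0).log (by positivity)
    have := hc.tendsto.mono_left (nhdsWithin_le_nhds (s := Set.Ioi 0))
    simpa using this
  · have := laplacian_log_sub_log one_pos (by positivity : 0 < r ^ 2) a x
    simp only [one_mul] at this
    rw [this]
    ring

/-- The potential of the point at infinity: `L` is the value of `Φ` there. -/
theorem TraceBounds.integral_log_smul_laplacian (H : TraceBounds e Φ C) {L : ℂ}
    (hL : Tendsto Φ (cocompact ℂ) (𝓝 L)) :
    ∫ x, (-Real.log (1 + ‖x‖ ^ 2)) • Laplacian.laplacian Φ x =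
      4 * Real.pi * L - 4 * ∫ x, ((1 + ‖x‖ ^ 2) ^ 2)⁻¹ • Φ x := by
  have hs : ∀ r > (0 : ℝ), SmoothOnSphere
      fun x => Real.log (r ^ 2 * ‖x‖ ^ 2 + 1) - Real.log (1 + ‖x‖ ^ 2) := fun r hr =>
    smoothOnSphere_log_infinity hr
  refine H.integral_smul_laplacian_of_tendsto
    (M := fun x => |Real.log (1 + ‖x‖ ^ 2)|) hs ?_ ?_ ?_
    (H.tendsto_integral_laplacian hs
      (k := fun r x => 2 * r ^ 2 / (r ^ 2 * ‖x‖ ^ 2 + 1) ^ 2) (fun r hr x => ?_)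
      (tendsto_integral_kernel_infinity H.continuous H.norm_le hL))
  · exact integrable_density_mul_of_singularBound
      (singularBound_log_one_add_norm_sq.mono (by norm_num) le_rfl) measurable_log_one_add_norm_sq
  · filter_upwards [Ioo_mem_nhdsGT one_pos] with r hr
    refine Eventually.of_forall fun x => ?_
    have hr2 : r ^ 2 ≤ 1 := pow_le_one₀ hr.1.le hr.2.le
    have h1 : 0 ≤ Real.log (r ^ 2 * ‖x‖ ^ 2 + 1) :=
      Real.log_nonneg (by nlinarith [sq_nonneg (r * ‖x‖)])
    have h2 : Real.log (r ^ 2 * ‖x‖ ^ 2 + 1) ≤ Real.log (1 + ‖x‖ ^ 2) :=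
      Real.log_le_log (by positivity) (by nlinarith [sq_nonneg ‖x‖])
    rw [abs_of_nonneg (h1.trans h2), abs_le]
    constructor <;> linarith
  · refine Eventually.of_forall fun x => ?_
    have hc : ContinuousAt (fun r : ℝ => Real.log (r ^ 2 * ‖x‖ ^ 2 + 1)) 0 :=
      (by fun_prop : ContinuousAt (fun r : ℝ => r ^ 2 * ‖x‖ ^ 2 + 1) 0).log (by positivity)
    have := (hc.tendsto.mono_left (nhdsWithin_le_nhds (s := Set.Ioi 0))).sub_const
      (Real.log (1 + ‖x‖ ^ 2))
    simpa using this
  · have := laplacian_log_sub_log (by positivity : 0 < r ^ 2) one_pos 0 x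
    simp only [sub_zero, mul_one] at this
    rw [this]
    ring

end Green

/-! ### Charts of the curve at ordinary points -/

section Charts

variable {g : ℕ} (e : Fin (2 * g + 2) ↪ ℂ)

theorem chart_ofAffine (p : PlaneCurve (polyF e)) (hp : p.1.2 ≠ 0) :
    chart e (ofAffine e p) = affineChart e p hp := by
  have := (exists_chart e (ofAffine e p)).choose_spec
  rcases this with ⟨p', hp', h, h'⟩ | ⟨k, h, h'⟩ | ⟨q, hq, h0, h, h'⟩
  · obtain rfl := ofAffine_injective e h
    exact h'
  · exact absurd (congrArg (fun p => p.1.2) (ofAffine_injective e h)).symm hp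
  · exact absurd h0 ((ofInfinite_mem_affine e).1 ⟨p, h.symm⟩)

theorem chart_weierstrassPoint (k : Fin (2 * g + 2)) :
    chart e (weierstrassPoint e k) = weierstrassChart e k := by
  have := (exists_chart e (weierstrassPoint e k)).choose_spec
  rcases this with ⟨p', hp', h, h'⟩ | ⟨k', h, h'⟩ | ⟨q, hq, h0, h, h'⟩
  · exact absurd (congrArg (fun p => p.1.2) (ofAffine_injective e h)) hp'
  · obtain rfl := e.injective (congrArg (fun p => p.1.1) (ofAffine_injective e h))
    exact h'
  · exact absurd h0 ((ofInfinite_mem_affine e).1 ⟨_, h.symm⟩)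

theorem chart_ofInfinite (q : PlaneCurve (polyG e)) (hq : q.1.1 = 0) (hq' : q.1.2 ≠ 0) :
    chart e (ofInfinite e q) = infiniteChart e q hq' := by
  have := (exists_chart e (ofInfinite e q)).choose_spec
  rcases this with ⟨p', hp', h, h'⟩ | ⟨k', h, h'⟩ | ⟨q', hq, h0, h, h'⟩
  · exact absurd hq ((ofInfinite_mem_affine e).1 ⟨_, h⟩)
  · exact absurd hq ((ofInfinite_mem_affine e).1 ⟨_, h⟩)
  · obtain rfl := ofInfinite_injective e h
    exact h'

theorem xCoord_affineChart_symm (p : PlaneCurve (polyF e)) (hp : p.1.2 ≠ 0) (t : ℂ) :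
    xCoord e ((affineChart e p hp).symm t) = t := rfl

theorem xCoord_weierstrassChart_symm (k : Fin (2 * g + 2)) (t : ℂ) :
    xCoord e ((weierstrassChart e k).symm t) = e k + t ^ 2 := rfl

theorem xCoord_infiniteChart_symm (q : PlaneCurve (polyG e)) (hq : q.1.2 ≠ 0) (t : ℂ) :
    xCoord e ((infiniteChart e q hq).symm t) = t⁻¹ := rfl

theorem affineChart_ofAffine (p : PlaneCurve (polyF e)) (hp : p.1.2 ≠ 0) :
    affineChart e p hp (ofAffine e p) = p.1.1 :=
  (affineChart_apply e p hp (mem_affineChart_source e p hp)).2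

theorem weierstrassChart_weierstrassPoint (k : Fin (2 * g + 2)) :
    weierstrassChart e k (weierstrassPoint e k) = 0 := by
  rw [(weierstrassChart_apply e k (mem_weierstrassChart_source e k)).2.2]
  have : yCoord e (weierstrassPoint e k) = 0 := rfl
  rw [this, zero_div]

theorem infiniteChart_ofInfinite (q : PlaneCurve (polyG e)) (hq : q.1.2 ≠ 0) :
    infiniteChart e q hq (ofInfinite e q) = q.1.1 :=
  (infiniteChart_apply e q hq (mem_infiniteChart_source e q hq)).2

theorem polyF_ne_zero_of_mem_target {p : PlaneCurve (polyF e)} {hp : p.1.2 ≠ 0} {t : ℂ}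
    (ht : t ∈ (affineChart e p hp).target) : polyF e t ≠ 0 := by
  have h : polyF e t / p.1.2 ^ 2 ∈ Complex.slitPlane := ht.1
  intro h0
  rw [h0, zero_div] at h
  exact Complex.slitPlane_ne_zero h rfl

/-- The points of `C₀` that are not Weierstrass points. -/
def ordinary : Set (Curve e) := ofAffine e '' {p | p.1.2 ≠ 0}

theorem isOpen_ordinary : IsOpen (ordinary e) :=
  (isOpenEmbedding_ofAffine e).isOpenMap _
    (isOpen_ne_fun (continuous_snd.comp continuous_subtype_val) continuous_const)

theorem continuousAt_xCoord (p : PlaneCurve (polyF e)) :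
    ContinuousAt (xCoord e) (ofAffine e p) := by
  rw [← (isOpenEmbedding_ofAffine e).continuousAt_iff]
  exact (continuous_fst.comp continuous_subtype_val).continuousAt

theorem polyF_ne_zero_of_snd_ne_zero {p : PlaneCurve (polyF e)} (hp : p.1.2 ≠ 0) :
    polyF e p.1.1 ≠ 0 := by
  rw [← p.2]
  exact pow_ne_zero 2 hp

theorem conformalFactor_affineChart {p : PlaneCurve (polyF e)} {hp : p.1.2 ≠ 0} {t : ℂ}
    (ht : t ∈ (affineChart e p hp).target) :
    conformalFactor e (affineChart e p hp) t = density e t := by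
  have hF := polyF_ne_zero_of_mem_target e ht
  set y := p.1.2 * Complex.sqrt (polyF e t / p.1.2 ^ 2) with hy
  have hy2 : y ^ 2 = polyF e t := baseChart_aux hp
  have hy0 : y ≠ 0 := fun h => hF (by rw [← hy2, h]; ring)
  have hyn : ‖y‖ ^ 2 = ‖polyF e t‖ := by rw [← hy2, norm_pow]
  have h1 : (affineChart e p hp).symm t ∈ Set.range (ofAffine e) := ⟨_, rfl⟩
  have h2 : yCoord e ((affineChart e p hp).symm t) = y := rfl
  have h3 : deriv (fun s => xCoord e ((affineChart e p hp).symm s)) t = 1 := by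
    have : (fun s => xCoord e ((affineChart e p hp).symm s)) = fun s => s := rfl
    rw [this, deriv_id'']
  have key : ∀ i : Fin g, ‖formCoeff e i (affineChart e p hp) t‖ ^ 2 =
      (‖t‖ ^ 2) ^ (i : ℕ) / ‖polyF e t‖ := by
    intro i
    unfold formCoeff
    rw [if_pos h1, h2, if_pos hy0, h3, xCoord_affineChart_symm, mul_one, norm_div, div_pow, hyn,
      norm_pow, ← pow_mul, ← pow_mul, mul_comm]
  unfold conformalFactor density sigma
  rw [Finset.sum_congr rfl fun i _ => key i, ← Finset.sum_div,
    Finset.sum_range fun i => (‖t‖ ^ 2) ^ i]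

/-- A function on `X` written in the coordinate `x` near an ordinary point. -/
noncomputable def localBranch (φ : Curve e → ℂ) (p : PlaneCurve (polyF e)) (hp : p.1.2 ≠ 0)
    (t : ℂ) : ℂ :=
  φ ((affineChart e p hp).symm t)

variable {e}

theorem laplaceBeltrami_ofAffine (φ : Curve e → ℂ) (p : PlaneCurve (polyF e)) (hp : p.1.2 ≠ 0) :
    laplaceBeltrami e φ (ofAffine e p) =
      ((density e p.1.1)⁻¹ : ℝ) * Laplacian.laplacian (localBranch e φ p hp) p.1.1 := by
  have ht := (affineChart e p hp).map_source (mem_affineChart_source e p hp)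
  unfold laplaceBeltrami
  rw [chart_ofAffine e p hp, conformalFactor_affineChart e ht, affineChart_ofAffine]
  rfl

/-- The denominator `|f|` of the density does not contribute to the curvature: `log |f|` is
harmonic. -/
theorem gaussCurvature_ofAffine (hg : 0 < g) (p : PlaneCurve (polyF e)) (hp : p.1.2 ≠ 0) :
    gaussCurvature e (ofAffine e p) = -(1 / 2) * (density e p.1.1)⁻¹ *
      Laplacian.laplacian (fun x : ℂ => Real.log (sigma g (‖x‖ ^ 2))) p.1.1 := by
  have ht := (affineChart e p hp).map_source (mem_affineChart_source e p hp)
  have hF := polyF_ne_zero_of_snd_ne_zero e hp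
  have hh : InnerProductSpace.HarmonicAt (fun x => Real.log ‖polyF e x‖) p.1.1 := by
    refine AnalyticAt.harmonicAt_log_norm ?_ hF
    have : Differentiable ℂ (polyF e) := fun t => differentiableAt_polyF e t
    exact this.analyticAt _
  have hev : (fun t => Real.log (conformalFactor e (affineChart e p hp) t)) =ᶠ[𝓝 p.1.1]
      (fun x : ℂ => Real.log (sigma g (‖x‖ ^ 2))) - fun x => Real.log ‖polyF e x‖ := by
    rw [affineChart_ofAffine] at ht
    filter_upwards [(affineChart e p hp).open_target.mem_nhds ht] with t ht
    have := polyF_ne_zero_of_mem_target e ht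
    rw [conformalFactor_affineChart e ht, density, Real.log_div (sigma_pos hg (sq_nonneg _)).ne'
      (norm_ne_zero_iff.2 this)]
    rfl
  unfold gaussCurvature
  rw [chart_ofAffine e p hp, conformalFactor_affineChart e ht, affineChart_ofAffine,
    (InnerProductSpace.laplacian_congr_nhds hev).eq_of_nhds,
    (contDiff_log_sigma hg).contDiffAt.laplacian_sub hh.1]
  have := hh.2.eq_of_nhds
  rw [this]
  simp

theorem comp_symm_eventuallyEq_localBranch (φ : Curve e → ℂ)
    (ψ : OpenPartialHomeomorph (Curve e) ℂ) (p : PlaneCurve (polyF e)) (hp : p.1.2 ≠ 0)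
    (hQ : ofAffine e p ∈ ψ.source) :
    (fun t => φ (ψ.symm t)) =ᶠ[𝓝 (ψ (ofAffine e p))]
      fun t => localBranch e φ p hp (xCoord e (ψ.symm t)) := by
  have hc : ContinuousAt ψ.symm (ψ (ofAffine e p)) := ψ.continuousAt_symm (ψ.map_source hQ)
  have hmem : (affineChart e p hp).source ∈ 𝓝 (ψ.symm (ψ (ofAffine e p))) := by
    rw [ψ.left_inv hQ]
    exact (affineChart e p hp).open_source.mem_nhds (mem_affineChart_source e p hp)
  filter_upwards [hc.preimage_mem_nhds hmem] with t ht
  have h1 := (affineChart_apply e p hp ht).2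
  unfold localBranch
  rw [← h1, (affineChart e p hp).left_inv ht]

/-! ### Smooth functions on the curve in charts -/

variable (e) in
theorem isManifold_real : IsManifold 𝓘(ℝ, ℂ) ∞ (Curve e) := by
  refine isManifold_of_contDiffOn _ _ _ fun ψ ψ' hψ hψ' => ?_
  have h := StructureGroupoid.compatible (contDiffGroupoid ω 𝓘(ℂ)) hψ hψ'
  rw [contDiffGroupoid, mem_groupoid_of_pregroupoid] at h
  have h1 : ContDiffOn ℂ ω _ _ := h.1
  exact (h1.restrict_scalars ℝ).of_le le_top

theorem contDiffAt_comp_chart_symm {φ : Curve e → ℂ} (hφ : ContMDiff 𝓘(ℝ, ℂ) 𝓘(ℝ, ℂ) ∞ φ)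
    (P : Curve e) {t : ℂ} (ht : t ∈ (chart e P).target) :
    ContDiffAt ℝ ∞ (fun t => φ ((chart e P).symm t)) t := by
  have := isManifold_real e
  have hQ : (chart e P).symm t ∈ (chartAt ℂ P).source := (chart e P).map_target ht
  have h1 := (contMDiffAt_iff_source_of_mem_source hQ).1 (hφ _)
  have h2 := contMDiffWithinAt_iff_contDiffWithinAt.1 h1
  have h3 : extChartAt 𝓘(ℝ, ℂ) P ((chart e P).symm t) = t := (chart e P).right_inv ht
  rw [h3, ModelWithCorners.range_eq_univ, contDiffWithinAt_univ] at h2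
  exact h2

end Charts

/-! ### Compactness and uniform bounds in the canonical metric -/

section Bounds

variable {g : ℕ} (e : Fin (2 * g + 2) ↪ ℂ)

theorem isCompact_planeCurve {h : ℂ → ℂ} (hh : Continuous h) :
    IsCompact {p : PlaneCurve h | ‖p.1.1‖ ≤ 1} := by
  have hcl : IsClosed {p : ℂ × ℂ | p.2 ^ 2 = h p.1} :=
    isClosed_eq (by fun_prop) (hh.comp continuous_fst)
  obtain ⟨C, hC⟩ := (isCompact_closedBall (0 : ℂ) 1).exists_bound_of_continuousOn hh.continuousOn
  have hK := (isCompact_closedBall (0 : ℂ) 1).prod (isCompact_closedBall (0 : ℂ) (1 + C))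
  refine (hcl.isClosedEmbedding_subtypeVal.isCompact_preimage hK).of_isClosed_subset
    (isClosed_le (continuous_fst.comp continuous_subtype_val).norm continuous_const) ?_
  intro p hp
  have hp : ‖p.1.1‖ ≤ 1 := hp
  have h1 : ‖p.1.1‖ ≤ 1 ∧ ‖p.1.2‖ ≤ 1 + C := by
    refine ⟨hp, ?_⟩
    have h2 := hC p.1.1 (by simpa using hp)
    rw [← p.2, norm_pow] at h2
    nlinarith [norm_nonneg p.1.2, sq_nonneg (‖p.1.2‖ - 1)]
  simpa using h1

instance compactSpace_curve : CompactSpace (Curve e) := by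
  have h := ((isCompact_planeCurve (continuous_polyF e)).image (continuous_ofAffine e)).union
    ((isCompact_planeCurve (continuous_polyG e)).image (continuous_ofInfinite e))
  refine ⟨?_⟩
  convert h
  refine (Set.eq_univ_of_forall fun P => ?_).symm
  rcases exists_eq e P with ⟨p, rfl⟩ | ⟨q, hq, rfl⟩
  · by_cases hp : ‖p.1.1‖ ≤ 1
    · exact .inl ⟨p, hp, rfl⟩
    · rw [not_le] at hp
      have h0 : p.1.1 ≠ 0 := norm_pos_iff.1 (zero_lt_one.trans hp)
      refine .inr ⟨toInfinite e p h0, ?_, ofInfinite_toInfinite e p h0⟩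
      change ‖p.1.1⁻¹‖ ≤ 1
      rw [norm_inv]
      exact inv_le_one_of_one_le₀ hp.le
  · exact .inr ⟨q, by simp [hq], rfl⟩

variable {e}

/-- In the preferred coordinate `t` at any point, the metric `density · |dx|²` is bounded below by a
multiple of `|dt|²`. -/
theorem exists_le_norm_deriv_sq_mul_density (hg : 0 < g) (P : Curve e) :
    ∃ c > 0, ∀ᶠ t in 𝓝 (chart e P P), polyF e (xCoord e ((chart e P).symm t)) ≠ 0 →
      (chart e P).symm t ∈ ordinary e →
      AnalyticAt ℂ (fun t => xCoord e ((chart e P).symm t)) t ∧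
        c ≤ ‖deriv (fun t => xCoord e ((chart e P).symm t)) t‖ ^ 2 *
          density e (xCoord e ((chart e P).symm t)) := by
  rcases point_cases e P with ⟨p, hp, rfl⟩ | ⟨k, rfl⟩ | ⟨q, hq, rfl⟩
  · rw [chart_ofAffine e p hp, affineChart_ofAffine]
    simp only [xCoord_affineChart_symm]
    have h0 := polyF_ne_zero_of_snd_ne_zero e hp
    have hc : ContinuousAt (density e) p.1.1 := (continuous_sigma_norm_sq g).continuousAt.div
      (continuous_polyF e).norm.continuousAt (norm_ne_zero_iff.2 h0)
    have hpos := density_pos e hg h0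
    refine ⟨density e p.1.1 / 2, by positivity, ?_⟩
    filter_upwards [hc.eventually (lt_mem_nhds (half_lt_self hpos))] with t ht _ _
    refine ⟨analyticAt_id, ?_⟩
    simpa using ht.le
  -- With `x = eₖ + t²`, the factor `|dx/dt|² = 4 |t|²` cancels the pole of the density at `eₖ`.
  · rw [chart_weierstrassPoint, weierstrassChart_weierstrassPoint]
    simp only [xCoord_weierstrassChart_symm]
    have hc : ContinuousAt (fun t : ℂ => 4 * sigma g (‖e k + t ^ 2‖ ^ 2) /
        ‖polyFk e k (e k + t ^ 2)‖) 0 := by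
      refine ContinuousAt.div ?_ ?_ ?_
      · exact (continuous_const.mul ((continuous_sigma_norm_sq g).comp (by fun_prop))).continuousAt
      · exact ((continuous_polyFk e k).comp (by fun_prop)).norm.continuousAt
      · simpa using polyFk_ne_zero e k
    have hpos : 0 < 4 * sigma g (‖e k + 0 ^ 2‖ ^ 2) / ‖polyFk e k (e k + 0 ^ 2)‖ := by
      have h1 := sigma_pos hg (sq_nonneg ‖e k + 0 ^ 2‖)
      have h2 : 0 < ‖polyFk e k (e k + 0 ^ 2)‖ := by simpa using polyFk_ne_zero e k
      positivity
    refine ⟨_, half_pos hpos, ?_⟩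
    filter_upwards [hc.eventually (lt_mem_nhds (half_lt_self hpos))] with t ht h0 _
    rw [polyF_eq e k, add_sub_cancel_left, mul_ne_zero_iff] at h0
    have ht0 : 0 < ‖t‖ := norm_pos_iff.2 fun h => h0.1 (by simp [h])
    have hd : HasDerivAt (fun t : ℂ => e k + t ^ 2) (2 * t) t := by
      simpa using (hasDerivAt_pow 2 t).const_add (e k)
    refine ⟨by fun_prop, ?_⟩
    rw [hd.deriv, density, polyF_eq e k, add_sub_cancel_left]
    refine ht.le.trans (le_of_eq ?_)
    simp only [norm_mul, norm_pow, Complex.norm_ofNat]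
    have := norm_pos_iff.2 h0.2
    field_simp
    ring
  -- In the coordinate `z = x⁻¹` the metric is `σ_g(|z|²) / |g(z)| |dz|²`, as `σ_g` is palindromic.
  · have hq' := snd_ne_zero_of_fst_eq_zero e hq
    rw [chart_ofInfinite e q hq hq', infiniteChart_ofInfinite, hq]
    simp only [xCoord_infiniteChart_symm]
    have hc : ContinuousAt (fun t : ℂ => sigma g (‖t‖ ^ 2) / ‖polyG e t‖) 0 :=
      (continuous_sigma_norm_sq g).continuousAt.div (continuous_polyG e).norm.continuousAt
        (by simp [polyG])
    have hpos : 0 < sigma g (‖(0 : ℂ)‖ ^ 2) / ‖polyG e 0‖ := by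
      have h1 := sigma_pos hg (sq_nonneg ‖(0 : ℂ)‖)
      have h2 : 0 < ‖polyG e 0‖ := by simp [polyG]
      positivity
    refine ⟨_, half_pos hpos, ?_⟩
    filter_upwards [hc.eventually (lt_mem_nhds (half_lt_self hpos))] with t ht h0 h1
    have ht0 : t ≠ 0 := by
      obtain ⟨p, -, hp⟩ := h1
      exact (ofInfinite_mem_affine e).1 ⟨p, hp⟩
    have htn : 0 < ‖t‖ := norm_pos_iff.2 ht0
    refine ⟨analyticAt_inv ht0, ?_⟩
    have hG := polyG_eq e (inv_mul_cancel₀ ht0)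
    refine ht.le.trans (le_of_eq ?_)
    have hFn := norm_pos_iff.2 h0
    rw [deriv_inv, density, norm_inv, inv_pow, sigma_inv (by positivity), hG, norm_mul, norm_neg,
      norm_inv, norm_pow, norm_pow]
    have e1 : ‖t‖ ^ (2 * g + 2) = (‖t‖ ^ 2) ^ (g - 1) * (‖t‖ ^ 2) ^ 2 := by
      rw [← pow_add, ← pow_mul]
      congr 1
      omega
    rw [e1]
    field_simp

theorem contDiffAt_localBranch {φ : Curve e → ℂ} (hφ : ContMDiff 𝓘(ℝ, ℂ) 𝓘(ℝ, ℂ) ∞ φ)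
    (p : PlaneCurve (polyF e)) (hp : p.1.2 ≠ 0) : ContDiffAt ℝ 2 (localBranch e φ p hp) p.1.1 := by
  have := contDiffAt_comp_chart_symm hφ (ofAffine e p)
    ((chart e (ofAffine e p)).map_source (mem_chart_source e _))
  rw [chart_ofAffine e p hp, affineChart_ofAffine] at this
  exact this.of_le (by norm_cast)

/-- The gradient and the Laplacian of a smooth function at ordinary points are bounded in the
canonical metric. -/
theorem exists_bound_localBranch (hg : 0 < g) {φ : Curve e → ℂ}
    (hφ : ContMDiff 𝓘(ℝ, ℂ) 𝓘(ℝ, ℂ) ∞ φ) :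
    ∃ C, ∀ (p : PlaneCurve (polyF e)) (hp : p.1.2 ≠ 0),
      ‖fderiv ℝ (localBranch e φ p hp) p.1.1‖ ≤ C * √(density e p.1.1) ∧
      ‖Laplacian.laplacian (localBranch e φ p hp) p.1.1‖ ≤ C * density e p.1.1 := by
  -- By compactness of the curve it suffices to bound both quantities near each point.
  have hloc : ∀ P : Curve e, ∃ C, ∀ᶠ Q in 𝓝 P, ∀ (p : PlaneCurve (polyF e)) (hp : p.1.2 ≠ 0),
      ofAffine e p = Q → ‖fderiv ℝ (localBranch e φ p hp) p.1.1‖ ≤ C * √(density e p.1.1) ∧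
      ‖Laplacian.laplacian (localBranch e φ p hp) p.1.1‖ ≤ C * density e p.1.1 := by
    intro P
    obtain ⟨c, hc, hev⟩ := exists_le_norm_deriv_sq_mul_density hg P
    set ψ := chart e P
    have hPs : P ∈ ψ.source := mem_chart_source e P
    set B : ℂ → ℂ := fun t => φ (ψ.symm t)
    have hB := contDiffAt_comp_chart_symm hφ P (ψ.map_source hPs)
    have e1 := eventually_norm_le_of_continuousAt
      (hB.fderiv_right (m := 1) (by norm_cast)).continuousAt
    have e2 := eventually_norm_le_of_continuousAt
      (continuousAt_laplacian (hB.of_le (by norm_cast)))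
    set K1 := ‖fderiv ℝ (fun t => φ (ψ.symm t)) (ψ P)‖ + 1
    set K2 := ‖Laplacian.laplacian (fun t => φ (ψ.symm t)) (ψ P)‖ + 1
    have hK1 : 0 ≤ K1 := by positivity
    have hK2 : 0 ≤ K2 := by positivity
    have hψc : ContinuousAt ψ P := ψ.continuousAt hPs
    refine ⟨max (K1 / √c) (K2 / c), ?_⟩
    filter_upwards [hψc.eventually hev, hψc.eventually e1, hψc.eventually e2,
      ψ.open_source.mem_nhds hPs] with Q h1 h2 h3 hQ p hp hpQ
    subst hpQ
    have hl := ψ.left_inv hQ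
    have hx : xCoord e (ψ.symm (ψ (ofAffine e p))) = p.1.1 := by rw [hl]; rfl
    have hF := polyF_ne_zero_of_snd_ne_zero e hp
    obtain ⟨ha, hcd⟩ := h1 (by rwa [hx]) (by rw [hl]; exact ⟨p, hp, rfl⟩)
    have hloc := comp_symm_eventuallyEq_localBranch φ ψ p hp hQ
    have hsm := contDiffAt_localBranch hφ p hp
    have hsm' : ContDiffAt ℝ 2 (localBranch e φ p hp)
        (xCoord e (ψ.symm (ψ (ofAffine e p)))) := by rwa [hx]
    set X : ℂ → ℂ := fun t => xCoord e (ψ.symm t)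
    rw [hx] at hcd
    have hdpos : 0 < density e p.1.1 := density_pos e hg hF
    have hd0 : deriv X (ψ (ofAffine e p)) ≠ 0 := by
      intro h0
      rw [h0] at hcd
      simp at hcd
      linarith
    have hdn : 0 < ‖deriv X (ψ (ofAffine e p))‖ := norm_pos_iff.2 hd0
    set d := ‖deriv X (ψ (ofAffine e p))‖
    constructor
    · have i1 := norm_fderiv_comp_analytic (Φ := localBranch e φ p hp) (X := X)
        ha.differentiableAt hd0 (hsm'.differentiableAt (by norm_num))
      rw [← hloc.fderiv_eq] at i1
      have hXp : X (ψ (ofAffine e p)) = p.1.1 := hx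
      rw [hXp] at i1
      have i2 := i1.trans h2
      have i3 : √c ≤ d * √(density e p.1.1) := by
        rw [← Real.sqrt_sq hdn.le, ← Real.sqrt_mul (sq_nonneg d)]
        exact Real.sqrt_le_sqrt hcd
      calc ‖fderiv ℝ (localBranch e φ p hp) p.1.1‖ ≤ K1 / √c * √(density e p.1.1) := by
            rw [div_mul_eq_mul_div, le_div_iff₀ (Real.sqrt_pos.2 hc)]
            calc _ ≤ ‖fderiv ℝ (localBranch e φ p hp) p.1.1‖ * (d * √(density e p.1.1)) := by
                  gcongr
              _ = ‖fderiv ℝ (localBranch e φ p hp) p.1.1‖ * d * √(density e p.1.1) := by ring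
              _ ≤ _ := by gcongr
        _ ≤ _ := by gcongr; exact le_max_left _ _
    · have i1 := laplacian_comp_analytic (Φ := localBranch e φ p hp) (X := X) ha hsm'
      have hloc' : (fun t => φ (ψ.symm t)) =ᶠ[𝓝 (ψ (ofAffine e p))]
        fun s => localBranch e φ p hp (X s) := hloc
      rw [← (InnerProductSpace.laplacian_congr_nhds hloc').eq_of_nhds] at i1
      have hXp : X (ψ (ofAffine e p)) = p.1.1 := hx
      rw [i1, hXp, norm_smul, norm_pow, norm_norm] at h3
      calc ‖Laplacian.laplacian (localBranch e φ p hp) p.1.1‖ ≤ K2 / c * density e p.1.1 := by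
            rw [div_mul_eq_mul_div, le_div_iff₀ hc]
            calc _ ≤ ‖Laplacian.laplacian (localBranch e φ p hp) p.1.1‖ *
                  (d ^ 2 * density e p.1.1) := by gcongr
              _ = d ^ 2 * ‖Laplacian.laplacian (localBranch e φ p hp) p.1.1‖ *
                  density e p.1.1 := by ring
              _ ≤ _ := by gcongr
        _ ≤ _ := by gcongr; exact le_max_right _ _
  choose C hC using hloc
  obtain ⟨T, -, hT⟩ := isCompact_univ.elim_nhds_subcover (fun P => {Q | ∀ (p : PlaneCurve (polyF e))
    (hp : p.1.2 ≠ 0), ofAffine e p = Q →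
      ‖fderiv ℝ (localBranch e φ p hp) p.1.1‖ ≤ C P * √(density e p.1.1) ∧
      ‖Laplacian.laplacian (localBranch e φ p hp) p.1.1‖ ≤ C P * density e p.1.1})
    fun P _ => hC P
  refine ⟨∑ P ∈ T, |C P|, fun p hp => ?_⟩
  obtain ⟨P, hP, hPp⟩ := Set.mem_iUnion₂.1 (hT (Set.mem_univ (ofAffine e p)))
  obtain ⟨h1, h2⟩ := hPp p hp rfl
  have hle : C P ≤ ∑ P ∈ T, |C P| := (le_abs_self _).trans
    (Finset.single_le_sum (f := fun P => |C P|) (fun i _ => abs_nonneg _) hP)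
  exact ⟨h1.trans (by gcongr), h2.trans (mul_le_mul_of_nonneg_right hle (density_nonneg e _))⟩

/-! ### The trace of a function to the plane -/

variable (e)

theorem continuous_involution : Continuous (involution e) := by
  refine Continuous.quotient_lift ?_ _
  refine continuous_sumElim.2 ⟨(continuous_ofAffine e).comp ?_, (continuous_ofInfinite e).comp ?_⟩
  all_goals
    exact ((continuous_fst.comp continuous_subtype_val).prodMk
      (continuous_snd.comp continuous_subtype_val).neg).subtype_mk _

theorem involution_ofAffine (p : PlaneCurve (polyF e)) :
    involution e (ofAffine e p) = ofAffine e ⟨(p.1.1, -p.1.2), by simpa using p.2⟩ := rfl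

theorem involution_ofInfinite (q : PlaneCurve (polyG e)) :
    involution e (ofInfinite e q) = ofInfinite e ⟨(q.1.1, -q.1.2), by simpa using q.2⟩ := rfl

theorem involution_involution (P : Curve e) : involution e (involution e P) = P := by
  rcases exists_eq e P with ⟨p, rfl⟩ | ⟨q, -, rfl⟩
  · simp only [involution_ofAffine, neg_neg]
  · simp only [involution_ofInfinite, neg_neg]

theorem involution_injective : Function.Injective (involution e) :=
  Function.LeftInverse.injective (involution_involution e)

/-- The section `x ↦ (x, √f(x))` with the principal branch of the square root. -/
noncomputable def sheet (x : ℂ) : Curve e :=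
  ofAffine e ⟨(x, Complex.sqrt (polyF e x)), sqrt_sq _⟩

/-- The sum of a function over the two points of `X` above a point of the `x`-plane. -/
noncomputable def trace (φ : Curve e → ℂ) (x : ℂ) : ℂ :=
  φ (sheet e x) + φ (involution e (sheet e x))

variable {e}

theorem trace_ofAffine (φ : Curve e → ℂ) (p : PlaneCurve (polyF e)) :
    trace e φ p.1.1 = φ (ofAffine e p) + φ (involution e (ofAffine e p)) := by
  have h : p.1.2 ^ 2 = Complex.sqrt (polyF e p.1.1) ^ 2 := by rw [p.2, sqrt_sq]
  rcases sq_eq_sq_iff_eq_or_eq_neg.1 h with h | h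
  · have : sheet e p.1.1 = ofAffine e p := congrArg (ofAffine e) (Subtype.ext (Prod.ext rfl h.symm))
    rw [trace, this]
  · have : sheet e p.1.1 = involution e (ofAffine e p) := by
      rw [involution_ofAffine]
      exact congrArg (ofAffine e) (Subtype.ext (Prod.ext rfl (neg_eq_iff_eq_neg.2 h).symm))
    rw [trace, this, involution_involution, add_comm]

theorem trace_xCoord (φ : Curve e → ℂ) {Q : Curve e} (hQ : Q ∈ Set.range (ofAffine e)) :
    trace e φ (xCoord e Q) = φ Q + φ (involution e Q) := by
  obtain ⟨p, rfl⟩ := hQ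
  exact trace_ofAffine φ p

theorem snd_sheet_ne_zero {x : ℂ} (hx : polyF e x ≠ 0) : Complex.sqrt (polyF e x) ≠ 0 :=
  fun h => hx (by rw [← sqrt_sq (polyF e x), h]; ring)

/-- The conjugate `(x, -y)` of a point `(x, y)` of the affine plane curve. -/
def conjPoint {h : ℂ → ℂ} (p : PlaneCurve h) : PlaneCurve h :=
  ⟨(p.1.1, -p.1.2), by simpa using p.2⟩

theorem conjPoint_snd_ne_zero {h : ℂ → ℂ} {p : PlaneCurve h} (hp : p.1.2 ≠ 0) :
    (conjPoint p).1.2 ≠ 0 :=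
  neg_ne_zero.2 hp

/-- The trace does not depend on the choice of the square root, so that near `x` it can be computed
with a smooth one. -/
theorem trace_eq_localBranch (φ : Curve e → ℂ) (p : PlaneCurve (polyF e)) (hp : p.1.2 ≠ 0) :
    trace e φ = localBranch e φ p hp +
      localBranch e φ (conjPoint p) (conjPoint_snd_ne_zero hp) := by
  funext t
  have h := trace_ofAffine φ ⟨(t, p.1.2 * Complex.sqrt (polyF e t / p.1.2 ^ 2)), baseChart_aux hp⟩
  rw [Pi.add_apply]
  refine h.trans ?_
  unfold localBranch
  rw [involution_ofAffine]
  have : ∀ y y' : ℂ, y = y' → ∀ (h : y ^ 2 = polyF e t) (h' : y' ^ 2 = polyF e t),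
      ofAffine e ⟨(t, y), h⟩ = ofAffine e ⟨(t, y'), h'⟩ := by
    rintro y _ rfl _ _
    rfl
  refine congrArg₂ (· + ·) rfl (congrArg φ (this _ _ ?_ _ _))
  change -(p.1.2 * _) = -p.1.2 * Complex.sqrt (polyF e t / (-p.1.2) ^ 2)
  rw [neg_sq, neg_mul]

theorem continuousAt_sheet_of_eq_zero {x : ℂ} (hx : polyF e x = 0) :
    ContinuousAt (sheet e) x := by
  refine (continuous_ofAffine e).continuousAt.comp ?_
  refine tendsto_subtype_rng.2 (continuousAt_id.prodMk ?_)
  have h1 : ∀ a : ℂ, ‖Complex.sqrt a‖ = √‖a‖ := fun a => by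
    rw [eq_comm, Real.sqrt_eq_iff_mul_self_eq (norm_nonneg _) (norm_nonneg _), ← pow_two,
      ← norm_pow, sqrt_sq]
  have h2 : Complex.sqrt (polyF e x) = 0 := by
    rw [← norm_eq_zero, h1, hx]; simp
  change Tendsto (fun x => Complex.sqrt (polyF e x)) (𝓝 x) (𝓝 (Complex.sqrt (polyF e x)))
  rw [h2, tendsto_zero_iff_norm_tendsto_zero]
  simp only [h1]
  have := ((continuous_polyF e).norm.sqrt).tendsto x
  simpa [hx] using this

/-- The derivatives of the trace may blow up at the branch points in the Euclidean metric of the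
plane. In the canonical metric they are bounded because `φ` is smooth on the compact curve. -/
theorem traceBounds_trace (hg : 0 < g) {φ : Curve e → ℂ}
    (hφ : ContMDiff 𝓘(ℝ, ℂ) 𝓘(ℝ, ℂ) ∞ φ) : ∃ C, TraceBounds e (trace e φ) C := by
  obtain ⟨C, hC⟩ := exists_bound_localBranch hg hφ
  obtain ⟨B, hB⟩ := isCompact_univ.exists_bound_of_continuousOn hφ.continuous.continuousOn
  have hB : ∀ Q, ‖φ Q‖ ≤ B := fun Q => hB Q (Set.mem_univ Q)
  have hC0 : 0 ≤ C := by
    by_contra! hneg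
    obtain ⟨x, hx⟩ := (ae_polyF_ne_zero e).exists
    have h1 := (hC ⟨(x, Complex.sqrt (polyF e x)), sqrt_sq _⟩ (snd_sheet_ne_zero hx)).2
    have h2 := density_pos e hg hx
    have h3 := (norm_nonneg _).trans h1
    have h4 : C * density e x < 0 := mul_neg_of_neg_of_pos hneg h2
    exact absurd h3 (not_le.2 h4)
  have hd : ∀ x, polyF e x ≠ 0 → ContDiffAt ℝ 2 (trace e φ) x ∧
      ‖fderiv ℝ (trace e φ) x‖ ≤ 2 * C * √(density e x) ∧
      ‖Laplacian.laplacian (trace e φ) x‖ ≤ 2 * C * density e x := by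
    intro x hx
    have hp := snd_sheet_ne_zero hx
    rw [trace_eq_localBranch φ ⟨(x, Complex.sqrt (polyF e x)), sqrt_sq _⟩ hp]
    set p : PlaneCurve (polyF e) := ⟨(x, Complex.sqrt (polyF e x)), sqrt_sq _⟩
    have c1 : ContDiffAt ℝ 2 _ x := contDiffAt_localBranch hφ p hp
    have c2 : ContDiffAt ℝ 2 _ x :=
      contDiffAt_localBranch hφ (conjPoint p) (conjPoint_snd_ne_zero hp)
    have b1 := hC p hp
    have b2 := hC (conjPoint p) (conjPoint_snd_ne_zero hp)
    refine ⟨c1.add c2, ?_, ?_⟩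
    · rw [fderiv_add (c1.differentiableAt (by norm_num)) (c2.differentiableAt (by norm_num))]
      exact (norm_add_le _ _).trans ((add_le_add b1.1 b2.1).trans_eq
        (show C * √(density e x) + C * √(density e x) = _ by ring))
    · rw [c1.laplacian_add c2]
      exact (norm_add_le _ _).trans ((add_le_add b1.2 b2.2).trans_eq
        (show C * density e x + C * density e x = _ by ring))
  have hB0 : 0 ≤ B := (norm_nonneg _).trans (hB (sheet e 0))
  refine ⟨2 * B + 2 * C, ?_, fun x => ?_, fun x hx => (hd x hx).1, fun x hx => ?_, fun x hx => ?_⟩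
  · refine continuous_iff_continuousAt.2 fun x => ?_
    by_cases hx : polyF e x = 0
    · have h1 := continuousAt_sheet_of_eq_zero hx
      exact (hφ.continuous.continuousAt.comp h1).add
        ((hφ.continuous.comp (continuous_involution e)).continuousAt.comp h1)
    · exact (hd x hx).1.continuousAt
  · refine (norm_add_le _ _).trans ?_
    linarith [hB (sheet e x), hB (involution e (sheet e x))]
  · exact (hd x hx).2.1.trans (by gcongr; linarith)
  · exact (hd x hx).2.2.trans (mul_le_mul_of_nonneg_right (by linarith) (density_nonneg e x))

/-- At infinity the trace tends to the sum over the two points at infinity. -/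
theorem tendsto_trace_cocompact {φ : Curve e → ℂ} (hφ : Continuous φ) {P : Curve e}
    (hP : P ∉ Set.range (ofAffine e)) :
    Tendsto (trace e φ) (cocompact ℂ) (𝓝 (φ P + φ (involution e P))) := by
  obtain ⟨q, hq, rfl⟩ := (exists_eq e P).resolve_left fun ⟨p, hp⟩ => hP ⟨p, hp⟩
  have hq' := snd_ne_zero_of_fst_eq_zero e hq
  set ψ := infiniteChart e q hq'
  have hs := mem_infiniteChart_source e q hq'
  have h0 : ψ (ofInfinite e q) = 0 := by rw [infiniteChart_ofInfinite, hq]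
  have hc : Tendsto ψ.symm (𝓝 0) (𝓝 (ofInfinite e q)) := by
    have := ψ.continuousAt_symm (ψ.map_source hs)
    rw [h0] at this
    have h2 : ψ.symm 0 = ofInfinite e q := by rw [← h0, ψ.left_inv hs]
    rw [ContinuousAt, h2] at this
    exact this
  have hlim := ((hφ.add (hφ.comp (continuous_involution e))).tendsto (ofInfinite e q)).comp
    (hc.comp tendsto_inv₀_cobounded)
  rw [← Metric.cobounded_eq_cocompact]
  refine hlim.congr' ?_
  filter_upwards [Bornology.eventually_ne_cobounded (0 : ℂ)] with x hx
  have hmem : ψ.symm x⁻¹ ∈ Set.range (ofAffine e) :=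
    (ofInfinite_mem_affine e).2 (inv_ne_zero hx)
  have := trace_xCoord φ hmem
  rw [xCoord_infiniteChart_symm, inv_inv] at this
  rw [this]
  rfl

end Bounds

/-! ### Integration over the curve -/

section Area

variable {g : ℕ} (e : Fin (2 * g + 2) ↪ ℂ)

theorem measurable_sheet : Measurable (sheet e) := by
  have h : Measurable Complex.sqrt := by
    unfold Complex.sqrt
    fun_prop
  exact (continuous_ofAffine e).measurable.comp
    (Measurable.subtype_mk (measurable_id.prodMk (h.comp (continuous_polyF e).measurable)))

/-- The area measure of one sheet, as a measure on the `x`-plane. -/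
noncomputable def sheetMeasure : Measure ℂ :=
  volume.withDensity fun x => ENNReal.ofReal (density e x)

theorem area_eq : area e = (sheetMeasure e).map (sheet e) +
    (sheetMeasure e).map fun x => involution e (sheet e x) := rfl

theorem measurable_involution_sheet : Measurable fun x => involution e (sheet e x) :=
  (continuous_involution e).measurable.comp (measurable_sheet e)

theorem ae_area_ne (a : ℂ) :
    ∀ᵐ Q ∂area e, ∃ p : PlaneCurve (polyF e), p.1.2 ≠ 0 ∧ p.1.1 ≠ a ∧ ofAffine e p = Q := by
  have hU : MeasurableSet {Q | ∃ p : PlaneCurve (polyF e), p.1.2 ≠ 0 ∧ p.1.1 ≠ a ∧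
      ofAffine e p = Q} := by
    have : IsOpen {p : PlaneCurve (polyF e) | p.1.2 ≠ 0 ∧ p.1.1 ≠ a} :=
      (isOpen_ne_fun (continuous_snd.comp continuous_subtype_val) continuous_const).inter
        (isOpen_ne_fun (continuous_fst.comp continuous_subtype_val) continuous_const)
    have h := ((isOpenEmbedding_ofAffine e).isOpenMap _ this).measurableSet
    convert h using 1
    ext Q
    simp only [Set.mem_image, Set.mem_ofPred_eq, and_assoc]
  have hae : ∀ᵐ x ∂sheetMeasure e, polyF e x ≠ 0 ∧ x ≠ a :=
    (withDensity_absolutelyContinuous _ _).ae_le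
      ((ae_polyF_ne_zero e).and (Measure.ae_ne volume a))
  rw [area_eq, ae_add_measure_iff, ae_map_iff (measurable_sheet e).aemeasurable hU,
    ae_map_iff (measurable_involution_sheet e).aemeasurable hU]
  constructor
  · filter_upwards [hae] with x hx
    exact ⟨_, snd_sheet_ne_zero hx.1, hx.2, rfl⟩
  · filter_upwards [hae] with x hx
    exact ⟨_, neg_ne_zero.2 (snd_sheet_ne_zero hx.1), hx.2, rfl⟩

/-- A statement that holds at the points over all but finitely many `x` holds almost everywhere. -/
theorem ae_area_of_forall {q : Curve e → Prop} (A : Finset ℂ)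
    (h : ∀ p : PlaneCurve (polyF e), p.1.2 ≠ 0 → p.1.1 ∉ A → q (ofAffine e p)) :
    ∀ᵐ Q ∂area e, q Q := by
  have h1 : ∀ᵐ Q ∂area e, ∀ a ∈ A, ∃ p : PlaneCurve (polyF e), p.1.2 ≠ 0 ∧ p.1.1 ≠ a ∧
      ofAffine e p = Q := (ae_ball_iff A.countable_toSet).2 fun a _ => ae_area_ne e a
  filter_upwards [h1, ae_area_ne e 0] with Q hQ ⟨p, hp, _, hpQ⟩
  subst hpQ
  refine h p hp fun hpA => ?_
  obtain ⟨p', -, h2, h3⟩ := hQ _ hpA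
  exact h2 (congrArg (fun p => p.1.1) (ofAffine_injective e h3))

open Classical in
theorem measurable_piecewise_ordinary {k : Curve e → ℂ} (hk : ContinuousOn k (ordinary e)) :
    Measurable ((ordinary e).piecewise k 0) :=
  hk.measurable_piecewise continuousOn_const (isOpen_ordinary e).measurableSet

theorem continuousOn_xCoord : ContinuousOn (xCoord e) (ordinary e) := by
  rintro _ ⟨p, -, rfl⟩
  exact (continuousAt_xCoord e p).continuousWithinAt

theorem sheet_mem_ordinary {x : ℂ} (hx : polyF e x ≠ 0) : sheet e x ∈ ordinary e :=
  ⟨_, snd_sheet_ne_zero hx, rfl⟩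

theorem involution_sheet_mem_ordinary {x : ℂ} (hx : polyF e x ≠ 0) :
    involution e (sheet e x) ∈ ordinary e :=
  ⟨_, neg_ne_zero.2 (snd_sheet_ne_zero hx), rfl⟩

open Classical in
/-- Integration over `X` of the product of a function of `x` and a bounded continuous function is
integration over the plane of the sum over the two sheets. -/
theorem integrable_area_and_integral_eq {h k : Curve e → ℂ} {u : ℂ → ℝ} {B : ℝ} {A : Finset ℂ}
    (hu : Measurable u) (hui : Integrable fun x => density e x * |u x|)
    (hk : ContinuousOn k (ordinary e)) (hB : ∀ Q ∈ ordinary e, ‖k Q‖ ≤ B)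
    (hh : ∀ p : PlaneCurve (polyF e), p.1.2 ≠ 0 → p.1.1 ∉ A →
      h (ofAffine e p) = u p.1.1 • k (ofAffine e p)) :
    Integrable h (area e) ∧ ∫ Q, h Q ∂area e =
      ∫ x, (density e x * u x) • (k (sheet e x) + k (involution e (sheet e x))) := by
  -- `xCoord` and `k` are only controlled at ordinary points; set them to zero elsewhere.
  have hX := measurable_piecewise_ordinary e (continuousOn_xCoord e)
  have hk' := measurable_piecewise_ordinary e hk
  set X' := (ordinary e).piecewise (xCoord e) 0
  set k' := (ordinary e).piecewise k 0
  have hm : Measurable fun Q => u (X' Q) • k' Q := (hu.comp hX).smul hk'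
  have hae : h =ᵐ[area e] fun Q => u (X' Q) • k' Q := by
    refine ae_area_of_forall e A fun p hp hpA => ?_
    have hmem : ofAffine e p ∈ ordinary e := ⟨p, hp, rfl⟩
    rw [hh p hp hpA]
    simp only [X', k', Set.piecewise_eq_of_mem _ _ _ hmem]
    rfl
  have key : ∀ s : ℂ → Curve e, Measurable s → (∀ x, polyF e x ≠ 0 → s x ∈ ordinary e) →
      (∀ x, xCoord e (s x) = x) →
      Integrable (fun x => (density e x * u x) • k (s x)) ∧
      Integrable (fun Q => u (X' Q) • k' Q) ((sheetMeasure e).map s) ∧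
      ∫ Q, u (X' Q) • k' Q ∂((sheetMeasure e).map s) =
        ∫ x, (density e x * u x) • k (s x) := by
    intro s hs hso hsx
    have hd : Measurable fun x => ENNReal.ofReal (density e x) :=
      (measurable_density e).ennreal_ofReal
    have hfin : ∀ᵐ x, ENNReal.ofReal (density e x) < ⊤ :=
      Eventually.of_forall fun x => ENNReal.ofReal_lt_top
    have e1 : (fun x => (density e x * u x) • k' (s x)) =ᵐ[volume]
        fun x => (density e x * u x) • k (s x) := by
      filter_upwards [ae_polyF_ne_zero e] with x hx
      simp only [k', Set.piecewise_eq_of_mem _ _ _ (hso x hx)]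
    have e2 : (fun x => (ENNReal.ofReal (density e x)).toReal • u (X' (s x)) • k' (s x))
        =ᵐ[volume] fun x => (density e x * u x) • k' (s x) := by
      filter_upwards [ae_polyF_ne_zero e] with x hx
      simp only [X', Set.piecewise_eq_of_mem _ _ _ (hso x hx), hsx,
        ENNReal.toReal_ofReal (density_nonneg e x), smul_smul]
    have i1 : Integrable fun x => (density e x * u x) • k' (s x) := by
      refine (hui.mul_const B).mono'
        (((measurable_density e).mul hu).smul (hk'.comp hs)).aestronglyMeasurable ?_
      filter_upwards [ae_polyF_ne_zero e] with x hx
      simp only [k', Set.piecewise_eq_of_mem _ _ _ (hso x hx)]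
      rw [norm_smul, norm_mul, Real.norm_of_nonneg (density_nonneg e x), Real.norm_eq_abs]
      exact mul_le_mul_of_nonneg_left (hB _ (hso x hx))
        (mul_nonneg (density_nonneg e x) (abs_nonneg _))
    refine ⟨i1.congr e1, ?_, ?_⟩
    · rw [integrable_map_measure hm.aestronglyMeasurable hs.aemeasurable, sheetMeasure,
        integrable_withDensity_iff_integrable_smul' hd hfin]
      exact i1.congr e2.symm
    · rw [integral_map hs.aemeasurable hm.aestronglyMeasurable, sheetMeasure,
        integral_withDensity_eq_integral_toReal_smul hd hfin, integral_congr_ae e2,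
        integral_congr_ae e1]
  obtain ⟨a1, a2, a3⟩ := key (sheet e) (measurable_sheet e) (fun x => sheet_mem_ordinary e)
    fun x => rfl
  obtain ⟨b1, b2, b3⟩ := key (fun x => involution e (sheet e x)) (measurable_involution_sheet e)
    (fun x => involution_sheet_mem_ordinary e) fun x => rfl
  constructor
  · rw [integrable_congr hae, area_eq]
    exact a2.add_measure b2
  · rw [integral_congr_ae hae, area_eq, integral_add_measure a2 b2, a3, b3, ← integral_add a1 b1]
    simp only [smul_add]

variable {e}

/-- The area density cancels the conformal factor, so `Δφ dν` becomes the Euclidean Laplacian of the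
trace. -/
theorem density_mul_laplaceBeltrami (hg : 0 < g) {φ : Curve e → ℂ}
    (hφ : ContMDiff 𝓘(ℝ, ℂ) 𝓘(ℝ, ℂ) ∞ φ) {x : ℂ} (hx : polyF e x ≠ 0) :
    (density e x : ℂ) * (laplaceBeltrami e φ (sheet e x) +
      laplaceBeltrami e φ (involution e (sheet e x))) = Laplacian.laplacian (trace e φ) x := by
  have hp := snd_sheet_ne_zero hx
  set p : PlaneCurve (polyF e) := ⟨(x, Complex.sqrt (polyF e x)), sqrt_sq _⟩
  have c1 : ContDiffAt ℝ 2 _ x := contDiffAt_localBranch hφ p hp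
  have c2 : ContDiffAt ℝ 2 _ x :=
    contDiffAt_localBranch hφ (conjPoint p) (conjPoint_snd_ne_zero hp)
  have h1 : laplaceBeltrami e φ (sheet e x) = _ := laplaceBeltrami_ofAffine φ p hp
  have h2 : laplaceBeltrami e φ (involution e (sheet e x)) = _ :=
    laplaceBeltrami_ofAffine φ (conjPoint p) (conjPoint_snd_ne_zero hp)
  have hd : (density e x : ℂ) ≠ 0 := by exact_mod_cast (density_pos e hg hx).ne'
  rw [trace_eq_localBranch φ p hp, c1.laplacian_add c2, h1, h2]
  have h3 : (density e x : ℂ) * (((density e p.1.1)⁻¹ : ℝ) : ℂ) = 1 := by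
    push_cast
    exact mul_inv_cancel₀ hd
  have h4 : (density e x : ℂ) * (((density e (conjPoint p).1.1)⁻¹ : ℝ) : ℂ) = 1 := h3
  rw [mul_add, ← mul_assoc, ← mul_assoc, h3, h4]
  simp [p, conjPoint]

theorem continuousOn_laplaceBeltrami (hg : 0 < g) {φ : Curve e → ℂ}
    (hφ : ContMDiff 𝓘(ℝ, ℂ) 𝓘(ℝ, ℂ) ∞ φ) : ContinuousOn (laplaceBeltrami e φ) (ordinary e) := by
  rintro _ ⟨p, hp, rfl⟩
  refine ContinuousAt.continuousWithinAt ?_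
  have hs := mem_affineChart_source e p hp
  have hev : laplaceBeltrami e φ =ᶠ[𝓝 (ofAffine e p)] fun Q =>
      ((density e (xCoord e Q))⁻¹ : ℝ) *
        Laplacian.laplacian (localBranch e φ p hp) (xCoord e Q) := by
    filter_upwards [(affineChart e p hp).open_source.mem_nhds hs,
      (isOpen_ordinary e).mem_nhds ⟨p, hp, rfl⟩] with Q hQ ⟨p', hp', hpQ⟩
    subst hpQ
    have h1 := comp_symm_eventuallyEq_localBranch φ (affineChart e p hp) p' hp' hQ
    have h2 := (affineChart_apply e p hp hQ).2
    rw [h2] at h1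
    have h3 : localBranch e φ p hp =ᶠ[𝓝 p'.1.1] localBranch e φ p' hp' := h1
    rw [laplaceBeltrami_ofAffine φ p' hp',
      ← (InnerProductSpace.laplacian_congr_nhds h3).eq_of_nhds]
    rfl
  refine ContinuousAt.congr ?_ hev.symm
  have hx := continuousAt_xCoord e p
  have h0 := polyF_ne_zero_of_snd_ne_zero e hp
  have hc : ContinuousAt (density e) p.1.1 := (continuous_sigma_norm_sq g).continuousAt.div
    (continuous_polyF e).norm.continuousAt (norm_ne_zero_iff.2 h0)
  have hc' : ContinuousAt (fun x => (((density e x)⁻¹ : ℝ) : ℂ) *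
      Laplacian.laplacian (localBranch e φ p hp) x) p.1.1 :=
    (Complex.continuous_ofReal.continuousAt.comp (hc.inv₀ (density_pos e hg h0).ne')).mul
      (continuousAt_laplacian (contDiffAt_localBranch hφ p hp))
  exact ContinuousAt.comp (f := xCoord e) (x := ofAffine e p) hc' hx

theorem exists_bound_laplaceBeltrami (hg : 0 < g) {φ : Curve e → ℂ}
    (hφ : ContMDiff 𝓘(ℝ, ℂ) 𝓘(ℝ, ℂ) ∞ φ) :
    ∃ C, ∀ Q ∈ ordinary e, ‖laplaceBeltrami e φ Q‖ ≤ C := by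
  obtain ⟨C, hC⟩ := exists_bound_localBranch hg hφ
  refine ⟨C, ?_⟩
  rintro _ ⟨p, hp, rfl⟩
  have hd := density_pos e hg (polyF_ne_zero_of_snd_ne_zero e hp)
  rw [laplaceBeltrami_ofAffine φ p hp, norm_mul, Complex.norm_real, norm_inv,
    Real.norm_of_nonneg hd.le, inv_mul_le_iff₀ hd, mul_comm]
  exact (hC p hp).2

/-! ### The limit over the complements of shrinking discs -/

theorem measurableSet_coordDisc (P : Curve e) (ε : ℝ) : MeasurableSet (coordDisc e P ε) := by
  have h1 := (chart e P).continuousOn.isOpen_inter_preimage (chart e P).open_source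
    (Metric.isClosed_closedBall (x := chart e P P) (ε := ε)).isOpen_compl
  have h2 : coordDisc e P ε = (chart e P).source \
      ((chart e P).source ∩ chart e P ⁻¹' (Metric.closedBall (chart e P P) ε)ᶜ) := by
    ext Q
    simp only [coordDisc, Set.mem_ofPred_eq, Set.mem_sdiff, Set.mem_inter_iff, Set.mem_preimage,
      Set.mem_compl_iff, mem_closedBall_iff_norm]
    tauto
  rw [h2]
  exact (chart e P).open_source.measurableSet.diff h1.measurableSet

theorem eventually_notMem_coordDisc {P Q : Curve e} (h : Q ≠ P) :
    ∀ᶠ ε in 𝓝[>] (0 : ℝ), Q ∉ coordDisc e P ε := by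
  by_cases hQ : Q ∈ (chart e P).source
  · have hne : chart e P Q ≠ chart e P P := fun h' =>
      h ((chart e P).injOn hQ (mem_chart_source e P) h')
    have hpos : 0 < ‖chart e P Q - chart e P P‖ := norm_pos_iff.2 (sub_ne_zero.2 hne)
    filter_upwards [Ioo_mem_nhdsGT hpos] with ε hε hmem
    exact absurd hmem.2 (not_le.2 hε.2)
  · exact Eventually.of_forall fun ε hmem => hQ hmem.1

/-- For an integrable function the discs can be filled in, as finite sets have area zero. -/
theorem tendsto_setIntegral_compl_coordDisc (S : Finset (Curve e)) {h : Curve e → ℂ}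
    (hh : Integrable h (area e)) :
    Tendsto (fun ε : ℝ => ∫ Q in (⋃ P ∈ S, coordDisc e P ε)ᶜ, h Q ∂area e) (𝓝[>] 0)
      (𝓝 (∫ Q, h Q ∂area e)) := by
  have hms : ∀ ε : ℝ, MeasurableSet (⋃ P ∈ S, coordDisc e P ε)ᶜ := fun ε =>
    (Finset.measurableSet_biUnion S fun P _ => measurableSet_coordDisc P ε).compl
  classical
  have hS : ∀ᵐ Q ∂area e, Q ∉ S := by
    refine ae_area_of_forall e (S.image (xCoord e)) fun p _ hpA hpS => ?_
    exact hpA (Finset.mem_image.2 ⟨_, hpS, rfl⟩)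
  simp only [← integral_indicator (hms _)]
  refine tendsto_integral_filter_of_dominated_convergence (fun Q => ‖h Q‖)
    (Eventually.of_forall fun ε => hh.1.indicator (hms ε))
    (Eventually.of_forall fun ε => Eventually.of_forall fun Q => norm_indicator_le_norm_self _ _)
    hh.norm ?_
  filter_upwards [hS] with Q hQ
  refine tendsto_const_nhds.congr' ?_
  have : ∀ᶠ ε in 𝓝[>] (0 : ℝ), ∀ P ∈ S, Q ∉ coordDisc e P ε :=
    (S.eventually_all).2 fun P hP => eventually_notMem_coordDisc fun h => hQ (h ▸ hP)
  filter_upwards [this] with ε hε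
  rw [Set.indicator_of_mem]
  simpa using hε

end Area

/-! ### The potential of a divisor -/

section Potential

variable {g : ℕ} (e : Fin (2 * g + 2) ↪ ℂ)

theorem sigma_mul_sq_pos (hg : 0 < g) (t : ℂ) :
    0 < sigma g (‖t‖ ^ 2) * (1 + ‖t‖ ^ 2) ^ 2 :=
  mul_pos (sigma_pos hg (by positivity)) (by positivity)

theorem denom_pos (hg : 0 < g) (t : ℂ) : 0 < denom g t :=
  Real.rpow_pos_of_pos (sigma_mul_sq_pos hg t) _

/-- The exponent `1 / (2 g + 2)` in `denom` makes the coefficient of `log (1 + |t|²)` equal to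
`1 / 2`. -/
theorem log_denom (hg : 0 < g) (t : ℂ) :
    Real.log (denom g t) = logSigma g t / (2 * g + 2) + Real.log (1 + ‖t‖ ^ 2) / 2 := by
  have h1 : (0 : ℝ) < 1 + ‖t‖ ^ 2 := by positivity
  rw [denom, Real.log_rpow (sigma_mul_sq_pos hg t),
    Real.log_mul (sigma_pos hg (by positivity)).ne' (by positivity), Real.log_pow, logSigma,
    Nat.cast_sub hg]
  push_cast
  field_simp
  ring

open Classical in
/-- The function `log F_P`, as a function of `x`. It is the same for both points at infinity. -/
noncomputable def pointPotential (P : Curve e) (x : ℂ) : ℝ :=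
  (if P ∈ Set.range (ofAffine e) then 2 * Real.log ‖x - xCoord e P‖ - Real.log (1 + ‖x‖ ^ 2)
    else -Real.log (1 + ‖x‖ ^ 2)) / 2 - logSigma g x / (2 * g + 2)

theorem funF_ofAffine_pos (hg : 0 < g) {P : Curve e} {p : PlaneCurve (polyF e)}
    (h : P ∈ Set.range (ofAffine e) → p.1.1 ≠ xCoord e P) : 0 < funF e P (ofAffine e p) := by
  have hd := denom_pos hg p.1.1
  have hm : ofAffine e p ∈ Set.range (ofAffine e) := ⟨p, rfl⟩
  unfold funF
  rw [if_pos hm, if_pos hm]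
  split_ifs with hP
  · exact div_pos (norm_pos_iff.2 (sub_ne_zero.2 (h hP))) hd
  · exact div_pos one_pos hd

theorem log_funF_ofAffine (hg : 0 < g) {P : Curve e} {p : PlaneCurve (polyF e)}
    (h : P ∈ Set.range (ofAffine e) → p.1.1 ≠ xCoord e P) :
    Real.log (funF e P (ofAffine e p)) = pointPotential e P p.1.1 := by
  have hd := (denom_pos hg p.1.1).ne'
  have hm : ofAffine e p ∈ Set.range (ofAffine e) := ⟨p, rfl⟩
  have hx : xCoord e (ofAffine e p) = p.1.1 := rfl
  unfold funF pointPotential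
  rw [if_pos hm, if_pos hm, hx]
  split_ifs with hP
  · rw [Real.log_div (norm_ne_zero_iff.2 (sub_ne_zero.2 (h hP))) hd, log_denom hg]
    ring
  · rw [Real.log_div one_ne_zero hd, log_denom hg, Real.log_one]
    ring

theorem measurable_logSigma (hg : 0 < g) : Measurable (logSigma g) :=
  (smoothOnSphere_logSigma hg).1.continuous.measurable

theorem measurable_pointPotential (hg : 0 < g) (P : Curve e) :
    Measurable (pointPotential e P) := by
  have h1 := measurable_logSigma hg
  have h2 := measurable_log_one_add_norm_sq
  unfold pointPotential
  split_ifs <;> fun_prop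

theorem singularBound_logSigma (hg : 0 < g) : SingularBound (logSigma g) (1 / 2) (-1) := by
  obtain ⟨C, hC⟩ := (smoothOnSphere_logSigma hg).exists_bound
  refine SingularBound.mono (s := 0) (t := 0) (singularBound_of_continuous (C := C)
    (smoothOnSphere_logSigma hg).1.continuous fun x => ?_) (by norm_num) (by norm_num)
  simpa using (hC x).1

theorem singularBound_pointPotential (hg : 0 < g) (P : Curve e) :
    SingularBound (pointPotential e P) (1 / 2) (-1) := by
  have h1 := (singularBound_logSigma hg).const_mul (-(1 / (2 * g + 2)))
  have h2 : SingularBound (fun x => Real.log (1 + ‖x‖ ^ 2)) (1 / 2) (-1) :=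
    singularBound_log_one_add_norm_sq.mono (by norm_num) le_rfl
  by_cases hP : P ∈ Set.range (ofAffine e)
  · convert ((singularBound_log_norm_sub (xCoord e P)).add (h2.const_mul (-(1 / 2)))).add h1
      using 2 with x
    simp only [pointPotential, if_pos hP]
    ring
  · convert (h2.const_mul (-(1 / 2))).add h1 using 2 with x
    simp only [pointPotential, if_neg hP]
    ring

variable {e}

/-- The first integral on the right is, up to the factor `-1/2`, that of the Gaussian curvature
against a function with trace `Φ`. -/
theorem TraceBounds.integral_logSigma_smul_laplacian (hg : 0 < g) {Φ : ℂ → ℂ} {C : ℝ}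
    (H : TraceBounds e Φ C) :
    ∫ x, logSigma g x • Laplacian.laplacian Φ x =
      (∫ x, Laplacian.laplacian (fun x : ℂ => Real.log (sigma g (‖x‖ ^ 2))) x • Φ x) -
        4 * (g - 1) * ∫ x, ((1 + ‖x‖ ^ 2) ^ 2)⁻¹ • Φ x := by
  have hs := smoothOnSphere_logSigma hg
  have i1 := H.integrable_smul hs.integrable_laplacian
  have i2 := H.integrable_one_add_norm_sq_inv_sq_smul
  rw [H.integral_smul_laplacian hs]
  have e1 : (fun x => Laplacian.laplacian (fun x : ℂ => Real.log (sigma g (‖x‖ ^ 2))) x • Φ x) =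
      fun x => Laplacian.laplacian (logSigma g) x • Φ x +
        (4 * (g - 1) : ℂ) * (((1 + ‖x‖ ^ 2) ^ 2)⁻¹ • Φ x) := by
    ext x
    rw [laplacian_logSigma hg, sub_smul, Nat.cast_sub hg]
    simp only [Complex.real_smul]
    push_cast
    ring
  rw [e1, integral_add i1 (i2.const_mul _), integral_const_mul, add_sub_cancel_right]

/-- The distributional Laplacian of `log F_P`: besides point masses `2π` at `P` and at `ι(P)`, there
are a multiple of the area form of the sphere and a multiple of the Laplacian of `logSigma`. -/
theorem integral_pointPotential_smul_laplacian (hg : 0 < g) {φ : Curve e → ℂ}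
    (hφ : ContMDiff 𝓘(ℝ, ℂ) 𝓘(ℝ, ℂ) ∞ φ) (P : Curve e) :
    ∫ x, pointPotential e P x • Laplacian.laplacian (trace e φ) x =
      2 * Real.pi * (φ P + φ (involution e P)) -
        (2 * ∫ x, ((1 + ‖x‖ ^ 2) ^ 2)⁻¹ • trace e φ x) -
        (∫ x, logSigma g x • Laplacian.laplacian (trace e φ) x) / (2 * g + 2) := by
  obtain ⟨C, H⟩ := traceBounds_trace hg hφ
  have hs := smoothOnSphere_logSigma hg
  have i1 := H.integrable_smul_laplacian hs.1.continuous.aestronglyMeasurable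
    hs.integrable_density_mul
  have h2 : SingularBound (fun x => Real.log (1 + ‖x‖ ^ 2)) (1 / 2) (-1) :=
    singularBound_log_one_add_norm_sq.mono (by norm_num) le_rfl
  -- The common end of the two cases, with `w` the logarithmic part of the potential.
  have key : ∀ w : ℂ → ℝ, Measurable w → SingularBound w (1 / 2) (-1) →
      (∀ x, pointPotential e P x = w x / 2 - logSigma g x / (2 * g + 2)) →
      ∫ x, w x • Laplacian.laplacian (trace e φ) x =
        4 * Real.pi * (φ P + φ (involution e P)) -
          4 * ∫ x, ((1 + ‖x‖ ^ 2) ^ 2)⁻¹ • trace e φ x →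
      ∫ x, pointPotential e P x • Laplacian.laplacian (trace e φ) x =
        2 * Real.pi * (φ P + φ (involution e P)) -
          (2 * ∫ x, ((1 + ‖x‖ ^ 2) ^ 2)⁻¹ • trace e φ x) -
          (∫ x, logSigma g x • Laplacian.laplacian (trace e φ) x) / (2 * g + 2) := by
    intro w hm hw hP hI
    have i2 := H.integrable_smul_laplacian hm.aestronglyMeasurable
      (integrable_density_mul_of_singularBound hw hm)
    have e1 : (fun x => pointPotential e P x • Laplacian.laplacian (trace e φ) x) = fun x =>
        (w x • Laplacian.laplacian (trace e φ) x) / 2 -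
          (logSigma g x • Laplacian.laplacian (trace e φ) x) / (2 * g + 2) := by
      ext x
      rw [hP]
      simp only [Complex.real_smul]
      push_cast
      ring
    rw [e1, integral_sub (i2.div_const _) (i1.div_const _), integral_div, integral_div, hI]
    ring
  by_cases hP : P ∈ Set.range (ofAffine e)
  · refine key (fun x => 2 * Real.log ‖x - xCoord e P‖ - Real.log (1 + ‖x‖ ^ 2)) ?_ ?_ ?_ ?_
    · have := measurable_log_one_add_norm_sq
      fun_prop
    · convert ((singularBound_log_norm_sub (xCoord e P)).const_mul 2).add (h2.const_mul (-1))
        using 2 with x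
      ring
    · intro x
      simp only [pointPotential, if_pos hP]
    · rw [H.integral_log_norm_sub_smul_laplacian, trace_xCoord φ hP]
  · refine key (fun x => -Real.log (1 + ‖x‖ ^ 2)) ?_ ?_ ?_ ?_
    · exact measurable_log_one_add_norm_sq.neg
    · simpa using h2.const_mul (-1)
    · intro x
      simp only [pointPotential, if_neg hP]
    · exact H.integral_log_smul_laplacian (tendsto_trace_cocompact hφ.continuous hP)

variable (e)

/-- The function `log F_E`, as a function of `x`. -/
noncomputable def divisorPotential (E : Divisor e) (x : ℂ) : ℝ :=
  ∑ P ∈ E.support, (E P : ℝ) * pointPotential e P x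

theorem divisorPotential_add (E E' : Divisor e) (x : ℂ) :
    divisorPotential e (E + E') x = divisorPotential e E x + divisorPotential e E' x := by
  change (E + E').sum (fun P n => (n : ℝ) * pointPotential e P x) = _
  rw [Finsupp.sum_add_index' (fun P => by simp) fun P m n => by push_cast; ring]
  rfl

theorem funFD_ofAffine (hg : 0 < g) {E : Divisor e} {p : PlaneCurve (polyF e)}
    (h : ∀ P ∈ E.support, P ∈ Set.range (ofAffine e) → p.1.1 ≠ xCoord e P) :
    funFD e E (ofAffine e p) = Real.exp (divisorPotential e E p.1.1) := by
  rw [divisorPotential, Real.exp_sum]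
  refine Finset.prod_congr rfl fun P hP => ?_
  rw [← log_funF_ofAffine e hg (h P hP), mul_comm, Real.exp_mul,
    Real.exp_log (funF_ofAffine_pos e hg (h P hP)), Real.rpow_intCast]

theorem logF_ofAffine (hg : 0 < g) {E : Divisor e} {p : PlaneCurve (polyF e)}
    (h : ∀ P ∈ E.support, P ∈ Set.range (ofAffine e) → p.1.1 ≠ xCoord e P) :
    logF e E (ofAffine e p) = divisorPotential e E p.1.1 := by
  rw [logF, funFD_ofAffine e hg h, Real.log_exp]

theorem measurable_divisorPotential (hg : 0 < g) (E : Divisor e) :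
    Measurable (divisorPotential e E) :=
  Finset.measurable_fun_sum _ fun P _ => (measurable_pointPotential e hg P).const_mul _

theorem singularBound_divisorPotential (hg : 0 < g) (E : Divisor e) :
    SingularBound (divisorPotential e E) (1 / 2) (-1) :=
  SingularBound.sum fun P _ => (singularBound_pointPotential e hg P).const_mul _

variable {e}

theorem diracDelta_alpha (E : Divisor e) (φ : Curve e → ℂ) :
    diracDelta e (alpha e E) φ = ∑ P ∈ E.support, (E P : ℂ) * (φ P + φ (involution e P)) := by
  unfold diracDelta alpha
  rw [Finsupp.sum_add_index' (fun P => by simp) fun P m n => by push_cast; ring,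
    Finsupp.sum_mapDomain_index (fun P => by simp) fun P m n => by push_cast; ring]
  simp only [Finsupp.sum, mul_add, Finset.sum_add_distrib]

/-- All points contribute the same multiples of the sphere's area form and of the curvature, so only
the degree of `E` enters. -/
theorem integral_divisorPotential_smul_laplacian (hg : 0 < g) {φ : Curve e → ℂ}
    (hφ : ContMDiff 𝓘(ℝ, ℂ) 𝓘(ℝ, ℂ) ∞ φ) (E : Divisor e) :
    ∫ x, divisorPotential e E x • Laplacian.laplacian (trace e φ) x =
      2 * Real.pi * diracDelta e (alpha e E) φ -
        degree e E * ((4 * ∫ x, ((1 + ‖x‖ ^ 2) ^ 2)⁻¹ • trace e φ x) +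
        (∫ x, Laplacian.laplacian (fun x : ℂ => Real.log (sigma g (‖x‖ ^ 2))) x • trace e φ x) /
          2) / (g + 1) := by
  obtain ⟨C, H⟩ := traceBounds_trace hg hφ
  have hi : ∀ P, Integrable fun x =>
      (E P : ℂ) * (pointPotential e P x • Laplacian.laplacian (trace e φ) x) := fun P =>
    (H.integrable_smul_laplacian (measurable_pointPotential e hg P).aestronglyMeasurable
      (integrable_density_mul_of_singularBound (singularBound_pointPotential e hg P)
        (measurable_pointPotential e hg P))).const_mul _
  have e1 : (fun x => divisorPotential e E x • Laplacian.laplacian (trace e φ) x) = fun x =>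
      ∑ P ∈ E.support, (E P : ℂ) * (pointPotential e P x • Laplacian.laplacian (trace e φ) x) := by
    ext x
    simp only [divisorPotential, Finset.sum_smul, mul_smul, Complex.real_smul,
      Complex.ofReal_intCast]
  rw [e1, integral_finsetSum _ fun P _ => hi P]
  simp only [integral_const_mul, integral_pointPotential_smul_laplacian hg hφ,
    H.integral_logSigma_smul_laplacian hg, diracDelta_alpha, degree, Finsupp.sum]
  have hg' : (g : ℂ) + 1 ≠ 0 := by exact_mod_cast g.succ_ne_zero
  push_cast
  rw [Finset.mul_sum, mul_div_assoc, Finset.sum_mul, ← Finset.sum_sub_distrib]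
  refine Finset.sum_congr rfl fun P _ => ?_
  have : (2 * (g : ℂ) + 2) = 2 * (g + 1) := by ring
  rw [this]
  field_simp
  ring

end Potential

/-! ### The smooth locus of `log F_E` -/

section Smooth

variable {g : ℕ} {e : Fin (2 * g + 2) ↪ ℂ}

theorem denom_inv (hg : 0 < g) {z : ℂ} (hz : z ≠ 0) : denom g z⁻¹ = denom g z / ‖z‖ := by
  have hn : 0 < ‖z‖ := norm_pos_iff.2 hz
  have h1 : sigma g (‖z⁻¹‖ ^ 2) * (1 + ‖z⁻¹‖ ^ 2) ^ 2 =
      sigma g (‖z‖ ^ 2) * (1 + ‖z‖ ^ 2) ^ 2 / ‖z‖ ^ (2 * (g : ℝ) + 2) := by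
    have h2 : ‖z‖ ^ (2 * (g : ℝ) + 2) = (‖z‖ ^ 2) ^ (g - 1) * ‖z‖ ^ 4 := by
      obtain ⟨m, rfl⟩ : ∃ m, g = m + 1 := ⟨g - 1, by omega⟩
      rw [← pow_mul, ← pow_add, ← Real.rpow_natCast]
      congr 1
      simp only [Nat.add_sub_cancel]
      push_cast
      ring
    rw [norm_inv, inv_pow, sigma_inv (by positivity), h2]
    field_simp
    ring
  rw [denom, h1, Real.div_rpow (sigma_mul_sq_pos hg z).le (by positivity), ← Real.rpow_mul hn.le,
    mul_one_div_cancel (by positivity), Real.rpow_one, denom]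

/-- A function that is holomorphic in the charts is smooth over the reals. -/
theorem contMDiffAt_of_differentiableAt_symm {f : Curve e → ℂ} {U : Set (Curve e)} (hU : IsOpen U)
    (hf : ∀ ψ ∈ curveAtlas e, ∀ t ∈ ψ.target, ψ.symm t ∈ U →
      DifferentiableAt ℂ (fun s => f (ψ.symm s)) t) {Q : Curve e} (hQ : Q ∈ U) :
    ContMDiffAt 𝓘(ℝ, ℂ) 𝓘(ℝ, ℂ) ∞ f Q := by
  have := isManifold_real e
  have hs := mem_chart_source e Q
  have ht : chart e Q Q ∈ (chart e Q).target := (chart e Q).map_source hs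
  have hev : ∀ᶠ t in 𝓝 (chart e Q Q), DifferentiableAt ℂ (fun s => f ((chart e Q).symm s)) t := by
    have hc : ContinuousAt (chart e Q).symm (chart e Q Q) := (chart e Q).continuousAt_symm ht
    have hU' : U ∈ 𝓝 ((chart e Q).symm (chart e Q Q)) := by
      rw [(chart e Q).left_inv hs]
      exact hU.mem_nhds hQ
    filter_upwards [(chart e Q).open_target.mem_nhds ht, hc hU'] with t ht htU
    exact hf _ (chart_mem_atlas e Q) t ht htU
  have hd : ContDiffAt ℝ ∞ (fun s => f ((chart e Q).symm s)) (chart e Q Q) :=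
    ((Complex.analyticAt_iff_eventually_differentiableAt.2 hev).contDiffAt).restrict_scalars ℝ
  have hx : ContMDiffAt 𝓘(ℝ, ℂ) 𝓘(ℝ, ℂ) ∞ (chart e Q) Q :=
    contMDiffAt_extChartAt (I := 𝓘(ℝ, ℂ)) (x := Q)
  refine (hd.contMDiffAt.comp Q hx).congr_of_eventuallyEq ?_
  filter_upwards [(chart e Q).open_source.mem_nhds hs] with Q' hQ'
  simp only [Function.comp_apply, (chart e Q).left_inv hQ']

theorem contMDiffAt_xCoord {Q : Curve e} (hQ : Q ∈ Set.range (ofAffine e)) :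
    ContMDiffAt 𝓘(ℝ, ℂ) 𝓘(ℝ, ℂ) ∞ (xCoord e) Q :=
  contMDiffAt_of_differentiableAt_symm (isOpenEmbedding_ofAffine e).isOpen_range
    (fun _ hψ _ ht h => ((differentiableAt_coord e hψ ht).1 h).1) hQ

theorem contMDiffAt_zCoord {Q : Curve e} (hQ : Q ∈ Set.range (ofInfinite e)) :
    ContMDiffAt 𝓘(ℝ, ℂ) 𝓘(ℝ, ℂ) ∞ (zCoord e) Q :=
  contMDiffAt_of_differentiableAt_symm (isOpenEmbedding_ofInfinite e).isOpen_range
    (fun _ hψ _ ht h => (differentiableAt_coord e hψ ht).2 h) hQ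

theorem contDiff_denom (hg : 0 < g) : ContDiff ℝ ∞ (denom g) := by
  have h1 : ContDiff ℝ ∞ fun t : ℂ => sigma g (‖t‖ ^ 2) * (1 + ‖t‖ ^ 2) ^ 2 :=
    ((contDiff_sigma g).comp (contDiff_norm_sq ℝ)).mul
      ((contDiff_const.add (contDiff_norm_sq ℝ)).pow 2)
  exact h1.rpow_const_of_ne fun t => (sigma_mul_sq_pos hg t).ne'

open Classical in
/-- The expression of `F_P` in the coordinate `z` is valid on all of `C₀'`. -/
theorem funF_ofInfinite (hg : 0 < g) (P : Curve e) {Q : Curve e}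
    (hQ : Q ∈ Set.range (ofInfinite e)) :
    funF e P Q = (if P ∈ Set.range (ofAffine e) then ‖1 - zCoord e Q * xCoord e P‖
      else ‖zCoord e Q‖) / denom g (zCoord e Q) := by
  obtain ⟨q, rfl⟩ := hQ
  by_cases hq : ofInfinite e q ∈ Set.range (ofAffine e)
  · have hz : q.1.1 ≠ 0 := (ofInfinite_mem_affine e).1 hq
    have hn : ‖q.1.1‖ ≠ 0 := norm_ne_zero_iff.2 hz
    have hx : xCoord e (ofInfinite e q) = q.1.1⁻¹ := rfl
    have hz' : zCoord e (ofInfinite e q) = q.1.1 := rfl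
    simp only [funF, if_pos hq, hx, hz', denom_inv hg hz]
    split_ifs with hP
    · have h1 : q.1.1⁻¹ - xCoord e P = (1 - q.1.1 * xCoord e P) / q.1.1 := by field_simp
      rw [h1, norm_div, div_div_div_cancel_right₀ hn]
    · rw [one_div_div]
  · simp only [funF, if_neg hq]
    split_ifs <;> rfl

theorem eq_or_eq_involution_of_xCoord_eq {P Q : Curve e} (hP : P ∈ Set.range (ofAffine e))
    (hQ : Q ∈ Set.range (ofAffine e)) (h : xCoord e Q = xCoord e P) :
    Q = P ∨ Q = involution e P := by
  obtain ⟨p, rfl⟩ := hP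
  obtain ⟨q, rfl⟩ := hQ
  have hx : q.1.1 = p.1.1 := h
  have hy : q.1.2 ^ 2 = p.1.2 ^ 2 := by rw [q.2, p.2, hx]
  rcases sq_eq_sq_iff_eq_or_eq_neg.1 hy with hy | hy
  · exact .inl (congrArg _ (Subtype.ext (Prod.ext hx hy)))
  · right
    rw [involution_ofAffine]
    exact congrArg _ (Subtype.ext (Prod.ext hx hy))

theorem eq_or_eq_involution_of_zCoord_eq {P Q : Curve e} (hP : P ∈ Set.range (ofInfinite e))
    (hQ : Q ∈ Set.range (ofInfinite e)) (h : zCoord e Q = zCoord e P) :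
    Q = P ∨ Q = involution e P := by
  obtain ⟨p, rfl⟩ := hP
  obtain ⟨q, rfl⟩ := hQ
  have hx : q.1.1 = p.1.1 := h
  have hy : q.1.2 ^ 2 = p.1.2 ^ 2 := by rw [q.2, p.2, hx]
  rcases sq_eq_sq_iff_eq_or_eq_neg.1 hy with hy | hy
  · exact .inl (congrArg _ (Subtype.ext (Prod.ext hx hy)))
  · right
    rw [involution_ofInfinite]
    exact congrArg _ (Subtype.ext (Prod.ext hx hy))

theorem mem_range_ofInfinite {Q : Curve e} (hQ : Q ∉ Set.range (ofAffine e)) :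
    Q ∈ Set.range (ofInfinite e) ∧ zCoord e Q = 0 := by
  rcases exists_eq e Q with h | ⟨q, hq, rfl⟩
  · exact absurd h hQ
  · exact ⟨⟨q, rfl⟩, hq⟩

/-- `F_P` is positive and smooth away from its zeros `P` and `ι(P)`. -/
theorem funF_pos_and_contMDiffAt (hg : 0 < g) {P Q : Curve e} (h1 : Q ≠ P)
    (h2 : Q ≠ involution e P) :
    0 < funF e P Q ∧ ContMDiffAt 𝓘(ℝ, ℂ) 𝓘(ℝ, ℝ) ∞ (funF e P) Q := by
  have hnorm : ∀ {a b t : ℂ}, a + b * t ≠ 0 →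
      ContDiffAt ℝ ∞ (fun t => ‖a + b * t‖ / denom g t) t := fun {a b t} h =>
    ((contDiffAt_const.add (contDiffAt_const.mul contDiffAt_id)).norm ℝ h).div
      (contDiff_denom hg).contDiffAt (denom_pos hg t).ne'
  have hpos : ∀ {a t : ℂ}, a ≠ 0 → 0 < ‖a‖ / denom g t := fun h =>
    div_pos (norm_pos_iff.2 h) (denom_pos hg _)
  -- In each case `F_P` is `‖a + b t‖ / denom g t` for a coordinate `t`.
  have key : ∀ {t : Curve e → ℂ} (a b : ℂ) {U : Set (Curve e)}, IsOpen U → Q ∈ U →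
      ContMDiffAt 𝓘(ℝ, ℂ) 𝓘(ℝ, ℂ) ∞ t Q → a + b * t Q ≠ 0 →
      (∀ Q' ∈ U, funF e P Q' = ‖a + b * t Q'‖ / denom g (t Q')) →
      0 < funF e P Q ∧ ContMDiffAt 𝓘(ℝ, ℂ) 𝓘(ℝ, ℝ) ∞ (funF e P) Q := by
    intro t a b U hU hQU ht h0 hF
    refine ⟨by rw [hF Q hQU]; exact hpos h0, ?_⟩
    refine ((hnorm h0).contMDiffAt.comp Q ht).congr_of_eventuallyEq ?_
    filter_upwards [hU.mem_nhds hQU] with Q' hQ'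
    exact hF Q' hQ'
  have hUa := (isOpenEmbedding_ofAffine e).isOpen_range
  have hUi := (isOpenEmbedding_ofInfinite e).isOpen_range
  by_cases hQ : Q ∈ Set.range (ofAffine e)
  · by_cases hP : P ∈ Set.range (ofAffine e)
    · refine key (-xCoord e P) 1 hUa hQ (contMDiffAt_xCoord hQ) (fun h => ?_) fun Q' hQ' => ?_
      · rcases eq_or_eq_involution_of_xCoord_eq hP hQ (by linear_combination h) with h | h
        · exact h1 h
        · exact h2 h
      · simp only [funF, if_pos hP, if_pos hQ', one_mul, neg_add_eq_sub]
    · refine key 1 0 hUa hQ (contMDiffAt_xCoord hQ) (by simp) fun Q' hQ' => ?_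
      simp only [funF, if_neg hP, if_pos hQ']
      simp
  · obtain ⟨hQi, hQ0⟩ := mem_range_ofInfinite hQ
    by_cases hP : P ∈ Set.range (ofAffine e)
    · refine key 1 (-xCoord e P) hUi hQi (contMDiffAt_zCoord hQi) (by simp [hQ0])
        fun Q' hQ' => ?_
      rw [funF_ofInfinite hg P hQ', if_pos hP]
      congr 2
      ring
    · obtain ⟨hPi, hP0⟩ := mem_range_ofInfinite hP
      rcases eq_or_eq_involution_of_zCoord_eq hPi hQi (hQ0.trans hP0.symm) with h | h
      · exact absurd h h1
      · exact absurd h h2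

theorem contMDiffAt_logF (hg : 0 < g) {E : Divisor e} {Q : Curve e}
    (h : ∀ P ∈ E.support, Q ≠ P ∧ Q ≠ involution e P) :
    ContMDiffAt 𝓘(ℝ, ℂ) 𝓘(ℝ, ℝ) ∞ (logF e E) Q := by
  have hF := fun P hP => funF_pos_and_contMDiffAt hg (h P hP).1 (h P hP).2
  have hsum : ContMDiffAt 𝓘(ℝ, ℂ) 𝓘(ℝ, ℝ) ∞
      (fun Q => ∑ P ∈ E.support, (E P : ℝ) * Real.log (funF e P Q)) Q := by
    refine ContMDiffAt.sum fun P hP => ?_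
    have hl : ContDiffAt ℝ ∞ (fun s => (E P : ℝ) * Real.log s) (funF e P Q) :=
      contDiffAt_const.mul (Real.contDiffAt_log.2 (hF P hP).1.ne')
    exact hl.contMDiffAt.comp Q (hF P hP).2
  refine hsum.congr_of_eventuallyEq ?_
  have hev : ∀ᶠ Q' in 𝓝 Q, ∀ P ∈ E.support, funF e P Q' ≠ 0 :=
    E.support.eventually_all.2 fun P hP => (hF P hP).2.continuousAt.eventually_ne (hF P hP).1.ne'
  filter_upwards [hev] with Q' hQ'
  rw [logF, funFD, Finsupp.prod, Real.log_prod fun P hP => zpow_ne_zero _ (hQ' P hP)]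
  simp only [Real.log_zpow]

theorem alpha_apply (E : Divisor e) (P : Curve e) :
    alpha e E P = E P + E (involution e P) := by
  have h := Finsupp.mapDomain_apply (involution_injective e) E (involution e P)
  rw [involution_involution] at h
  rw [alpha, Finsupp.add_apply, h]

theorem involution_weierstrassPoint (k : Fin (2 * g + 2)) :
    involution e (weierstrassPoint e k) = weierstrassPoint e k := by
  unfold weierstrassPoint
  rw [involution_ofAffine]
  simp

theorem weierstrassPoint_injective : Function.Injective (weierstrassPoint e) := fun _ _ h =>
  e.injective (congrArg (fun p => p.1.1) (ofAffine_injective e h))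

theorem weierstrassDivisor_weierstrassPoint (k : Fin (2 * g + 2)) :
    weierstrassDivisor e (weierstrassPoint e k) = 1 := by
  classical
  simp [weierstrassDivisor, Finsupp.finsetSum_apply, Finsupp.single_apply,
    weierstrassPoint_injective.eq_iff]

theorem weierstrassDivisor_of_forall_ne {P : Curve e} (h : ∀ k, weierstrassPoint e k ≠ P) :
    weierstrassDivisor e P = 0 := by
  classical
  simp [weierstrassDivisor, Finsupp.finsetSum_apply, h]

/-- No cancellation occurs in `α(W - D)`: its coefficients are `2` at the Weierstrass points, and
non-positive elsewhere. -/
theorem mem_support_alpha {D : Divisor e} (hD : 0 ≤ D) (hW : ∀ k, weierstrassPoint e k ∉ D.support)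
    {P : Curve e} (hP : P ∈ (weierstrassDivisor e - D).support) :
    P ∈ (alpha e (weierstrassDivisor e - D)).support ∧
      involution e P ∈ (alpha e (weierstrassDivisor e - D)).support := by
  have h : alpha e (weierstrassDivisor e - D) P ≠ 0 := by
    rw [alpha_apply]
    by_cases hk : ∃ k, weierstrassPoint e k = P
    · obtain ⟨k, rfl⟩ := hk
      rw [involution_weierstrassPoint, Finsupp.sub_apply, weierstrassDivisor_weierstrassPoint,
        Finsupp.notMem_support_iff.1 (hW k)]
      norm_num
    · push Not at hk
      have hk' : ∀ k, weierstrassPoint e k ≠ involution e P := fun k h => hk k <| by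
        rw [← involution_weierstrassPoint, h, involution_involution]
      have h1 := Finsupp.mem_support_iff.1 hP
      have h2 : 0 ≤ D P := hD P
      have h3 : 0 ≤ D (involution e P) := hD _
      rw [Finsupp.sub_apply, weierstrassDivisor_of_forall_ne hk] at h1
      rw [Finsupp.sub_apply, Finsupp.sub_apply, weierstrassDivisor_of_forall_ne hk,
        weierstrassDivisor_of_forall_ne hk']
      omega
  refine ⟨Finsupp.mem_support_iff.2 h, Finsupp.mem_support_iff.2 ?_⟩
  rwa [alpha_apply, involution_involution, add_comm, ← alpha_apply]

end Smooth

/-! ### The three integrals on the curve -/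

section Integrals

variable {g : ℕ} {e : Fin (2 * g + 2) ↪ ℂ}

theorem exists_norm_le_of_contMDiff {φ : Curve e → ℂ} (hφ : ContMDiff 𝓘(ℝ, ℂ) 𝓘(ℝ, ℂ) ∞ φ) :
    ∃ B, ∀ Q, ‖φ Q‖ ≤ B := by
  obtain ⟨B, hB⟩ := (isCompact_range hφ.continuous).isBounded.exists_norm_le
  exact ⟨B, fun Q => hB _ ⟨Q, rfl⟩⟩

open Classical in
theorem ne_xCoord_of_notMem_image {E : Divisor e} {p : PlaneCurve (polyF e)}
    (h : p.1.1 ∉ E.support.image (xCoord e)) :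
    ∀ P ∈ E.support, P ∈ Set.range (ofAffine e) → p.1.1 ≠ xCoord e P :=
  fun P hP _ hx => h (Finset.mem_image.2 ⟨P, hP, hx.symm⟩)

/-- The distributional Laplacian of `log F_E` is integration of `log F_E` against `Δφ`, which is
computed in the plane. -/
theorem integrable_and_integral_logF_mul_laplaceBeltrami (hg : 0 < g) (E : Divisor e)
    {φ : Curve e → ℂ} (hφ : ContMDiff 𝓘(ℝ, ℂ) 𝓘(ℝ, ℂ) ∞ φ) :
    Integrable (fun Q => (logF e E Q : ℂ) * laplaceBeltrami e φ Q) (area e) ∧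
      ∫ Q, (logF e E Q : ℂ) * laplaceBeltrami e φ Q ∂area e =
        2 * Real.pi * diracDelta e (alpha e E) φ -
        degree e E * ((4 * ∫ x, ((1 + ‖x‖ ^ 2) ^ 2)⁻¹ • trace e φ x) +
        (∫ x, Laplacian.laplacian (fun x : ℂ => Real.log (sigma g (‖x‖ ^ 2))) x • trace e φ x) /
          2) / (g + 1) := by
  classical
  obtain ⟨B, hB⟩ := exists_bound_laplaceBeltrami hg hφ
  have hm := measurable_divisorPotential e hg E
  obtain ⟨h1, h2⟩ := integrable_area_and_integral_eq e hm
    (integrable_density_mul_of_singularBound (singularBound_divisorPotential e hg E) hm)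
    (continuousOn_laplaceBeltrami hg hφ) hB
    (h := fun Q => (logF e E Q : ℂ) * laplaceBeltrami e φ Q)
    (A := E.support.image (xCoord e)) fun p _ hpA => by
      rw [logF_ofAffine e hg (ne_xCoord_of_notMem_image hpA), Complex.real_smul]
  refine ⟨h1, h2.trans ?_⟩
  rw [← integral_divisorPotential_smul_laplacian hg hφ]
  refine integral_congr_ae ?_
  filter_upwards [ae_polyF_ne_zero e] with x hx
  rw [← density_mul_laplaceBeltrami hg hφ hx, Complex.real_smul, Complex.real_smul]
  push_cast
  ring

theorem divisorPotential_weierstrassDivisor (x : ℂ) :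
    divisorPotential e (weierstrassDivisor e) x =
      ∑ k, pointPotential e (weierstrassPoint e k) x := by
  change (weierstrassDivisor e).sum (fun P n => (n : ℝ) * pointPotential e P x) = _
  rw [weierstrassDivisor, ← Finsupp.sum_finsetSum_index (fun P => by simp)
    fun P m n => by push_cast; ring]
  refine Finset.sum_congr rfl fun k _ => ?_
  rw [Finsupp.sum_single_index (by simp)]
  simp

/-- `F_W` is the ratio of the area form of the sphere and the area form of the canonical metric. -/
theorem density_mul_exp_divisorPotential (hg : 0 < g) {x : ℂ} (hx : polyF e x ≠ 0) :
    density e x * Real.exp (divisorPotential e (weierstrassDivisor e) x) =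
      ((1 + ‖x‖ ^ 2) ^ 2)⁻¹ := by
  have hs : 0 < sigma g (‖x‖ ^ 2) := sigma_pos hg (by positivity)
  have hr : 0 < 1 + ‖x‖ ^ 2 := by positivity
  have hlog : Real.log ‖polyF e x‖ = ∑ k, Real.log ‖x - e k‖ := by
    rw [polyF, norm_prod, Real.log_prod fun k _ =>
      norm_ne_zero_iff.2 (sub_ne_zero.2 ((polyF_ne_zero_iff e).1 hx k))]
  have hpt : ∀ k, pointPotential e (weierstrassPoint e k) x =
      Real.log ‖x - e k‖ - (Real.log (1 + ‖x‖ ^ 2) / 2 + logSigma g x / (2 * g + 2)) := by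
    intro k
    have hk : weierstrassPoint e k ∈ Set.range (ofAffine e) := ⟨_, rfl⟩
    have hxk : xCoord e (weierstrassPoint e k) = e k := rfl
    rw [pointPotential, if_pos hk, hxk]
    ring
  have hW : divisorPotential e (weierstrassDivisor e) x =
      -(Real.log (density e x) + 2 * Real.log (1 + ‖x‖ ^ 2)) := by
    rw [divisorPotential_weierstrassDivisor, density, Real.log_div hs.ne' (norm_ne_zero_iff.2 hx),
      hlog]
    simp only [hpt, Finset.sum_sub_distrib, Finset.sum_const, Finset.card_univ, Fintype.card_fin,
      nsmul_eq_mul]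
    rw [logSigma, Nat.cast_sub hg]
    push_cast
    field_simp
    ring
  rw [hW, neg_add, Real.exp_add, Real.exp_neg, Real.exp_log (density_pos e hg hx), ← mul_assoc,
    mul_inv_cancel₀ (density_pos e hg hx).ne', one_mul, Real.exp_neg, two_mul, Real.exp_add,
    Real.exp_log hr, pow_two (1 + _)]

/-- `F_D e^v = F_D F_{W - D} = F_W` almost everywhere. -/
theorem integrable_and_integral_funFD_mul (hg : 0 < g) (D : Divisor e)
    {φ : Curve e → ℂ} (hφ : ContMDiff 𝓘(ℝ, ℂ) 𝓘(ℝ, ℂ) ∞ φ) :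
    Integrable (fun Q => ((funFD e D Q * Real.exp (logF e (weierstrassDivisor e - D) Q) : ℝ) : ℂ) *
        φ Q) (area e) ∧
      ∫ Q, ((funFD e D Q * Real.exp (logF e (weierstrassDivisor e - D) Q) : ℝ) : ℂ) *
        φ Q ∂area e = ∫ x, ((1 + ‖x‖ ^ 2) ^ 2)⁻¹ • trace e φ x := by
  classical
  obtain ⟨B, hB⟩ := exists_norm_le_of_contMDiff hφ
  have hae : (fun x => density e x * Real.exp (divisorPotential e (weierstrassDivisor e) x))
      =ᵐ[volume] fun x => ((1 + ‖x‖ ^ 2) ^ 2)⁻¹ := by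
    filter_upwards [ae_polyF_ne_zero e] with x hx
    exact density_mul_exp_divisorPotential hg hx
  have hi : Integrable fun x => density e x *
      |Real.exp (divisorPotential e (weierstrassDivisor e) x)| := by
    simp only [Real.abs_exp]
    exact integrable_one_add_norm_sq_inv_sq.congr hae.symm
  obtain ⟨h1, h2⟩ := integrable_area_and_integral_eq e
    (measurable_divisorPotential e hg (weierstrassDivisor e)).exp hi
    hφ.continuous.continuousOn (fun Q _ => hB Q)
    (h := fun Q => ((funFD e D Q * Real.exp (logF e (weierstrassDivisor e - D) Q) : ℝ) : ℂ) * φ Q)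
    (A := D.support.image (xCoord e) ∪ (weierstrassDivisor e - D).support.image (xCoord e))
    fun p _ hpA => by
      rw [Finset.mem_union, not_or] at hpA
      rw [logF_ofAffine e hg (ne_xCoord_of_notMem_image hpA.2),
        funFD_ofAffine e hg (ne_xCoord_of_notMem_image hpA.1), ← Real.exp_add,
        ← divisorPotential_add, add_sub_cancel, Complex.real_smul]
  refine ⟨h1, h2.trans (integral_congr_ae ?_)⟩
  filter_upwards [hae] with x hx
  rw [hx]
  rfl

/-- The conformal factor in the denominator of `K` cancels the area density. -/
theorem integrable_and_integral_gaussCurvature_mul (hg : 0 < g)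
    {φ : Curve e → ℂ} (hφ : ContMDiff 𝓘(ℝ, ℂ) 𝓘(ℝ, ℂ) ∞ φ) :
    Integrable (fun Q => (gaussCurvature e Q : ℂ) * φ Q) (area e) ∧
      ∫ Q, (gaussCurvature e Q : ℂ) * φ Q ∂area e = -(1 / 2) *
        ∫ x, Laplacian.laplacian (fun x : ℂ => Real.log (sigma g (‖x‖ ^ 2))) x • trace e φ x := by
  obtain ⟨B, hB⟩ := exists_norm_le_of_contMDiff hφ
  set l : ℂ → ℝ := Laplacian.laplacian fun x : ℂ => Real.log (sigma g (‖x‖ ^ 2)) with hl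
  have hle : l = fun x => Laplacian.laplacian (logSigma g) x +
      4 * (g - 1 : ℕ) * ((1 + ‖x‖ ^ 2) ^ 2)⁻¹ := by
    ext x
    rw [laplacian_logSigma hg, sub_add_cancel]
  have hs := smoothOnSphere_logSigma hg
  have hli : Integrable l := by
    rw [hle]
    exact hs.integrable_laplacian.add (integrable_one_add_norm_sq_inv_sq.const_mul _)
  have hlm : Measurable l := by
    have := hs.continuous_laplacian.measurable
    rw [hle]
    fun_prop
  have hm : Measurable fun x => -(1 / 2) * (density e x)⁻¹ * l x :=
    ((measurable_density e).inv.const_mul _).mul hlm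
  have hae : (fun x => density e x * (-(1 / 2) * (density e x)⁻¹ * l x)) =ᵐ[volume]
      fun x => -(1 / 2) * l x := by
    filter_upwards [ae_polyF_ne_zero e] with x hx
    have := (density_pos e hg hx).ne'
    field_simp
  have hi : Integrable fun x => density e x * |-(1 / 2) * (density e x)⁻¹ * l x| := by
    refine ((hli.const_mul (-(1 / 2))).congr hae.symm).abs.congr (Eventually.of_forall fun x => ?_)
    simp only [abs_mul (density e x), abs_of_nonneg (density_nonneg e x)]
  obtain ⟨h1, h2⟩ := integrable_area_and_integral_eq e hm hi hφ.continuous.continuousOn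
    (fun Q _ => hB Q) (h := fun Q => (gaussCurvature e Q : ℂ) * φ Q) (A := ∅) fun p hp _ => by
      rw [gaussCurvature_ofAffine hg p hp, Complex.real_smul]
  refine ⟨h1, h2.trans ?_⟩
  rw [← integral_const_mul]
  refine integral_congr_ae ?_
  filter_upwards [hae] with x hx
  rw [hx, Complex.real_smul, Complex.real_smul, trace, mul_add]
  push_cast
  simp only [sheet]
  ring

end Integrals

end Hyperelliptic

open Hyperelliptic in
theorem mainTheorem6 (g : ℕ) (hg : 2 ≤ g) (e : Fin (2 * g + 2) ↪ ℂ)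
    (D : Divisor e) (hD : 0 ≤ D) (hW : ∀ k, weierstrassPoint e k ∉ D.support)
    (v : Curve e → ℝ) (hv : v = logF e (weierstrassDivisor e - D))
    (S : Finset (Curve e)) (hS : S = (alpha e (weierstrassDivisor e - D)).support)
    (ρ : ℝ) (hρ : ρ = degree e (weierstrassDivisor e - D) / ((g : ℝ) + 1)) :
    ContMDiffOn 𝓘(ℝ, ℂ) 𝓘(ℝ, ℝ) ∞ v (S : Set (Curve e))ᶜ ∧
    ∀ φ : Curve e → ℂ, ContMDiff 𝓘(ℝ, ℂ) 𝓘(ℝ, ℂ) ∞ φ →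
      Integrable (fun Q => (v Q : ℂ) * laplaceBeltrami e φ Q) (area e) ∧
      Integrable (fun Q => ((funFD e D Q * Real.exp (v Q) : ℝ) : ℂ) * φ Q) (area e) ∧
      Integrable (fun Q => (gaussCurvature e Q : ℂ) * φ Q) (area e) ∧
      ∃ Λ : ℂ,
        Tendsto (fun ε : ℝ => ∫ Q in (⋃ P ∈ S, coordDisc e P ε)ᶜ,
          (v Q : ℂ) * laplaceBeltrami e φ Q ∂(area e)) (𝓝[>] 0) (𝓝 Λ) ∧
        Λ + 4 * ρ * ∫ Q, ((funFD e D Q * Real.exp (v Q) : ℝ) : ℂ) * φ Q ∂(area e) =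
          ρ * ∫ Q, (gaussCurvature e Q : ℂ) * φ Q ∂(area e) +
            2 * Real.pi * diracDelta e (alpha e (weierstrassDivisor e - D)) φ := by
  have hg' : 0 < g := by omega
  subst hv hS hρ
  refine ⟨fun Q hQ => (contMDiffAt_logF hg' fun P hP => ?_).contMDiffWithinAt, fun φ hφ => ?_⟩
  · obtain ⟨h1, h2⟩ := mem_support_alpha hD hW hP
    exact ⟨fun h => hQ (h ▸ h1), fun h => hQ (h ▸ h2)⟩
  obtain ⟨i1, e1⟩ :=
    integrable_and_integral_logF_mul_laplaceBeltrami hg' (weierstrassDivisor e - D) hφ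
  obtain ⟨i2, e2⟩ := integrable_and_integral_funFD_mul hg' D hφ
  obtain ⟨i3, e3⟩ := integrable_and_integral_gaussCurvature_mul hg' hφ
  refine ⟨i1, i2, i3, _, tendsto_setIntegral_compl_coordDisc _ i1, ?_⟩
  rw [e1, e2, e3]
  push_cast
  ring
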